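/- Let $K$ be a locally compact, separable, metrizable space, $\mu$ a positive Radon measure on $K$ with full support, and $(\mathcal E,\mathcal F)$ a strong local regular symmetric Dirichlet form on $L^2(K,\mu)$. Write $\mathcal E(f)=\mathcal E(f,f)$ and $\mathcal E_1(f)=\mathcal E(f)+\|f\|_{L^2(\mu)}^2$, and give $\mathcal F$ the norm $\mathcal E_1^{1/2}$. The capacity of an open set $U$ is $\inf\{\mathcal E_1(f): f\in\mathcal F,\ f\ge 1\ \mu\text{-a.e. on }U\}$, and the capacity of a general set is the infimum of the capacities of the open sets containing it. Quasi-continuity and "q.e." (off a set of capacity zero) refer to this capacity, and $\tilde f$ denotes a quasi-continuous Borel modification of $f\in\mathcal F$. For bounded $f\in\mathcal F$, the energy measure $\nu_f$ is the finite Borel measure on $K$ determined by $\int_K\varphi\,d\nu_f=2\mathcal E(f\varphi,f)-\mathcal E(\varphi,f^2)$ for all $\varphi\in\mathcal F\cap C_c(K)$; for general $f\in\mathcal F$, $\nu_f(B)=\lim_n\nu_{f_n}(B)$ for every Borel set $B$, where $f_n\in\mathcal F$ are bounded and $f_n\to f$ in $\mathcal F$. Put $\nu_{f,g}=(\nu_{f+g}-\nu_f-\nu_g)/2$.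 Let $\nu$ be a minimal energy-dominant measure, i.e. a $\sigma$-finite Borel measure with $\nu_f\ll\nu$ for all $f\in\mathcal F$ and with $\nu\ll\nu'$ for every other $\sigma$-finite Borel measure $\nu'$ having this property. For an integer $d\ge1$ and $\boldsymbol h=(h_1,\dots,h_d)\in\mathcal F^d$ put $\nu_{\boldsymbol h}=\frac1d\sum_{i=1}^d\nu_{h_i}$, and let $\Phi_{\boldsymbol h}$ be the matrix-valued function equal to $\bigl(\frac{d\nu_{h_i,h_j}}{d\nu}\big/\frac{d\nu_{\boldsymbol h}}{d\nu}\bigr)_{i,j=1}^d$ on $\{\frac{d\nu_{\boldsymbol h}}{d\nu}>0\}$ and to $0$ elsewhere. Fix a closed set $K^\partial\subset K$, let $\mathcal F_{\mathrm D}=\{f\in\mathcal F:\tilde f=0\text{ q.e. on }K^\partial\}$, and call $h\in\mathcal F$ harmonic if $\mathcal E(h)\le\mathcal E(h+f)$ for all $f\in\mathcal F_{\mathrm D}$; let $\mathcal H$ be the set of harmonic functions. **Proposition.** Let $\boldsymbol h=(h_1,\dots,h_d)\in\mathcal H^d$ be such that $\Phi_{\boldsymbol h}(x)$ is the identity matrix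 for $\nu_{\boldsymbol h}$-a.e. $x$, and let $f\in\mathcal F_{\mathrm D}$ be bounded. Then the push-forward $\tilde{\boldsymbol h}_*(\tilde f^2\nu_{\boldsymbol h})$ of the measure $\tilde f^2\nu_{\boldsymbol h}$ under $\tilde{\boldsymbol h}=(\tilde h_1,\dots,\tilde h_d)\colon K\to\mathbb R^d$ is absolutely continuous with respect to Lebesgue measure on $\mathbb R^d$, and its density $\xi$ satisfies $\sqrt\xi\in W^{1,2}(\mathbb R^d)$. -/

import Mathlib

open MeasureTheory Filter Topology Set
open scoped ENNReal NNReal ContDiff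

noncomputable section

/-- A symmetric Dirichlet form on the real Hilbert space `L²(K, μ)`: a densely defined, symmetric,
nonnegative-definite bilinear form that is closed and on which the unit contraction operates. -/
structure DirichletForm {K : Type*} [MeasurableSpace K] (μ : Measure K) where
  /-- the domain of the form -/
  domain : Submodule ℝ (Lp ℝ 2 μ)
  /-- the bilinear form on its domain -/
  form : domain →ₗ[ℝ] domain →ₗ[ℝ] ℝ
  dense_domain : Dense (domain : Set (Lp ℝ 2 μ))
  symm : ∀ u v : domain, form u v = form v u
  nonneg : ∀ u : domain, 0 ≤ form u u
  /-- the domain is complete for the norm `(form u u + ‖u‖²) ^ (1 / 2)` -/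
  closed : ∀ u : ℕ → domain,
    (∀ ε : ℝ, 0 < ε → ∃ N : ℕ, ∀ m n : ℕ, N ≤ m → N ≤ n →
      form (u m - u n) (u m - u n) + ‖(u m : Lp ℝ 2 μ) - (u n : Lp ℝ 2 μ)‖ ^ 2 < ε) →
    ∃ v : domain, Tendsto
      (fun n => form (u n - v) (u n - v) + ‖(u n : Lp ℝ 2 μ) - (v : Lp ℝ 2 μ)‖ ^ 2) atTop (𝓝 0)
  /-- Markov property -/
  markov : ∀ u : domain, ∃ v : domain,
    (∀ᵐ x ∂μ, (v : Lp ℝ 2 μ) x = min (max ((u : Lp ℝ 2 μ) x) 0) 1) ∧ form v v ≤ form u u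

namespace DirichletForm

section Basic

variable {K : Type*} [MeasurableSpace K] {μ : Measure K} (D : DirichletForm μ)

/-- `E₁(u) = E(u, u) + ‖u‖²`, the square of the norm of the domain. -/
def energyOne (u : D.domain) : ℝ := D.form u u + ‖(u : Lp ℝ 2 μ)‖ ^ 2

/-- The function `w` represents the element `u` of the domain. -/
def Represents (u : D.domain) (w : K → ℝ) : Prop := (u : Lp ℝ 2 μ) =ᵐ[μ] w

/-- `u` is a bounded element of the domain. -/
def IsBdd (u : D.domain) : Prop := ∃ C : ℝ, ∀ᵐ x ∂μ, |(u : Lp ℝ 2 μ) x| ≤ C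

end Basic

section Topological

variable {K : Type*} [TopologicalSpace K] [MeasurableSpace K] {μ : Measure K}
  (D : DirichletForm μ)

/-- The form is regular: the elements of the domain that are represented by a continuous function
with compact support are dense in the domain (for `E₁`), and dense in `C_c(K)`
for the uniform norm. -/
def IsRegular : Prop :=
  (∀ (u : D.domain) (ε : ℝ), 0 < ε → ∃ (p : D.domain) (φ : K → ℝ),
      Continuous φ ∧ HasCompactSupport φ ∧ D.Represents p φ ∧ D.energyOne (u - p) < ε) ∧
  (∀ ψ : K → ℝ, Continuous ψ → HasCompactSupport ψ → ∀ ε : ℝ, 0 < ε →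
      ∃ (p : D.domain) (φ : K → ℝ), Continuous φ ∧ HasCompactSupport φ ∧ D.Represents p φ ∧
        ∀ x, |ψ x - φ x| < ε)

/-- `Supp[u]`, the support of the measure `|u| · μ`. -/
def supp (u : D.domain) : Set K :=
  (μ.withDensity (fun x => ‖(u : Lp ℝ 2 μ) x‖ₑ)).support

/-- The form is strong local: `E(u, v) = 0` whenever `u`, `v` have compact supports and `v` is
constant on a neighborhood of the support of `u`. -/
def IsStrongLocal : Prop :=
  ∀ u v : D.domain, IsCompact (D.supp u) → IsCompact (D.supp v) →
    (∃ U : Set K, IsOpen U ∧ D.supp u ⊆ U ∧ ∃ c : ℝ, ∀ᵐ x ∂μ, x ∈ U → (v : Lp ℝ 2 μ) x = c) →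
    D.form u v = 0

/-- Capacity of an open set (infinite if there is no admissible function). -/
def capOpen (U : Set K) : ℝ≥0∞ :=
  ⨅ (u : D.domain) (_ : ∀ᵐ x ∂μ, x ∈ U → 1 ≤ (u : Lp ℝ 2 μ) x), ENNReal.ofReal (D.energyOne u)

/-- Capacity of an arbitrary set. -/
def cap (B : Set K) : ℝ≥0∞ :=
  ⨅ (U : Set K) (_ : IsOpen U) (_ : B ⊆ U), D.capOpen U

/-- `w` is quasi-continuous: it is continuous off open sets of arbitrarily small capacity. -/
def IsQuasiContinuous (w : K → ℝ) : Prop :=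
  ∀ ε : ℝ≥0∞, 0 < ε → ∃ U : Set K, IsOpen U ∧ D.cap U < ε ∧ ContinuousOn w Uᶜ

/-- `w` is a quasi-continuous Borel modification of `u`. -/
def IsQCModification (u : D.domain) (w : K → ℝ) : Prop :=
  Measurable w ∧ D.IsQuasiContinuous w ∧ D.Represents u w

/-- `F_D`: a quasi-continuous modification of `u` vanishes quasi-everywhere on the
boundary set `S`. -/
def VanishesOn (S : Set K) (u : D.domain) : Prop :=
  ∃ w : K → ℝ, D.IsQCModification u w ∧ D.cap {x | x ∈ S ∧ w x ≠ 0} = 0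

/-- `h` is harmonic with respect to the boundary set `S`: it minimizes the energy among
its perturbations by elements of `F_D`. -/
def IsHarmonic (S : Set K) (h : D.domain) : Prop :=
  ∀ u : D.domain, D.VanishesOn S u → D.form h h ≤ D.form (h + u) (h + u)

/-- `m` is the energy measure of the bounded element `f`: it is the finite Borel measure with
`∫ φ dm = 2 E(f φ, f) - E(φ, f²)` for all `φ` in the domain that are continuous with compact
support. (The products `f φ` and `f²` are again elements of the domain.) -/
def IsEnergyMeasureBdd (f : D.domain) (m : Measure K) : Prop :=
  IsFiniteMeasure m ∧
  ∀ (p : D.domain) (φ : K → ℝ), Continuous φ → HasCompactSupport φ → D.Represents p φ →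
    ∃ fp ff : D.domain,
      D.Represents fp (fun x => (f : Lp ℝ 2 μ) x * φ x) ∧
      D.Represents ff (fun x => (f : Lp ℝ 2 μ) x * (f : Lp ℝ 2 μ) x) ∧
      ∫ x, φ x ∂m = 2 * D.form fp f - D.form p ff

/-- `m` is the energy measure of `f`: it is the finite measure that is the setwise limit of the
energy measures of bounded elements converging to `f` in the domain. -/
def IsEnergyMeasure (f : D.domain) (m : Measure K) : Prop :=
  IsFiniteMeasure m ∧
  ∃ (g : ℕ → D.domain) (k : ℕ → Measure K),
    (∀ n, D.IsBdd (g n)) ∧ (∀ n, D.IsEnergyMeasureBdd (g n) (k n)) ∧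
    Tendsto (fun n => D.energyOne (g n - f)) atTop (𝓝 0) ∧
    ∀ B : Set K, MeasurableSet B → Tendsto (fun n => k n B) atTop (𝓝 (m B))

open scoped Classical in
/-- The energy measure `ν_f` of `f`. For a strong local regular Dirichlet form it always exists
and is unique; the second branch is a mere convention. -/
def energyMeasure (f : D.domain) : Measure K :=
  if H : ∃ m : Measure K, D.IsEnergyMeasure f m then H.choose else 0

instance isFiniteMeasure_energyMeasure (f : D.domain) : IsFiniteMeasure (D.energyMeasure f) := by
  unfold energyMeasure
  split_ifs with H
  · exact H.choose_spec.1
  · infer_instance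

/-- The mutual energy measure `ν_{f,g} = (ν_{f+g} - ν_f - ν_g) / 2`, a signed measure. -/
def mutualEnergyMeasure (f g : D.domain) : SignedMeasure K :=
  (1 / 2 : ℝ) • ((D.energyMeasure (f + g)).toSignedMeasure
    - (D.energyMeasure f).toSignedMeasure - (D.energyMeasure g).toSignedMeasure)

/-- `n` is a minimal energy-dominant measure. -/
def IsMinimalEnergyDominant (n : Measure K) : Prop :=
  SigmaFinite n ∧ (∀ f : D.domain, D.energyMeasure f ≪ n) ∧
  ∀ n' : Measure K, SigmaFinite n' → (∀ f : D.domain, D.energyMeasure f ≪ n') → n ≪ n'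

/-- `ν_𝐟 = (1 / d) ∑ ν_{f_i}` for `𝐟 = (f_1, …, f_d)`. -/
def energyMeasureVec {d : ℕ} (f : Fin d → D.domain) : Measure K :=
  ((d : ℝ≥0)⁻¹) • ∑ i, D.energyMeasure (f i)

open scoped Classical in
/-- The matrix `Φ_𝐟 = ((dν_{f_i,f_j}/dn) / (dν_𝐟/dn))_{i,j}` on `{dν_𝐟/dn > 0}`,
and `0` elsewhere. -/
def Phi (n : Measure K) {d : ℕ} (f : Fin d → D.domain) (x : K) : Matrix (Fin d) (Fin d) ℝ :=
  if 0 < ((D.energyMeasureVec f).rnDeriv n x).toReal then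
    Matrix.of fun i j => (D.mutualEnergyMeasure (f i) (f j)).rnDeriv n x
      / ((D.energyMeasureVec f).rnDeriv n x).toReal
  else 0

end Topological

end DirichletForm

/-- `u ∈ W^{1,2}(ℝ^d)`: `u` and its weak first partial derivatives are square integrable. -/
def MemW12 {d : ℕ} (u : EuclideanSpace ℝ (Fin d) → ℝ) : Prop :=
  MemLp u 2 volume ∧
  ∀ i : Fin d, ∃ g : EuclideanSpace ℝ (Fin d) → ℝ, MemLp g 2 volume ∧
    ∀ φ : EuclideanSpace ℝ (Fin d) → ℝ, ContDiff ℝ ∞ φ → HasCompactSupport φ →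
      ∫ y, u y * fderiv ℝ φ y (EuclideanSpace.single i 1) = - ∫ y, g y * φ y

end

/-! The theorem rests on one inequality. For a product `G(y) = ∏ g_j(y_j)` of compactly supported
`C¹` functions, the function `A = f² G(h̃)` lies in `F_D`, so `E(A, h_i) = 0` because `h_i` is
harmonic. For a strong local form, `2 E(u, v)` is the total mass of `ν_{u,v}`, and mutual energy
measures obey the Leibniz and chain rules. Expanding `ν_{A,h_i}(K) = 0` gives `∑_k ∫ f² ∂_k G(h̃)
dν_{h_k,h_i} = -2 ∫ f G(h̃) dν_{f,h_i}`. Since `Φ_h` is the identity, `ν_{h_k,h_i}` is `ν_h` for `k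
= i` and `0` otherwise, so only `∂_i` remains. The Kunita-Watanabe inequality then yields, with `κ`
the push-forward of `f² ν_h` and `η` that of `ν_f`, `(∫ ∂_i G dκ)² ≤ 4 ∫ |G| dη ∫ |G| dκ`. This is
`IsStrongLocal.exists_derivative_estimate`, the only link between the Dirichlet form and Euclidean
space.

The rest is analysis on `ℝ^d`. Let `p_n`, `q_n` be the convolutions of `κ`, `η` with a product
mollifier. Translating the inequality gives `(∂_i p_n)² ≤ 4 q_n p_n`, that is, `(∂_i √p_n)² ≤ q_n`
up to a regularization of the root, and `∫ q_n = η(ℝ^d)`. Also `|∂_i p_n| ≤ q_n + p_n`; as the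
difference of two one-dimensional mollifiers is the derivative of a function with small integral,
the `p_n` are Cauchy in `L¹` (`DerivativeEstimate.integral_abs_sub_le`). Their limit `ξ` is the
density of `κ`, and the uniform `L²` bound on the gradients of the roots passes to `√ξ` by duality
(`DerivativeEstimate.memW12_sqrt`).

The calculus of energy measures is developed from the definition of a Dirichlet form. Resolvents
approximate `E` by bounded forms which, on simple functions, are finite sums of squared differences
with nonnegative weights (`IsSymmMarkov.sum_nonneg`); pointwise inequalities thereby become energy
inequalities, giving contraction, positivity and mass bounds. Riesz extension and representation
produce the energy measures (`IsRegular.exists_energyMeasure`), and `IsRegular.integral_nuB` extends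
their defining formula to quasi-continuous functions. The Leibniz rule amounts to the vanishing of a
symmetric four-linear expression (`IsStrongLocal.quart_eq_zero`), obtained by slicing a function
into thin layers that do not interact. -/

noncomputable section

set_option linter.unusedSectionVars false

namespace DirichletForm

/-! ### Resolvents, approximating forms and weak convergence in the domain. -/

section Hilbert

variable {K : Type*} [MeasurableSpace K] {μ : Measure K} (D : DirichletForm μ)

lemma form_sq_le (u v : D.domain) : D.form u v ^ 2 ≤ D.form u u * D.form v v :=
  LinearMap.BilinForm.apply_sq_le_of_symm D.form D.nonneg ⟨fun u v => D.symm u v⟩ u v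

lemma abs_form_le (u v : D.domain) : |D.form u v| ≤ √(D.form u u) * √(D.form v v) := by
  rw [← Real.sqrt_mul (D.nonneg u)]
  exact Real.abs_le_sqrt (D.form_sq_le u v)

lemma form_add_add (u v : D.domain) :
    D.form (u + v) (u + v) = D.form u u + 2 * D.form u v + D.form v v := by
  simp only [map_add, LinearMap.add_apply, D.symm v u]; ring

lemma form_sub_sub (u v : D.domain) :
    D.form (u - v) (u - v) = D.form u u - 2 * D.form u v + D.form v v := by
  simp only [map_sub, LinearMap.sub_apply, D.symm v u]; ring

lemma form_add_le (u v : D.domain) :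
    D.form (u + v) (u + v) ≤ 2 * D.form u u + 2 * D.form v v := by
  have := D.nonneg (u - v)
  rw [form_sub_sub] at this
  rw [form_add_add]; linarith

lemma form_sub_le (u v : D.domain) :
    D.form (u - v) (u - v) ≤ 2 * D.form u u + 2 * D.form v v := by
  have := D.nonneg (u + v)
  rw [form_add_add] at this
  rw [form_sub_sub]; linarith

lemma form_smul_smul (t : ℝ) (u v : D.domain) :
    D.form (t • u) (t • v) = t ^ 2 * D.form u v := by
  simp only [map_smul, LinearMap.smul_apply, smul_eq_mul]; ring

lemma form_le_energyOne (u : D.domain) : D.form u u ≤ D.energyOne u := by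
  unfold energyOne; nlinarith [sq_nonneg ‖(u : Lp ℝ 2 μ)‖]

lemma energyOne_nonneg (u : D.domain) : 0 ≤ D.energyOne u :=
  (D.nonneg u).trans (D.form_le_energyOne u)

lemma energyOne_add_le (u v : D.domain) :
    D.energyOne (u + v) ≤ 2 * D.energyOne u + 2 * D.energyOne v := by
  unfold energyOne
  have h1 := D.form_add_le u v
  have h2 := parallelogram_law_with_norm ℝ (u : Lp ℝ 2 μ) v
  push_cast at *
  nlinarith [norm_nonneg ((u : Lp ℝ 2 μ) - v)]

lemma energyOne_smul (t : ℝ) (u : D.domain) : D.energyOne (t • u) = t ^ 2 * D.energyOne u := by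
  unfold energyOne
  rw [form_smul_smul]
  simp [norm_smul, mul_pow]; ring

lemma energyOne_neg (u : D.domain) : D.energyOne (-u) = D.energyOne u := by
  unfold energyOne; simp

/-- The domain, to be equipped with the inner product `E(u, v) + (n + 1) ⟪u, v⟫`. -/
def Hil (D : DirichletForm μ) (_n : ℕ) : Type _ := D.domain

instance (n : ℕ) : AddCommGroup (D.Hil n) := inferInstanceAs (AddCommGroup D.domain)
instance (n : ℕ) : Module ℝ (D.Hil n) := inferInstanceAs (Module ℝ D.domain)

/-- The inclusion of the domain into `L²`. -/
def hilIncl (n : ℕ) : D.Hil n →ₗ[ℝ] Lp ℝ 2 μ := D.domain.subtype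

/-- The form on `D.Hil n`. -/
def hilForm (n : ℕ) : D.Hil n →ₗ[ℝ] D.Hil n →ₗ[ℝ] ℝ := D.form

lemma hilIncl_injective (n : ℕ) : Function.Injective (D.hilIncl n) := D.domain.subtype_injective

/-- The type synonym depends on `n` so that the inner products for different shifts do not collide
as instances. The shift `n + 1` is positive for every `n`, which keeps the pairing definite where
`E` degenerates. -/
instance hilCore (n : ℕ) : InnerProductSpace.Core ℝ (D.Hil n) where
  inner u v := D.hilForm n u v + (n + 1) * inner ℝ (D.hilIncl n u) (D.hilIncl n v)
  conj_inner_symm u v := by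
    have : D.hilForm n v u = D.hilForm n u v := D.symm v u
    simp [this, real_inner_comm]
  re_inner_nonneg u := by
    have : 0 ≤ D.hilForm n u u := D.nonneg u
    have h2 : 0 ≤ inner ℝ (D.hilIncl n u) (D.hilIncl n u) := real_inner_self_nonneg
    simp only [RCLike.re_to_real]
    positivity
  add_left u v w := by
    simp only [map_add, LinearMap.add_apply, inner_add_left]; ring
  smul_left u v r := by
    simp only [map_smul, LinearMap.smul_apply, real_inner_smul_left, smul_eq_mul, conj_trivial]
    ring
  definite u hu := by
    have h1 : 0 ≤ D.hilForm n u u := D.nonneg u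
    have h2 : 0 ≤ inner ℝ (D.hilIncl n u) (D.hilIncl n u) := real_inner_self_nonneg
    have h3 : (0 : ℝ) < n + 1 := by positivity
    have h4 : inner ℝ (D.hilIncl n u) (D.hilIncl n u) = 0 := by
      change D.hilForm n u u + (n + 1) * inner ℝ (D.hilIncl n u) (D.hilIncl n u) = 0 at hu
      nlinarith [mul_nonneg h3.le h2]
    have h5 : D.hilIncl n u = 0 := inner_self_eq_zero.1 h4
    exact D.hilIncl_injective n (by rw [h5, map_zero])

instance (n : ℕ) : NormedAddCommGroup (D.Hil n) := (D.hilCore n).toNormedAddCommGroup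
instance (n : ℕ) : InnerProductSpace ℝ (D.Hil n) := InnerProductSpace.ofCore (D.hilCore n).toCore

lemma hil_inner (n : ℕ) (u v : D.Hil n) :
    inner ℝ u v = D.hilForm n u v + (n + 1) * inner ℝ (D.hilIncl n u) (D.hilIncl n v) := rfl

lemma hil_norm_sq (n : ℕ) (u : D.Hil n) :
    ‖u‖ ^ 2 = D.hilForm n u u + (n + 1) * ‖D.hilIncl n u‖ ^ 2 := by
  rw [← real_inner_self_eq_norm_sq, ← real_inner_self_eq_norm_sq, hil_inner]

lemma hil_norm_sq_le (n : ℕ) (u : D.Hil n) : ‖u‖ ^ 2 ≤ (n + 1) * D.energyOne u := by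
  rw [hil_norm_sq]
  have h1 : 0 ≤ D.hilForm n u u := D.nonneg u
  have h2 : D.energyOne u = D.hilForm n u u + ‖D.hilIncl n u‖ ^ 2 := rfl
  rw [h2]
  nlinarith [mul_nonneg (Nat.cast_nonneg (α := ℝ) n) h1]

lemma energyOne_le_hil_norm_sq (n : ℕ) (u : D.Hil n) : D.energyOne u ≤ ‖u‖ ^ 2 := by
  rw [hil_norm_sq]
  have h2 : D.energyOne u = D.hilForm n u u + ‖D.hilIncl n u‖ ^ 2 := rfl
  rw [h2]
  nlinarith [mul_nonneg (Nat.cast_nonneg (α := ℝ) n) (sq_nonneg ‖D.hilIncl n u‖)]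

instance (n : ℕ) : CompleteSpace (D.Hil n) := by
  refine Metric.complete_of_cauchySeq_tendsto fun u hu => ?_
  obtain ⟨v, hv⟩ := D.closed u (fun ε hε => by
    obtain ⟨N, hN⟩ := Metric.cauchySeq_iff.1 hu (√ε) (Real.sqrt_pos.2 hε)
    refine ⟨N, fun m k hm hk => ?_⟩
    have h1 := hN m hm k hk
    rw [dist_eq_norm] at h1
    have h2 : ‖u m - u k‖ ^ 2 < ε := by
      rw [← Real.sq_sqrt hε.le]; exact pow_lt_pow_left₀ h1 (norm_nonneg _) two_ne_zero
    exact (D.energyOne_le_hil_norm_sq n (u m - u k)).trans_lt h2)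
  refine ⟨v, tendsto_iff_norm_sub_tendsto_zero.2 ?_⟩
  have h3 : Tendsto (fun k => (n + 1 : ℝ) * D.energyOne ((show D.domain from u k) - v)) atTop (𝓝 0) := by
    have := hv.const_mul (n + 1 : ℝ)
    rw [mul_zero] at this
    exact this
  have h4 : Tendsto (fun k => ‖u k - (show D.Hil n from v)‖ ^ 2) atTop (𝓝 0) :=
    squeeze_zero (fun k => sq_nonneg _) (fun k => D.hil_norm_sq_le n _) h3
  have := h4.sqrt
  simpa [Real.sqrt_sq] using this

/-- The inclusion into `L²` as a bounded operator. -/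
def hilInclL (n : ℕ) : D.Hil n →L[ℝ] Lp ℝ 2 μ :=
  (D.hilIncl n).mkContinuous 1 fun u => by
    rw [one_mul]
    refine abs_le_of_sq_le_sq' ?_ (norm_nonneg _) |>.2
    have h1 : 0 ≤ D.hilForm n u u := D.nonneg u
    rw [hil_norm_sq]
    nlinarith [mul_nonneg (Nat.cast_nonneg (α := ℝ) n) (sq_nonneg ‖D.hilIncl n u‖)]

/-- `T_n = (n + 1) G_{n + 1}`, where `G_α` is the resolvent of the form. -/
def res (n : ℕ) : Lp ℝ 2 μ →ₗ[ℝ] D.domain :=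
  -- The adjoint of the inclusion is `G_{n+1}`: its value at `g` represents the functional `v ↦ ⟪g,
  -- v⟫` in the inner product of `Hil n`.
  ((n + 1 : ℝ) • ((D.hilInclL n).adjoint : Lp ℝ 2 μ →ₗ[ℝ] D.Hil n) : Lp ℝ 2 μ →ₗ[ℝ] D.Hil n)

/-- The resolvent equation with the `L²` term moved to the right. It exhibits the approximating form
`(n + 1) ⟪g - T_n g, v⟫` as an energy, and the energy of a resolvent element as an `L²` inner
product. -/
lemma form_res (n : ℕ) (g : Lp ℝ 2 μ) (v : D.domain) :
    D.form (D.res n g) v = (n + 1) * inner ℝ (g - D.res n g) (v : Lp ℝ 2 μ) := by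
  have h1 : inner ℝ ((D.hilInclL n).adjoint g) (show D.Hil n from v) = inner ℝ g (v : Lp ℝ 2 μ) :=
    ContinuousLinearMap.adjoint_inner_left (D.hilInclL n) v g
  have h2 : inner ℝ (show D.Hil n from D.res n g) (show D.Hil n from v)
      = (n + 1) * inner ℝ g (v : Lp ℝ 2 μ) := by
    rw [← h1, ← real_inner_smul_left]; rfl
  rw [hil_inner] at h2
  change D.form (D.res n g) v + (n + 1) * inner ℝ (D.res n g : Lp ℝ 2 μ) (v : Lp ℝ 2 μ) = _ at h2
  rw [inner_sub_left]; linarith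

lemma inner_res_comm (n : ℕ) (f g : Lp ℝ 2 μ) :
    inner ℝ (D.res n f : Lp ℝ 2 μ) g = inner ℝ f (D.res n g : Lp ℝ 2 μ) := by
  have h1 := D.form_res n f (D.res n g)
  have h2 := D.form_res n g (D.res n f)
  rw [D.symm, h1, inner_sub_left, inner_sub_left, real_inner_comm (D.res n f : Lp ℝ 2 μ) (D.res n g),
    real_inner_comm (D.res n f : Lp ℝ 2 μ) g] at h2
  have : (0 : ℝ) < n + 1 := by positivity
  have := mul_left_cancel₀ this.ne' h2
  linarith

/-- The approximating forms increase to the form: a bound for the resolvent. -/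
lemma form_res_res_le (n : ℕ) (w : Lp ℝ 2 μ) :
    D.form (D.res n w) (D.res n w) ≤ (n + 1) * (inner ℝ w w - inner ℝ (D.res n w : Lp ℝ 2 μ) w) ∧
    (n + 1) * ‖w - D.res n w‖ ^ 2 ≤ (n + 1) * (inner ℝ w w - inner ℝ (D.res n w : Lp ℝ 2 μ) w) := by
  have h1 := D.form_res n w (D.res n w)
  have h0 := D.nonneg (D.res n w)
  have h2 : inner ℝ w w - inner ℝ (D.res n w : Lp ℝ 2 μ) w
      = inner ℝ (w - D.res n w) (D.res n w : Lp ℝ 2 μ) + ‖w - D.res n w‖ ^ 2 := by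
    rw [← inner_sub_left, ← real_inner_self_eq_norm_sq, ← inner_add_right]; simp
  have h3 : (0:ℝ) < n + 1 := by positivity
  rw [h2, mul_add, ← h1]
  constructor
  · nlinarith [sq_nonneg ‖w - D.res n w‖]
  · linarith

/-- Positivity of `E` at `u - T_n u` gives `2 E(T_n u, u) ≤ E(u, u) + E(T_n u, T_n u)`, and the last
term is at most `E(T_n u, u)` by the resolvent equation. -/
lemma form_res_self_le (n : ℕ) (u : D.domain) :
    D.form (D.res n u) (D.res n u) ≤ D.form u u ∧
    (n + 1) * ‖(u : Lp ℝ 2 μ) - D.res n u‖ ^ 2 ≤ D.form u u ∧ D.form (D.res n u) u ≤ D.form u u := by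
  obtain ⟨h1, h2⟩ := D.form_res_res_le n u
  have h3 := D.form_res n u u
  rw [inner_sub_left] at h3
  rw [← h3] at h1 h2
  have h4 := D.nonneg (u - D.res n u)
  rw [form_sub_sub, D.symm u (D.res n u)] at h4
  have h5 : D.form (D.res n u) u ≤ D.form u u := by linarith
  exact ⟨h1.trans h5, h2.trans h5, h5⟩

/-- Elements of the form `G_1 g` are dense in the domain. -/
lemma exists_res_approx (v : D.domain) {ε : ℝ} (hε : 0 < ε) :
    ∃ g : Lp ℝ 2 μ, D.energyOne (v - D.res 0 g) < ε := by
  have h1 : (LinearMap.range ((D.hilInclL 0).adjoint : Lp ℝ 2 μ →ₗ[ℝ] D.Hil 0)).topologicalClosure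
      = ⊤ := by
    rw [Submodule.topologicalClosure_eq_top_iff, Submodule.eq_bot_iff]
    intro w hw
    -- Orthogonality is tested on the image of `w` itself, which returns the squared `L²` norm of
    -- `w`.
    have h2 := (Submodule.mem_orthogonal _ _).1 hw ((D.hilInclL 0).adjoint (D.hilInclL 0 w)) ⟨_, rfl⟩
    rw [ContinuousLinearMap.adjoint_inner_left] at h2
    have h3 : D.hilIncl 0 w = 0 := inner_self_eq_zero.1 h2
    exact D.hilIncl_injective 0 (by rw [h3, map_zero])
  have h2 : (show D.Hil 0 from v) ∈ closure
      (LinearMap.range ((D.hilInclL 0).adjoint : Lp ℝ 2 μ →ₗ[ℝ] D.Hil 0) : Set (D.Hil 0)) := by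
    rw [← Submodule.topologicalClosure_coe, h1]; trivial
  obtain ⟨_, ⟨g, rfl⟩, hg⟩ := Metric.mem_closure_iff.1 h2 (√ε) (Real.sqrt_pos.2 hε)
  refine ⟨g, ?_⟩
  rw [dist_eq_norm] at hg
  have h3 : ‖(show D.Hil 0 from v) - (D.hilInclL 0).adjoint g‖ ^ 2 < ε := by
    rw [← Real.sq_sqrt hε.le]; exact pow_lt_pow_left₀ hg (norm_nonneg _) two_ne_zero
  have h4 : D.res 0 g = ((D.hilInclL 0).adjoint g) := by
    change ((0 : ℕ) + 1 : ℝ) • (D.hilInclL 0).adjoint g = _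
    simp
  rw [h4]
  exact (D.energyOne_le_hil_norm_sq 0 _).trans_lt h3

/-- Energy-bounded families converging to `0` in `L²` converge weakly to `0`. -/
lemma tendsto_form_of_bounded {ι : Type*} {l : Filter ι} {w : ι → D.domain} {C : ℝ}
    (hC : ∀ i, D.form (w i) (w i) ≤ C) (hw : Tendsto (fun i => ‖(w i : Lp ℝ 2 μ)‖) l (𝓝 0))
    (v : D.domain) : Tendsto (fun i => D.form (w i) v) l (𝓝 0) := by
  rw [Metric.tendsto_nhds]
  intro ε hε
  have hC' : 0 < |C| + 1 := by positivity
  obtain ⟨g, hg⟩ := D.exists_res_approx v (ε := (ε / 2) ^ 2 / (|C| + 1)) (by positivity)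
  set p := D.res 0 g
  -- Against the resolvent element `p` the energy is an `L²` inner product, so `L²` convergence
  -- suffices; the remainder `v - p` is absorbed by Cauchy-Schwarz and the energy bound.
  have hp : ∀ i, |D.form (w i) p| ≤ ‖g - p‖ * ‖(w i : Lp ℝ 2 μ)‖ := by
    intro i
    have := D.form_res 0 g (w i)
    rw [D.symm, this]
    simpa using abs_real_inner_le_norm (g - p) (w i : Lp ℝ 2 μ)
  have h1 : ∀ᶠ i in l, ‖g - p‖ * ‖(w i : Lp ℝ 2 μ)‖ < ε / 2 := by
    have : Tendsto (fun i => ‖g - p‖ * ‖(w i : Lp ℝ 2 μ)‖) l (𝓝 0) := by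
      simpa using hw.const_mul ‖g - p‖
    exact this.eventually (gt_mem_nhds (by positivity))
  filter_upwards [h1] with i hi
  have h2 : |D.form (w i) (v - p)| ≤ ε / 2 := by
    refine abs_le_of_sq_le_sq ?_ (by positivity)
    refine (D.form_sq_le _ _).trans ?_
    have h3 := (D.form_le_energyOne (v - p)).trans hg.le
    calc _ ≤ (|C| + 1) * ((ε / 2) ^ 2 / (|C| + 1)) :=
          mul_le_mul ((hC i).trans (by linarith [le_abs_self C])) h3 (D.nonneg _) hC'.le
      _ = _ := by field_simp
  rw [Real.dist_eq, sub_zero]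
  have h4 : D.form (w i) v = D.form (w i) (v - p) + D.form (w i) p := by
    rw [← map_add, sub_add_cancel]
  rw [h4]
  calc _ ≤ _ := abs_add_le _ _
    _ < ε := by linarith [hp i]

lemma tendsto_form_of_bounded' {ι : Type*} {l : Filter ι} {w : ι → D.domain} {u : D.domain} {C : ℝ}
    (hC : ∀ i, D.form (w i) (w i) ≤ C)
    (hw : Tendsto (fun i => ‖(w i : Lp ℝ 2 μ) - u‖) l (𝓝 0))
    (v : D.domain) : Tendsto (fun i => D.form (w i) v) l (𝓝 (D.form u v)) := by
  have := D.tendsto_form_of_bounded (w := fun i => w i - u) (C := 2 * C + 2 * D.form u u)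
    (fun i => (D.form_sub_le _ _).trans (by linarith [hC i])) (by simpa using hw) v
  simpa using this.add_const (D.form u v)

/-- Strong convergence from `L²`-convergence and convergence of upper bounds of the energies. -/
lemma tendsto_energyOne_of_le {ι : Type*} {l : Filter ι} {w : ι → D.domain} {u : D.domain} {C : ℝ}
    (hC : ∀ i, D.form (w i) (w i) ≤ C) {a : ι → ℝ} (ha : Tendsto a l (𝓝 (D.form u u)))
    (hwa : ∀ i, D.form (w i) (w i) ≤ a i)
    (hw : Tendsto (fun i => ‖(w i : Lp ℝ 2 μ) - u‖) l (𝓝 0)) :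
    Tendsto (fun i => D.energyOne (w i - u)) l (𝓝 0) := by
  have h1 := D.tendsto_form_of_bounded' hC hw u
  have h2 : Tendsto (fun i => a i - 2 * D.form (w i) u + D.form u u + ‖(w i : Lp ℝ 2 μ) - u‖ ^ 2) l
      (𝓝 (D.form u u - 2 * D.form u u + D.form u u + 0 ^ 2)) :=
    ((ha.sub (h1.const_mul 2)).add_const _).add (hw.pow 2)
  have h3 : D.form u u - 2 * D.form u u + D.form u u + 0 ^ 2 = 0 := by ring
  rw [h3] at h2
  refine squeeze_zero (fun i => D.energyOne_nonneg _) (fun i => ?_) h2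
  unfold energyOne
  rw [form_sub_sub]
  push_cast
  linarith [hwa i]

/-- The domain contains the `L²`-limits of its energy-bounded sequences. -/
lemma mem_domain_of_bounded {u : ℕ → D.domain} {C : ℝ} (hC : ∀ i, D.form (u i) (u i) ≤ C)
    {g : Lp ℝ 2 μ} (hg : Tendsto (fun i => (u i : Lp ℝ 2 μ)) atTop (𝓝 g)) : g ∈ D.domain := by
  have hC0 : 0 ≤ C := (D.nonneg _).trans (hC 0)
  have hcau : ∀ v : D.domain, ∃ a, Tendsto (fun i => D.form (u i) v) atTop (𝓝 a) := by
    intro v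
    refine cauchySeq_tendsto_of_complete ?_
    have h1 : Tendsto (fun p : ℕ × ℕ => ‖((u p.1 - u p.2 : D.domain) : Lp ℝ 2 μ)‖)
        (atTop ×ˢ atTop) (𝓝 0) := by
      have := ((hg.comp tendsto_fst).sub (hg.comp tendsto_snd)).norm (l := atTop ×ˢ atTop)
      simpa using this
    have h2 := D.tendsto_form_of_bounded (w := fun p : ℕ × ℕ => u p.1 - u p.2) (C := 4 * C)
      (fun p => (D.form_sub_le _ _).trans (by linarith [hC p.1, hC p.2])) h1 v
    rw [cauchySeq_iff_tendsto_dist_atTop_0]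
    rw [prod_atTop_atTop_eq] at h2
    have := h2.abs
    simpa [Real.dist_eq] using this
  choose ℓ hℓ using hcau
  have hinner : ∀ v : D.domain, Tendsto (fun i => inner ℝ (u i : Lp ℝ 2 μ) (v : Lp ℝ 2 μ)) atTop
      (𝓝 (inner ℝ g (v : Lp ℝ 2 μ))) := fun v => hg.inner tendsto_const_nhds
  -- The limits of `E(u i, ·)` form a bounded functional on `Hil 0`. Its Riesz representative `z` is
  -- identified with `g` by testing on the range of the adjoint, where the inner product of `Hil 0`
  -- reduces to that of `L²`.
  let L : D.Hil 0 →ₗ[ℝ] ℝ :=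
    { toFun := fun v => ℓ v + inner ℝ g (D.hilIncl 0 v)
      map_add' := fun v w => by
        have h1 : ℓ (v + w) = ℓ v + ℓ w := tendsto_nhds_unique (hℓ (v + w)) (by
          have := (hℓ v).add (hℓ w)
          refine this.congr fun i => ?_
          exact (map_add (D.form (u i)) _ _).symm)
        rw [h1, map_add, inner_add_right]; ring
      map_smul' := fun t v => by
        have h1 : ℓ (t • v) = t * ℓ v := tendsto_nhds_unique (hℓ (t • v)) (by
          have := (hℓ v).const_mul t
          refine this.congr fun i => ?_
          exact (map_smul (D.form (u i)) t _).symm)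
        rw [h1, map_smul, real_inner_smul_right]; simp; ring }
  have hL : ∀ v, ‖L v‖ ≤ (√C + ‖g‖) * ‖v‖ := by
    intro v
    have h1 : |ℓ v| ≤ √C * √(D.form v v) := by
      refine le_of_tendsto (hℓ v).abs (Eventually.of_forall fun i => ?_)
      exact (D.abs_form_le _ _).trans (by gcongr; exact hC i)
    have h2 : √(D.form v v) ≤ ‖v‖ := Real.sqrt_le_iff.2 ⟨norm_nonneg _, 
      (D.form_le_energyOne v).trans (D.energyOne_le_hil_norm_sq 0 v)⟩
    have h3 : ‖D.hilIncl 0 v‖ ≤ ‖v‖ := by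
      refine abs_le_of_sq_le_sq' ?_ (norm_nonneg _) |>.2
      have h1 : 0 ≤ D.hilForm 0 v v := D.nonneg v
      rw [hil_norm_sq]
      simp; linarith
    calc ‖L v‖ ≤ |ℓ v| + |inner ℝ g (D.hilIncl 0 v)| := abs_add_le _ _
      _ ≤ √C * √(D.form v v) + ‖g‖ * ‖D.hilIncl 0 v‖ := add_le_add h1 (abs_real_inner_le_norm _ _)
      _ ≤ √C * ‖v‖ + ‖g‖ * ‖v‖ := by gcongr
      _ = _ := by ring
  let L' := L.mkContinuous _ hL
  let z : D.Hil 0 := (InnerProductSpace.toDual ℝ (D.Hil 0)).symm L'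
  have hz : ∀ v, inner ℝ z v = L v := fun v => InnerProductSpace.toDual_symm_apply
  have key : ∀ g' : Lp ℝ 2 μ, inner ℝ (D.hilIncl 0 z) g' = inner ℝ g g' := by
    intro g'
    have h1 := hz ((D.hilInclL 0).adjoint g')
    rw [ContinuousLinearMap.adjoint_inner_right] at h1
    set p : D.domain := ((D.hilInclL 0).adjoint g' : D.Hil 0)
    have h3 : ∀ i, D.form (u i) p + inner ℝ (u i : Lp ℝ 2 μ) (p : Lp ℝ 2 μ)
        = inner ℝ (u i : Lp ℝ 2 μ) g' := by
      intro i
      have := ContinuousLinearMap.adjoint_inner_right (D.hilInclL 0) (show D.Hil 0 from u i) g'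
      rw [hil_inner] at this
      simp only [Nat.cast_zero, zero_add, one_mul] at this
      exact this
    have h4 : ℓ p + inner ℝ g (p : Lp ℝ 2 μ) = inner ℝ g g' :=
      tendsto_nhds_unique (((hℓ p).add (hinner p)).congr h3) (hg.inner tendsto_const_nhds)
    exact h1.trans h4
  have : D.hilIncl 0 z = g := ext_inner_right ℝ key
  rw [← this]
  exact Subtype.mem (show D.domain from z)

lemma tendsto_res (u : D.domain) :
    Tendsto (fun n => ‖(D.res n u : Lp ℝ 2 μ) - u‖) atTop (𝓝 0) := by
  have h1 : Tendsto (fun n : ℕ => √(D.form u u / (n + 1))) atTop (𝓝 0) := by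
    have : Tendsto (fun n : ℕ => D.form u u / ((n : ℝ) + 1)) atTop (𝓝 0) :=
      tendsto_const_nhds.div_atTop (tendsto_natCast_atTop_atTop.atTop_add tendsto_const_nhds)
    simpa using this.sqrt
  refine squeeze_zero (fun n => norm_nonneg _) (fun n => ?_) h1
  refine Real.le_sqrt_of_sq_le ?_
  rw [le_div_iff₀ (by positivity), norm_sub_rev, mul_comm]
  exact (D.form_res_self_le n u).2.1

/-- The approximating forms converge to the form. -/
lemma tendsto_approxForm (u v : D.domain) :
    Tendsto (fun n : ℕ => (n + 1 : ℝ) * (inner ℝ (u : Lp ℝ 2 μ) (v : Lp ℝ 2 μ)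
      - inner ℝ (D.res n u : Lp ℝ 2 μ) (v : Lp ℝ 2 μ))) atTop (𝓝 (D.form u v)) := by
  have := D.tendsto_form_of_bounded' (w := fun n => D.res n u)
    (fun n => (D.form_res_self_le n u).1) (D.tendsto_res u) v
  refine this.congr fun n => ?_
  rw [form_res, inner_sub_left]

/-- An `L²`-function with bounded approximating energies belongs to the domain. -/
lemma mem_domain_of_approxForm_le {w : Lp ℝ 2 μ} {C : ℝ}
    (hw : ∀ n : ℕ, (n + 1 : ℝ) * (inner ℝ w w - inner ℝ (D.res n w : Lp ℝ 2 μ) w) ≤ C) :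
    ∃ h : w ∈ D.domain, D.form ⟨w, h⟩ ⟨w, h⟩ ≤ C := by
  have h0 : Tendsto (fun n => ‖(D.res n w : Lp ℝ 2 μ) - w‖) atTop (𝓝 0) := by
    have h1 : Tendsto (fun n : ℕ => √(C / (n + 1))) atTop (𝓝 0) := by
      have : Tendsto (fun n : ℕ => C / ((n : ℝ) + 1)) atTop (𝓝 0) :=
        tendsto_const_nhds.div_atTop (tendsto_natCast_atTop_atTop.atTop_add tendsto_const_nhds)
      simpa using this.sqrt
    refine squeeze_zero (fun n => norm_nonneg _) (fun n => ?_) h1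
    refine Real.le_sqrt_of_sq_le ?_
    rw [le_div_iff₀ (by positivity), norm_sub_rev, mul_comm]
    exact (D.form_res_res_le n w).2.trans (hw n)
  have hmem : w ∈ D.domain := D.mem_domain_of_bounded (u := fun n => D.res n w)
    (fun n => (D.form_res_res_le n w).1.trans (hw n)) (tendsto_iff_norm_sub_tendsto_zero.2 h0)
  refine ⟨hmem, ?_⟩
  exact le_of_tendsto (D.tendsto_approxForm ⟨w, hmem⟩ ⟨w, hmem⟩) (Eventually.of_forall hw)

end Hilbert

end DirichletForm

/-! ### Symmetric Markov operators and discrete energies. -/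

section Markov

variable {K : Type*} [MeasurableSpace K] {μ : Measure K}

/-- A bounded symmetric Markov operator on `L²`. -/
structure IsSymmMarkov (T : Lp ℝ 2 μ →L[ℝ] Lp ℝ 2 μ) : Prop where
  symm : ∀ f g, inner ℝ (T f) g = inner ℝ f (T g)
  markov : ∀ g : Lp ℝ 2 μ, (∀ᵐ x ∂μ, 0 ≤ g x ∧ g x ≤ 1) → ∀ᵐ x ∂μ, 0 ≤ T g x ∧ T g x ≤ 1

/-- The Beurling-Deny decomposition on a finite set: `c` plays the role of jump weights and `m z - ∑
c z w` that of killing weights. Symmetry of `c` allows the double sum to be symmetrized. -/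
lemma sum_markov_identity {ι : Type*} (Z : Finset ι) (a b m : ι → ℝ) (c : ι → ι → ℝ)
    (hc : ∀ z w, c z w = c w z) :
    ∑ z ∈ Z, a z * b z * m z - ∑ z ∈ Z, ∑ w ∈ Z, a z * b w * c z w
      = ∑ z ∈ Z, a z * b z * (m z - ∑ w ∈ Z, c z w)
        + 1 / 2 * ∑ z ∈ Z, ∑ w ∈ Z, c z w * ((a z - a w) * (b z - b w)) := by
  have h1 : ∑ z ∈ Z, ∑ w ∈ Z, c z w * ((a z - a w) * (b z - b w))
      = 2 * ∑ z ∈ Z, a z * b z * ∑ w ∈ Z, c z w - 2 * ∑ z ∈ Z, ∑ w ∈ Z, a z * b w * c z w := by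
    have e1 : ∑ z ∈ Z, ∑ w ∈ Z, a w * b w * c z w = ∑ z ∈ Z, ∑ w ∈ Z, a z * b z * c z w := by
      rw [Finset.sum_comm]
      exact Finset.sum_congr rfl fun z _ => Finset.sum_congr rfl fun w _ => by rw [hc]
    have e2 : ∑ z ∈ Z, ∑ w ∈ Z, a w * b z * c z w = ∑ z ∈ Z, ∑ w ∈ Z, a z * b w * c z w := by
      rw [Finset.sum_comm]
      exact Finset.sum_congr rfl fun z _ => Finset.sum_congr rfl fun w _ => by rw [hc]
    have e3 : ∑ z ∈ Z, ∑ w ∈ Z, c z w * ((a z - a w) * (b z - b w))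
        = ∑ z ∈ Z, ∑ w ∈ Z, a z * b z * c z w + ∑ z ∈ Z, ∑ w ∈ Z, a w * b w * c z w
          - ∑ z ∈ Z, ∑ w ∈ Z, a z * b w * c z w - ∑ z ∈ Z, ∑ w ∈ Z, a w * b z * c z w := by
      simp only [← Finset.sum_add_distrib, ← Finset.sum_sub_distrib]
      exact Finset.sum_congr rfl fun z _ => Finset.sum_congr rfl fun w _ => by ring
    rw [e3, e1, e2]
    simp only [Finset.mul_sum]
    simp only [two_mul, Finset.sum_add_distrib]
    simp only [← Finset.mul_sum]
    ring
  rw [h1]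
  simp only [mul_sub, Finset.sum_sub_distrib]
  ring

variable {T : Lp ℝ 2 μ →L[ℝ] Lp ℝ 2 μ}

/-- A finite family of pairs of Lipschitz functions, the sum of whose discrete energies is
nonnegative pointwise, has nonnegative energy for every symmetric Markov operator. -/
theorem IsSymmMarkov.sum_nonneg (hT : IsSymmMarkov T) {ι : Type*} [Fintype ι]
    {A B : ι → ℝ × ℝ → ℝ} {L M : ι → ℝ≥0} (hA : ∀ k, LipschitzWith (L k) (A k))
    (hB : ∀ k, LipschitzWith (M k) (B k)) (hA0 : ∀ k, A k 0 = 0) (hB0 : ∀ k, B k 0 = 0)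
    (h1 : ∀ z, 0 ≤ ∑ k, A k z * B k z)
    (h2 : ∀ z w, 0 ≤ ∑ k, (A k z - A k w) * (B k z - B k w)) (F : Lp (ℝ × ℝ) 2 μ) :
    0 ≤ ∑ k, (inner ℝ ((hA k).compLp (hA0 k) F) ((hB k).compLp (hB0 k) F)
      - inner ℝ (T ((hA k).compLp (hA0 k) F)) ((hB k).compLp (hB0 k) F)) := by
  -- The expression is continuous in `F`, so `F` may be taken simple; the energies then become
  -- finite sums over the fibres of `F`.
  refine DenseRange.induction_on (Lp.simpleFunc.denseRange (E := ℝ × ℝ) (μ := μ) (p := 2)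
    ENNReal.ofNat_ne_top) F ?_ ?_
  · refine isClosed_le continuous_const (continuous_finsetSum _ fun k _ => ?_)
    have c1 := LipschitzWith.continuous_compLp (p := 2) (μ := μ) (hA k) (hA0 k)
    have c2 := LipschitzWith.continuous_compLp (p := 2) (μ := μ) (hB k) (hB0 k)
    exact (c1.inner c2).sub ((T.continuous.comp c1).inner c2)
  intro g
  classical
  set s := Lp.simpleFunc.toSimpleFunc g
  have hs : s =ᵐ[μ] (g : Lp (ℝ × ℝ) 2 μ) := Lp.simpleFunc.toSimpleFunc_eq_toFun g
  -- The fibre over `0` may have infinite measure; it is dropped, as all the functions vanish at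
  -- `0`.
  set Z := s.range.filter (· ≠ 0)
  have hfin : ∀ z ∈ Z, μ (s ⁻¹' {z}) ≠ ⊤ := fun z hz =>
    (SimpleFunc.measure_preimage_lt_top_of_memLp two_ne_zero ENNReal.ofNat_ne_top s
      (Lp.simpleFunc.memLp g) z (Finset.mem_filter.1 hz).2).ne
  let e : ℝ × ℝ → Lp ℝ 2 μ := fun z => if h : μ (s ⁻¹' {z}) ≠ ⊤ then
    indicatorConstLp 2 (s.measurableSet_fiber z) h 1 else 0
  have he : ∀ z ∈ Z, ∀ᵐ x ∂μ, e z x = (s ⁻¹' {z}).indicator 1 x := by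
    intro z hz
    simp only [e, dif_pos (hfin z hz)]
    exact indicatorConstLp_coeFn
  have hint : ∀ z ∈ Z, ∀ f : Lp ℝ 2 μ, inner ℝ (e z) f = ∫ x in s ⁻¹' {z}, f x ∂μ := by
    intro z hz f
    simp only [e, dif_pos (hfin z hz)]
    exact L2.inner_indicatorConstLp_one _ _ _
  have hall : ∀ᵐ x ∂μ, ∀ z ∈ Z, e z x = (s ⁻¹' {z}).indicator 1 x :=
    (eventually_all_finset Z).2 he
  have hsum : ∀ (a : ℝ × ℝ → ℝ), a 0 = 0 → ∀ᵐ x ∂μ, (∑ z ∈ Z, a z • e z : Lp ℝ 2 μ) x = a (s x) := by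
    intro a ha
    have h3 : ∀ᵐ x ∂μ, ∀ z ∈ Z, (a z • e z : Lp ℝ 2 μ) x = a z * e z x :=
      (eventually_all_finset Z).2 fun z _ => by
        filter_upwards [Lp.coeFn_smul (a z) (e z)] with x hx
        rw [hx]; rfl
    filter_upwards [hall, h3, Lp.coeFn_finsetSum Z (fun z => a z • e z)] with x hx hx3 hx4
    rw [hx4, Finset.sum_apply, Finset.sum_congr rfl hx3, Finset.sum_congr rfl fun z hz => by rw [hx z hz]]
    by_cases h0 : s x = 0
    · rw [h0, ha]
      refine Finset.sum_eq_zero fun z hz => ?_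
      have : s x ≠ z := by rw [h0]; exact (Finset.mem_filter.1 hz).2.symm
      simp [this]
    · rw [Finset.sum_eq_single_of_mem (s x) (Finset.mem_filter.2 ⟨s.mem_range_self x, h0⟩)]
      · simp
      · intro z _ hz
        simp [hz.symm]
  have hcomp : ∀ {C : ℝ≥0} {a : ℝ × ℝ → ℝ} (ha : LipschitzWith C a) (ha0 : a 0 = 0),
      ha.compLp ha0 (g : Lp (ℝ × ℝ) 2 μ) = ∑ z ∈ Z, a z • e z := by
    intro C a ha ha0
    refine Lp.ext ?_
    filter_upwards [hsum a ha0, ha.coeFn_compLp ha0 (g : Lp (ℝ × ℝ) 2 μ), hs] with x hx hx1 hx2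
    rw [hx, hx1, Function.comp_apply, hx2]
  set m : ℝ × ℝ → ℝ := fun z => μ.real (s ⁻¹' {z})
  set c : ℝ × ℝ → ℝ × ℝ → ℝ := fun z w => inner ℝ (T (e z)) (e w)
  have hee : ∀ z ∈ Z, ∀ w ∈ Z, inner ℝ (e z) (e w) = if z = w then m z else 0 := by
    intro z hz w hw
    rw [hint z hz, setIntegral_congr_ae (g := (s ⁻¹' {w}).indicator 1) (s.measurableSet_fiber z)
      (by filter_upwards [he w hw] with x hx _; exact hx)]
    split_ifs with h
    · subst h
      rw [setIntegral_indicator (s.measurableSet_fiber _)]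
      simp [m]
    · refine setIntegral_eq_zero_of_forall_eq_zero fun x hx => ?_
      simp only [mem_preimage, mem_singleton_iff] at hx
      simp [hx, h]
  have hT0 : ∀ z ∈ Z, ∀ᵐ x ∂μ, 0 ≤ T (e z) x := by
    intro z hz
    refine (hT.markov (e z) ?_).mono fun x hx => hx.1
    filter_upwards [he z hz] with x hx
    rw [hx]
    exact ⟨indicator_nonneg (fun _ _ => zero_le_one) _, indicator_le_self' (fun _ _ => zero_le_one) _⟩
  have hc0 : ∀ z ∈ Z, ∀ w ∈ Z, 0 ≤ c z w := by
    intro z hz w hw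
    simp only [c]
    rw [real_inner_comm, hint w hw]
    exact setIntegral_nonneg_of_ae (hT0 z hz)
  have hcs : ∀ z w, c z w = c w z := fun z w => by
    simp only [c]; rw [hT.symm, real_inner_comm]
  -- The killing weights are nonnegative because `T` sends the indicator of `{s ≠ 0}` to a function
  -- that is at most `1`.
  have hκ : ∀ z ∈ Z, 0 ≤ m z - ∑ w ∈ Z, c z w := by
    intro z hz
    let q : ℝ × ℝ → ℝ := fun w => if w = 0 then 0 else 1
    have h3 : ∑ w ∈ Z, c z w = inner ℝ (e z) (T (∑ w ∈ Z, q w • e w)) := by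
      rw [← hT.symm, inner_sum]
      refine Finset.sum_congr rfl fun w hw => ?_
      simp [q, c, (Finset.mem_filter.1 hw).2]
    have h4 := hT.markov (∑ w ∈ Z, q w • e w) (by
      filter_upwards [hsum q (by simp [q])] with x hx
      rw [hx]; simp only [q]; split_ifs <;> norm_num)
    rw [h3, hint z hz, sub_nonneg]
    calc _ ≤ ∫ x in s ⁻¹' {z}, (1 : ℝ) ∂μ := by
          refine setIntegral_mono_ae ?_ ?_ (h4.mono fun x hx => hx.2)
          · have := Fact.mk (hfin z hz).lt_top
            exact ((Lp.memLp _).mono_measure Measure.restrict_le_self).integrable one_le_two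
          · exact integrableOn_const (hfin z hz)
      _ = _ := by simp [m]
  have hk : ∀ k, inner ℝ ((hA k).compLp (hA0 k) (g : Lp (ℝ × ℝ) 2 μ)) ((hB k).compLp (hB0 k) g)
      - inner ℝ (T ((hA k).compLp (hA0 k) g)) ((hB k).compLp (hB0 k) g)
      = ∑ z ∈ Z, A k z * B k z * (m z - ∑ w ∈ Z, c z w)
        + 1 / 2 * ∑ z ∈ Z, ∑ w ∈ Z, c z w * ((A k z - A k w) * (B k z - B k w)) := by
    intro k
    rw [← sum_markov_identity Z (A k) (B k) m c hcs, hcomp, hcomp, map_sum]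
    simp only [map_smul, sum_inner, inner_sum, real_inner_smul_left, real_inner_smul_right]
    congr 1
    · refine Finset.sum_congr rfl fun z hz => ?_
      rw [Finset.sum_congr rfl fun w hw => by rw [hee w hw z hz]]
      rw [Finset.sum_eq_single_of_mem z hz]
      · simp; ring
      · intro w _ hw; simp [hw]
    · rw [Finset.sum_comm]
      refine Finset.sum_congr rfl fun z _ => Finset.sum_congr rfl fun w _ => ?_
      simp only [c]; ring
  rw [Finset.sum_congr rfl fun k _ => hk k, Finset.sum_add_distrib, ← Finset.mul_sum,
    Finset.sum_comm, Finset.sum_comm (s := Finset.univ)]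
  refine add_nonneg (Finset.sum_nonneg fun z hz => ?_) (mul_nonneg (by norm_num)
    (Finset.sum_nonneg fun z hz => ?_))
  · rw [← Finset.sum_mul]
    exact mul_nonneg (h1 z) (hκ z hz)
  · rw [Finset.sum_comm]
    refine Finset.sum_nonneg fun w hw => ?_
    rw [← Finset.mul_sum]
    exact mul_nonneg (hc0 z hz w hw) (h2 z w)

end Markov

namespace DirichletForm

/-! ### Markov property of the resolvent and normal contractions. -/

section Resolvent

variable {K : Type*} [MeasurableSpace K] {μ : Measure K} (D : DirichletForm μ)

/-- The operator `T_n` as a bounded operator on `L²`. -/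
def resL (n : ℕ) : Lp ℝ 2 μ →L[ℝ] Lp ℝ 2 μ :=
  (n + 1 : ℝ) • (D.hilInclL n ∘L (D.hilInclL n).adjoint)

lemma resL_apply (n : ℕ) (g : Lp ℝ 2 μ) : D.resL n g = D.res n g := rfl

/-- `T_n g` is the unique minimizer of `u ↦ E(u, u) + (n + 1) ‖u - g‖²`. If `0 ≤ g ≤ 1`, truncating
`T_n g` to `[0, 1]` increases neither term, so the truncation equals `T_n g`. -/
lemma isSymmMarkov_resL (n : ℕ) : IsSymmMarkov (D.resL n) where
  symm f g := D.inner_res_comm n f g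
  markov g hg := by
    obtain ⟨v, hv, hvE⟩ := D.markov (D.res n g)
    set u := D.res n g
    have h1 : ‖(v : Lp ℝ 2 μ) - g‖ ≤ ‖(u : Lp ℝ 2 μ) - g‖ := by
      refine Lp.norm_le_norm_of_ae_le ?_
      filter_upwards [hg, hv, Lp.coeFn_sub (v : Lp ℝ 2 μ) g, Lp.coeFn_sub (u : Lp ℝ 2 μ) g]
        with x hx1 hx2 hx3 hx4
      rw [hx3, hx4, Pi.sub_apply, Pi.sub_apply, hx2, Real.norm_eq_abs, Real.norm_eq_abs]
      generalize (u : Lp ℝ 2 μ) x = t at *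
      generalize g x = y at *
      rcases le_total t 0 with h | h
      · rw [max_eq_right h, min_eq_left zero_le_one, abs_of_nonpos, abs_of_nonpos] <;> linarith
      · rw [max_eq_left h]
        rcases le_total t 1 with h' | h'
        · rw [min_eq_left h']
        · rw [min_eq_right h', abs_of_nonneg, abs_of_nonneg] <;> linarith
    have h2 := D.form_res n g (v - u)
    have h3 : D.form v v = D.form u u + 2 * D.form u (v - u) + D.form (v - u) (v - u) := by
      rw [← form_add_add]; simp
    have h4 : ‖(v : Lp ℝ 2 μ) - g‖ ^ 2 = ‖(u : Lp ℝ 2 μ) - g‖ ^ 2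
        + 2 * inner ℝ ((u : Lp ℝ 2 μ) - g) ((v : Lp ℝ 2 μ) - u) + ‖(v : Lp ℝ 2 μ) - u‖ ^ 2 := by
      rw [← norm_add_sq_real]; congr 2; abel
    have h5 : inner ℝ ((u : Lp ℝ 2 μ) - g) ((v : Lp ℝ 2 μ) - u)
        = - inner ℝ (g - (u : Lp ℝ 2 μ)) ((v : Lp ℝ 2 μ) - u) := by
      rw [← inner_neg_left]; congr 1; abel
    have h6 : ‖(v : Lp ℝ 2 μ) - g‖ ^ 2 ≤ ‖(u : Lp ℝ 2 μ) - g‖ ^ 2 :=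
      pow_le_pow_left₀ (norm_nonneg _) h1 2
    have h7 : (0 : ℝ) < n + 1 := by positivity
    have h8 : ‖(v : Lp ℝ 2 μ) - u‖ ^ 2 ≤ 0 := by
      have h9 := D.nonneg (v - u)
      change D.form u (v - u) = (n + 1) * inner ℝ (g - (u : Lp ℝ 2 μ)) ((v : Lp ℝ 2 μ) - u) at h2
      rw [h5] at h4
      have h10 : (n + 1) * (‖(v : Lp ℝ 2 μ) - u‖ ^ 2) ≤ 0 := by
        have : (n + 1) * (‖(v : Lp ℝ 2 μ) - g‖ ^ 2 - ‖(u : Lp ℝ 2 μ) - g‖ ^ 2) ≤ 0 :=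
          mul_nonpos_of_nonneg_of_nonpos h7.le (by linarith)
        rw [h4] at this
        nlinarith
      nlinarith
    have h9 : (v : Lp ℝ 2 μ) = u := by
      have := pow_eq_zero_iff (two_ne_zero) |>.1 (le_antisymm h8 (sq_nonneg _))
      exact sub_eq_zero.1 (norm_eq_zero.1 this)
    rw [resL_apply]
    rw [h9] at hv
    filter_upwards [hv] with x hx
    rw [hx]
    exact ⟨le_min (le_max_right _ _) zero_le_one, min_le_right _ _⟩

/-- The domain is stable under Lipschitz functions vanishing at `0`. -/
lemma exists_lipschitz_comp (u : D.domain) {Ψ : ℝ → ℝ} {L : ℝ≥0} (hΨ : LipschitzWith L Ψ)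
    (h0 : Ψ 0 = 0) : ∃ v : D.domain, (v : Lp ℝ 2 μ) =ᵐ[μ] (fun x => Ψ ((u : Lp ℝ 2 μ) x)) ∧
      D.form v v ≤ L ^ 2 * D.form u u := by
  set w : Lp ℝ 2 μ := hΨ.compLp h0 (u : Lp ℝ 2 μ)
  have hF : MemLp (fun x => ((u : Lp ℝ 2 μ) x, (0 : ℝ))) 2 μ :=
    memLp_prod_iff.2 ⟨Lp.memLp _, MemLp.zero⟩
  -- These pairs encode the discrete inequality `(Ψ a - Ψ b)² ≤ L² (a - b)²`; the second coordinate
  -- of the plane is a dummy here.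
  let A : Fin 2 → ℝ × ℝ → ℝ := ![fun z => L * z.1, fun z => - Ψ z.1]
  let B : Fin 2 → ℝ × ℝ → ℝ := ![fun z => L * z.1, fun z => Ψ z.1]
  have l1 : LipschitzWith L (fun z : ℝ × ℝ => (L : ℝ) * z.1) := by
    refine LipschitzWith.of_dist_le_mul fun z w => ?_
    rw [Real.dist_eq, ← mul_sub, abs_mul, NNReal.abs_eq]
    exact mul_le_mul_of_nonneg_left (le_max_left _ _) L.2
  have l2 : LipschitzWith L (fun z : ℝ × ℝ => Ψ z.1) := by
    have := hΨ.comp (LipschitzWith.prod_fst (α := ℝ) (β := ℝ))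
    rw [mul_one] at this
    exact this
  have hA : ∀ k, LipschitzWith L (A k) := by
    intro k; fin_cases k
    · exact l1
    · exact l2.neg
  have hB : ∀ k, LipschitzWith L (B k) := by
    intro k; fin_cases k
    · exact l1
    · exact l2
  have hA0 : ∀ k, A k 0 = 0 := by intro k; fin_cases k <;> simp [A, h0]
  have hB0 : ∀ k, B k 0 = 0 := by intro k; fin_cases k <;> simp [B, h0]
  have hsq : ∀ a b : ℝ, (Ψ a - Ψ b) ^ 2 ≤ (L * (a - b)) ^ 2 := fun a b => by
    have := hΨ.dist_le_mul a b
    rw [Real.dist_eq, Real.dist_eq] at this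
    rw [← sq_abs, mul_pow, ← sq_abs (a - b), ← mul_pow]
    exact pow_le_pow_left₀ (abs_nonneg _) this 2
  have key : ∀ n : ℕ, inner ℝ w w - inner ℝ (D.res n w : Lp ℝ 2 μ) w ≤
      L ^ 2 * (inner ℝ (u : Lp ℝ 2 μ) u - inner ℝ (D.res n u : Lp ℝ 2 μ) (u : Lp ℝ 2 μ)) := by
    intro n
    have h := (D.isSymmMarkov_resL n).sum_nonneg hA hB hA0 hB0
      (fun z => by
        have := hsq z.1 0
        simp [A, B, h0] at this ⊢
        nlinarith)
      (fun z w => by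
        have := hsq z.1 w.1
        simp [A, B] at this ⊢
        nlinarith) hF.toLp
    have e1 : ∀ a : Fin 2 → ℝ × ℝ → ℝ, ∀ (ha : ∀ k, LipschitzWith L (a k)) (ha0 : ∀ k, a k 0 = 0),
      (∀ z, a 0 z = L * z.1) → (ha 0).compLp (ha0 0) hF.toLp = (L : ℝ) • (u : Lp ℝ 2 μ) := by
      intro a ha ha0 haz
      refine Lp.ext ?_
      filter_upwards [(ha 0).coeFn_compLp (ha0 0) hF.toLp, Lp.coeFn_smul (L : ℝ) (u : Lp ℝ 2 μ),
        hF.coeFn_toLp] with x hx1 hx2 hx3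
      rw [hx1, hx2, Function.comp_apply, hx3, haz]; simp
    have e2 : (hA 1).compLp (hA0 1) hF.toLp = - w := by
      refine Lp.ext ?_
      filter_upwards [(hA 1).coeFn_compLp (hA0 1) hF.toLp, Lp.coeFn_neg w,
        hF.coeFn_toLp, hΨ.coeFn_compLp h0 (u : Lp ℝ 2 μ)] with x hx1 hx2 hx3 hx4
      rw [hx1, hx2, Function.comp_apply, hx3, Pi.neg_apply, hx4]; simp [A]
    have e3 : (hB 1).compLp (hB0 1) hF.toLp = w := by
      refine Lp.ext ?_
      filter_upwards [(hB 1).coeFn_compLp (hB0 1) hF.toLp,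
        hF.coeFn_toLp, hΨ.coeFn_compLp h0 (u : Lp ℝ 2 μ)] with x hx1 hx3 hx4
      rw [hx1, Function.comp_apply, hx3, hx4]; simp [B]
    rw [Fin.sum_univ_two, e1 A hA hA0 (fun z => rfl), e1 B hB hB0 (fun z => rfl), e2, e3] at h
    simp only [map_neg, map_smul, inner_neg_left, real_inner_smul_left, real_inner_smul_right,
      resL_apply] at h
    linarith
  have h1 : ∀ n : ℕ, (n + 1 : ℝ) * (inner ℝ w w - inner ℝ (D.res n w : Lp ℝ 2 μ) w)
      ≤ L ^ 2 * D.form u u := by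
    intro n
    have h2 := (D.form_res_self_le n u).2.2
    rw [form_res, inner_sub_left] at h2
    calc _ ≤ (n + 1 : ℝ) * (L ^ 2 * (inner ℝ (u : Lp ℝ 2 μ) u
            - inner ℝ (D.res n u : Lp ℝ 2 μ) (u : Lp ℝ 2 μ))) :=
          mul_le_mul_of_nonneg_left (key n) (by positivity)
      _ = L ^ 2 * ((n + 1 : ℝ) * (inner ℝ (u : Lp ℝ 2 μ) u
            - inner ℝ (D.res n u : Lp ℝ 2 μ) (u : Lp ℝ 2 μ))) := by ring
      _ ≤ _ := mul_le_mul_of_nonneg_left h2 (by positivity)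
  obtain ⟨hmem, hle⟩ := D.mem_domain_of_approxForm_le h1
  exact ⟨⟨w, hmem⟩, hΨ.coeFn_compLp h0 _, hle⟩

/-- The energy inequality corresponding to a pointwise inequality of discrete energies. -/
lemma sum_form_nonneg {f φ : K → ℝ} (hf : MemLp f 2 μ) (hφ : MemLp φ 2 μ) {ι : Type*} [Fintype ι]
    {A B : ι → ℝ × ℝ → ℝ} {L M : ι → ℝ≥0} (hA : ∀ k, LipschitzWith (L k) (A k))
    (hB : ∀ k, LipschitzWith (M k) (B k)) (hA0 : ∀ k, A k 0 = 0) (hB0 : ∀ k, B k 0 = 0)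
    (h1 : ∀ z, 0 ≤ ∑ k, A k z * B k z)
    (h2 : ∀ z w, 0 ≤ ∑ k, (A k z - A k w) * (B k z - B k w))
    {u v : ι → D.domain} (hu : ∀ k, D.Represents (u k) fun x => A k (f x, φ x))
    (hv : ∀ k, D.Represents (v k) fun x => B k (f x, φ x)) :
    0 ≤ ∑ k, D.form (u k) (v k) := by
  have hF : MemLp (fun x => (f x, φ x)) 2 μ := memLp_prod_iff.2 ⟨hf, hφ⟩
  have eu : ∀ k, (hA k).compLp (hA0 k) hF.toLp = u k := fun k => by
    refine Lp.ext ?_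
    filter_upwards [(hA k).coeFn_compLp (hA0 k) hF.toLp, hF.coeFn_toLp, hu k] with x h1 h2 h3
    rw [h1, h3, Function.comp_apply, h2]
  have ev : ∀ k, (hB k).compLp (hB0 k) hF.toLp = v k := fun k => by
    refine Lp.ext ?_
    filter_upwards [(hB k).coeFn_compLp (hB0 k) hF.toLp, hF.coeFn_toLp, hv k] with x h1 h2 h3
    rw [h1, h3, Function.comp_apply, h2]
  have key := fun n => (D.isSymmMarkov_resL n).sum_nonneg hA hB hA0 hB0 h1 h2 hF.toLp
  simp only [eu, ev, resL_apply] at key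
  refine ge_of_tendsto (tendsto_finsetSum Finset.univ fun k _ => D.tendsto_approxForm (u k) (v k))
    (Eventually.of_forall fun n => ?_)
  rw [← Finset.mul_sum]
  exact mul_nonneg (by positivity) (key n)

end Resolvent

end DirichletForm

/-- Truncation at the level `M`. -/
def clamp (M t : ℝ) : ℝ := max (-M) (min t M)

lemma lipschitzWith_clamp (M : ℝ) : LipschitzWith 1 (clamp M) :=
  (LipschitzWith.id.min_const M).const_max (-M)

lemma clamp_zero {M : ℝ} (hM : 0 ≤ M) : clamp M 0 = 0 := by
  unfold clamp; rw [min_eq_left hM, max_eq_right (by linarith)]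

lemma abs_clamp_le {M : ℝ} (hM : 0 ≤ M) (t : ℝ) : |clamp M t| ≤ M := by
  unfold clamp
  exact abs_le.2 ⟨le_max_left _ _, max_le (by linarith) (min_le_right _ _)⟩

lemma clamp_eq_self {M t : ℝ} (h : |t| ≤ M) : clamp M t = t := by
  unfold clamp
  rw [min_eq_left (abs_le.1 h).2, max_eq_right (abs_le.1 h).1]

lemma abs_clamp_le_abs {M : ℝ} (hM : 0 ≤ M) (t : ℝ) : |clamp M t| ≤ |t| := by
  have := (lipschitzWith_clamp M).dist_le_mul t 0
  simpa [clamp_zero hM] using this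

lemma continuous_clamp (M : ℝ) : Continuous (clamp M) := (lipschitzWith_clamp M).continuous

lemma lipschitzWith_mul_of_bounded {α : Type*} [PseudoMetricSpace α] {a b : α → ℝ} {L M : ℝ≥0}
    (ha : LipschitzWith L a) (hb : LipschitzWith M b) {C C' : ℝ≥0} (hC : ∀ x, |a x| ≤ C)
    (hC' : ∀ x, |b x| ≤ C') : LipschitzWith (C * M + C' * L) (fun x => a x * b x) := by
  refine LipschitzWith.of_dist_le_mul fun x y => ?_
  have h1 := ha.dist_le_mul x y
  have h2 := hb.dist_le_mul x y
  rw [Real.dist_eq] at *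
  have e : a x * b x - a y * b y = a x * (b x - b y) + b y * (a x - a y) := by ring
  rw [e]
  refine (abs_add_le _ _).trans ?_
  rw [abs_mul, abs_mul]
  push_cast
  have h3 : |a x| * |b x - b y| ≤ C * (M * dist x y) :=
    mul_le_mul (hC x) h2 (abs_nonneg _) C.2
  have h4 : |b y| * |a x - a y| ≤ C' * (L * dist x y) :=
    mul_le_mul (hC' y) h1 (abs_nonneg _) C'.2
  linarith

namespace DirichletForm

/-! ### The algebra of bounded elements and the energy functional on it. -/

section Algebra

variable {K : Type*} [MeasurableSpace K] {μ : Measure K} (D : DirichletForm μ)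

variable {D} in
lemma Represents.unique {u v : D.domain} {w : K → ℝ} (hu : D.Represents u w)
    (hv : D.Represents v w) : u = v :=
  Subtype.ext (Lp.ext (hu.trans hv.symm))

variable {D} in
lemma Represents.add {u v : D.domain} {w z : K → ℝ} (hu : D.Represents u w)
    (hv : D.Represents v z) : D.Represents (u + v) (w + z) :=
  (Lp.coeFn_add _ _).trans (Filter.EventuallyEq.add hu hv)

variable {D} in
lemma Represents.sub {u v : D.domain} {w z : K → ℝ} (hu : D.Represents u w)
    (hv : D.Represents v z) : D.Represents (u - v) (w - z) :=
  (Lp.coeFn_sub _ _).trans (Filter.EventuallyEq.sub hu hv)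

variable {D} in
lemma Represents.smul {u : D.domain} {w : K → ℝ} (hu : D.Represents u w) (t : ℝ) :
    D.Represents (t • u) (t • w) :=
  (Lp.coeFn_smul _ _).trans (Filter.EventuallyEq.const_smul hu t)

lemma represents_zero : D.Represents 0 0 := Lp.coeFn_zero _ _ _

variable {D} in
lemma Represents.memLp {u : D.domain} {w : K → ℝ} (hu : D.Represents u w) : MemLp w 2 μ :=
  (memLp_congr_ae hu).1 (Lp.memLp _)

variable {D} in
lemma Represents.congr {u : D.domain} {w z : K → ℝ} (hu : D.Represents u w) (h : w =ᵐ[μ] z) :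
    D.Represents u z := hu.trans h

variable {D} in
lemma Represents.exists_lipschitz {u : D.domain} {w : K → ℝ} (hu : D.Represents u w) {Ψ : ℝ → ℝ}
    {L : ℝ≥0} (hΨ : LipschitzWith L Ψ) (h0 : Ψ 0 = 0) :
    ∃ v : D.domain, D.Represents v (fun x => Ψ (w x)) ∧ D.form v v ≤ L ^ 2 * D.form u u := by
  obtain ⟨v, hv, hE⟩ := D.exists_lipschitz_comp u hΨ h0
  exact ⟨v, hv.trans (hu.mono fun x hx => by simp only [hx]), hE⟩

-- Polarization `4wz = (w + z)² - (w - z)²`: the square is cut off at the level `2M`, which makes it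
-- Lipschitz without changing it on the values that occur.
variable {D} in
lemma Represents.exists_mul {u v : D.domain} {w z : K → ℝ} (hu : D.Represents u w)
    (hv : D.Represents v z) {M : ℝ≥0} (hw : ∀ᵐ x ∂μ, |w x| ≤ M) (hz : ∀ᵐ x ∂μ, |z x| ≤ M) :
    ∃ p : D.domain, D.Represents p (fun x => w x * z x) ∧
      D.form p p ≤ 4 * M ^ 2 * (D.form u u + D.form v v) := by
  let Ψ : ℝ → ℝ := fun t => clamp (2 * M) t * clamp (2 * M) t
  have h2M : (0 : ℝ) ≤ 2 * M := by positivity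
  have hb : ∀ t, |clamp (2 * M) t| ≤ (2 * M : ℝ≥0) := fun t => by
    push_cast; exact abs_clamp_le h2M t
  have hΨ : LipschitzWith (2 * M * 1 + 2 * M * 1) Ψ :=
    lipschitzWith_mul_of_bounded (lipschitzWith_clamp _) (lipschitzWith_clamp _) hb hb
  have hΨ0 : Ψ 0 = 0 := by simp [Ψ, clamp_zero h2M]
  obtain ⟨p, hp, hpE⟩ := (hu.add hv).exists_lipschitz hΨ hΨ0
  obtain ⟨q, hq, hqE⟩ := (hu.sub hv).exists_lipschitz hΨ hΨ0
  refine ⟨(1 / 4 : ℝ) • (p - q), ((hp.sub hq).smul (1 / 4)).congr ?_, ?_⟩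
  · filter_upwards [hw, hz] with x h1 h2
    have h3 : |w x + z x| ≤ 2 * M := (abs_add_le _ _).trans (by linarith)
    have h4 : |w x - z x| ≤ 2 * M := (abs_sub _ _).trans (by linarith)
    simp only [Pi.smul_apply, Pi.sub_apply, Pi.add_apply, Ψ, clamp_eq_self h3, clamp_eq_self h4,
      smul_eq_mul]
    ring
  · rw [form_smul_smul]
    have h1 := D.form_sub_le p q
    have h2 : D.form (u + v) (u + v) + D.form (u - v) (u - v)
        = 2 * (D.form u u + D.form v v) := by
      rw [form_add_add, form_sub_sub]; ring
    push_cast at hpE hqE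
    have h3 : D.form p p + D.form q q ≤ (2 * M * 1 + 2 * M * 1) ^ 2 * (2 * (D.form u u + D.form v v)) := by
      rw [← h2, mul_add]; exact add_le_add hpE hqE
    nlinarith

/-- The algebra of functions representing the bounded elements of the domain. -/
def bdd : NonUnitalSubalgebra ℝ (K → ℝ) where
  carrier := {w | (∃ u : D.domain, D.Represents u w) ∧ ∃ C : ℝ≥0, ∀ᵐ x ∂μ, |w x| ≤ C}
  add_mem' := by
    rintro a b ⟨⟨u, hu⟩, C, hC⟩ ⟨⟨v, hv⟩, C', hC'⟩
    refine ⟨⟨u + v, hu.add hv⟩, C + C', ?_⟩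
    filter_upwards [hC, hC'] with x h1 h2
    push_cast
    exact (abs_add_le _ _).trans (add_le_add h1 h2)
  zero_mem' := ⟨⟨0, D.represents_zero⟩, 0, by simp⟩
  smul_mem' := by
    rintro t a ⟨⟨u, hu⟩, C, hC⟩
    refine ⟨⟨t • u, hu.smul t⟩, ⟨|t|, abs_nonneg _⟩ * C, ?_⟩
    filter_upwards [hC] with x h1
    simp only [Pi.smul_apply, smul_eq_mul, abs_mul]
    exact mul_le_mul_of_nonneg_left h1 (abs_nonneg _)
  mul_mem' := by
    rintro a b ⟨⟨u, hu⟩, C, hC⟩ ⟨⟨v, hv⟩, C', hC'⟩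
    obtain ⟨p, hp, -⟩ := hu.exists_mul hv (M := max C C')
      (hC.mono fun x hx => hx.trans (by exact_mod_cast le_max_left _ _))
      (hC'.mono fun x hx => hx.trans (by exact_mod_cast le_max_right _ _))
    refine ⟨⟨p, hp⟩, C * C', ?_⟩
    filter_upwards [hC, hC'] with x h1 h2
    simp only [Pi.mul_apply, abs_mul, NNReal.coe_mul]
    exact mul_le_mul h1 h2 (abs_nonneg _) C.2

/-- The element of the domain represented by a function in the algebra `bdd`. -/
def el : D.bdd →ₗ[ℝ] D.domain where
  toFun a := a.2.1.choose
  map_add' a b := (a + b).2.1.choose_spec.unique (a.2.1.choose_spec.add b.2.1.choose_spec)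
  map_smul' t a := (t • a).2.1.choose_spec.unique (a.2.1.choose_spec.smul t)

lemma represents_el (a : D.bdd) : D.Represents (D.el a) a := a.2.1.choose_spec

variable {D} in
lemma Represents.el_eq {u : D.domain} {a : D.bdd} (h : D.Represents u a) : D.el a = u :=
  (D.represents_el a).unique h

variable {D} in
/-- A bounded function representing an element of the domain, as an element of the algebra. -/
def Represents.toBdd {u : D.domain} {w : K → ℝ} (h : D.Represents u w)
    (hw : ∃ C : ℝ≥0, ∀ᵐ x ∂μ, |w x| ≤ C) : D.bdd := ⟨w, ⟨u, h⟩, hw⟩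

variable {D} in
lemma Represents.el_toBdd {u : D.domain} {w : K → ℝ} (h : D.Represents u w)
    (hw : ∃ C : ℝ≥0, ∀ᵐ x ∂μ, |w x| ≤ C) : D.el (h.toBdd hw) = u :=
  Represents.el_eq (a := h.toBdd hw) h

/-- The form on the algebra `bdd`. -/
def ef : D.bdd →ₗ[ℝ] D.bdd →ₗ[ℝ] ℝ := D.form.compl₁₂ D.el D.el

lemma ef_apply (a b : D.bdd) : D.ef a b = D.form (D.el a) (D.el b) := rfl

lemma ef_comm (a b : D.bdd) : D.ef a b = D.ef b a := D.symm _ _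

lemma ef_self_nonneg (a : D.bdd) : 0 ≤ D.ef a a := D.nonneg _

/-- The functional `φ ↦ ∫ φ dν_{a,b}`. -/
def gam (a b φ : D.bdd) : ℝ := D.ef (a * φ) b + D.ef (b * φ) a - D.ef φ (a * b)

lemma gam_comm (a b φ : D.bdd) : D.gam a b φ = D.gam b a φ := by
  unfold gam; rw [mul_comm a b]; ring

lemma gam_add_left (a b c φ : D.bdd) : D.gam (a + b) c φ = D.gam a c φ + D.gam b c φ := by
  simp only [gam, add_mul, map_add, LinearMap.add_apply]; ring

lemma gam_smul_left (t : ℝ) (a c φ : D.bdd) : D.gam (t • a) c φ = t * D.gam a c φ := by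
  simp only [gam, smul_mul_assoc, map_smul, LinearMap.smul_apply, smul_eq_mul]; ring

lemma gam_add_right (a b c φ : D.bdd) : D.gam c (a + b) φ = D.gam c a φ + D.gam c b φ := by
  rw [gam_comm, gam_add_left, gam_comm, D.gam_comm b]

lemma gam_smul_right (t : ℝ) (a c φ : D.bdd) : D.gam c (t • a) φ = t * D.gam c a φ := by
  rw [gam_comm, gam_smul_left, gam_comm]

lemma gam_add_test (a b φ ψ : D.bdd) : D.gam a b (φ + ψ) = D.gam a b φ + D.gam a b ψ := by
  simp only [gam, mul_add, map_add, LinearMap.add_apply]; ring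

lemma gam_smul_test (t : ℝ) (a b φ : D.bdd) : D.gam a b (t • φ) = t * D.gam a b φ := by
  simp only [gam, mul_smul_comm, map_smul, LinearMap.smul_apply, smul_eq_mul]; ring

lemma gam_zero (φ : D.bdd) : D.gam 0 0 φ = 0 := by simp [gam]

lemma exists_nnreal_bound (a : D.bdd) : ∃ C : ℝ≥0, ∀ᵐ x ∂μ, |(a : K → ℝ) x| ≤ C := a.2.2

lemma sum_ef_nonneg (f φ : D.bdd) {ι : Type*} [Fintype ι] {A B : ι → ℝ × ℝ → ℝ}
    (hA : ∀ k, ∃ L, LipschitzWith L (A k)) (hB : ∀ k, ∃ L, LipschitzWith L (B k))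
    (hA0 : ∀ k, A k 0 = 0) (hB0 : ∀ k, B k 0 = 0) (h1 : ∀ z, 0 ≤ ∑ k, A k z * B k z)
    (h2 : ∀ z w, 0 ≤ ∑ k, (A k z - A k w) * (B k z - B k w)) {u v : ι → D.bdd}
    (hu : ∀ k, (u k : K → ℝ) =ᵐ[μ] fun x => A k ((f : K → ℝ) x, (φ : K → ℝ) x))
    (hv : ∀ k, (v k : K → ℝ) =ᵐ[μ] fun x => B k ((f : K → ℝ) x, (φ : K → ℝ) x)) :
    0 ≤ ∑ k, D.ef (u k) (v k) := by
  choose L hL using hA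
  choose M hM using hB
  exact D.sum_form_nonneg (D.represents_el f).memLp (D.represents_el φ).memLp hL hM hA0 hB0 h1 h2
    (fun k => (D.represents_el (u k)).congr (hu k)) (fun k => (D.represents_el (v k)).congr (hv k))

/-- Products of the coordinates are not Lipschitz on the plane. The truncated coordinates `X`, `Y`
agree with `f` and `φ` almost everywhere and have Lipschitz products, so `sum_ef_nonneg` applies to
them. -/
lemma exists_clamp_lipschitz (f φ : D.bdd) (hφ : ∀ᵐ x ∂μ, 0 ≤ (φ : K → ℝ) x) {M C : ℝ≥0}
    (hM : ∀ᵐ x ∂μ, |(f : K → ℝ) x| ≤ M) (hC : ∀ᵐ x ∂μ, (φ : K → ℝ) x ≤ C) :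
    ∃ X Y : ℝ × ℝ → ℝ, (∀ᵐ x ∂μ, X ((f : K → ℝ) x, (φ : K → ℝ) x) = (f : K → ℝ) x) ∧
      (∀ᵐ x ∂μ, Y ((f : K → ℝ) x, (φ : K → ℝ) x) = (φ : K → ℝ) x) ∧
      LipschitzWith 1 X ∧ LipschitzWith 1 Y ∧ X 0 = 0 ∧ Y 0 = 0 ∧ (∀ z, |X z| ≤ M) ∧
      (∀ z, 0 ≤ Y z) ∧ (∀ z, Y z ≤ C) := by
  refine ⟨fun z => clamp M z.1, fun z => clamp C (max z.2 0), ?_, ?_, ?_, ?_, ?_, ?_, ?_, ?_, ?_⟩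
  · filter_upwards [hM] with x hx using clamp_eq_self hx
  · filter_upwards [hφ, hC] with x hx hx2
    simp only [max_eq_left hx]
    exact clamp_eq_self (by rwa [abs_of_nonneg hx])
  · have := (lipschitzWith_clamp M).comp (LipschitzWith.prod_fst (α := ℝ) (β := ℝ))
    rwa [mul_one] at this
  · have := (lipschitzWith_clamp C).comp
      ((LipschitzWith.prod_snd (α := ℝ) (β := ℝ)).max_const 0)
    rwa [mul_one] at this
  · simp [clamp_zero]
  · simp [clamp_zero]
  · exact fun z => abs_clamp_le M.2 _
  · intro z
    unfold clamp
    exact le_max_of_le_right (le_min (le_max_right _ _) C.2)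
  · exact fun z => (abs_le.1 (abs_clamp_le C.2 _)).2

/-- Contraction property of the energy functional. -/
lemma gam_contraction {f g φ : D.bdd} (hφ : ∀ᵐ x ∂μ, 0 ≤ (φ : K → ℝ) x) {Ψ : ℝ → ℝ}
    (hΨ : LipschitzWith 1 Ψ) (h0 : Ψ 0 = 0)
    (hg : ∀ᵐ x ∂μ, (g : K → ℝ) x = Ψ ((f : K → ℝ) x)) : D.gam g g φ ≤ D.gam f f φ := by
  obtain ⟨M, hM⟩ := D.exists_nnreal_bound f
  obtain ⟨C, hC⟩ := D.exists_nnreal_bound φ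
  obtain ⟨X, Y, hX, hY, lX, lY, X0, Y0, bX, pY, bY⟩ := D.exists_clamp_lipschitz f φ hφ hM
    (hC.mono fun x hx => (le_abs_self _).trans hx)
  have hΨa : ∀ t, |Ψ t| ≤ |t| := fun t => by
    have := hΨ.dist_le_mul t 0
    simpa [h0] using this
  have hΨd : ∀ s t, (Ψ s - Ψ t) ^ 2 ≤ (s - t) ^ 2 := fun s t => by
    have := hΨ.dist_le_mul s t
    rw [Real.dist_eq, Real.dist_eq, NNReal.coe_one, one_mul] at this
    exact sq_le_sq.2 this
  have lZ : LipschitzWith 1 (fun z => Ψ (X z)) := by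
    have := hΨ.comp lX
    rwa [mul_one] at this
  have bZ : ∀ z, |Ψ (X z)| ≤ M := fun z => (hΨa _).trans (bX z)
  have bY' : ∀ z, |Y z| ≤ C := fun z => by rw [abs_of_nonneg (pY z)]; exact bY z
  have l2 : LipschitzWith 2 (fun t : ℝ => 2 * t) :=
    LipschitzWith.of_dist_le_mul fun x y => by simp [Real.dist_eq, ← mul_sub, abs_mul]
  -- With `Δ` the difference between two points `z`, `w`, one has `2 Δ(XY) ΔX - ΔY Δ(X²) = (Y z + Y
  -- w) (ΔX)²`. The claim thus reduces to `(ΔΨ(X))² ≤ (ΔX)²` and `Y ≥ 0`.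
  let A : Fin 4 → ℝ × ℝ → ℝ := ![fun z => 2 * (X z * Y z), fun z => - Y z,
    fun z => - (2 * (Ψ (X z) * Y z)), Y]
  let B : Fin 4 → ℝ × ℝ → ℝ := ![X, fun z => X z * X z, fun z => Ψ (X z), fun z => Ψ (X z) * Ψ (X z)]
  have key := D.sum_ef_nonneg f φ (A := A) (B := B) (u := ![(2 : ℝ) • (f * φ), - φ, -((2 : ℝ) • (g * φ)), φ])
    (v := ![f, f * f, g, g * g])
    (by
      intro k; fin_cases k
      · exact ⟨_, l2.comp (lipschitzWith_mul_of_bounded lX lY bX bY')⟩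
      · exact ⟨_, lY.neg⟩
      · exact ⟨_, (l2.comp (lipschitzWith_mul_of_bounded lZ lY bZ bY')).neg⟩
      · exact ⟨_, lY⟩)
    (by
      intro k; fin_cases k
      · exact ⟨_, lX⟩
      · exact ⟨_, lipschitzWith_mul_of_bounded lX lX bX bX⟩
      · exact ⟨_, lZ⟩
      · exact ⟨_, lipschitzWith_mul_of_bounded lZ lZ bZ bZ⟩)
    (by intro k; fin_cases k <;> simp [A, X0, Y0])
    (by intro k; fin_cases k <;> simp [B, X0, h0])
    (by
      intro z
      have h1 : Ψ (X z) ^ 2 ≤ X z ^ 2 := sq_le_sq.2 (hΨa _)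
      have := mul_nonneg (pY z) (sub_nonneg.2 h1)
      simp [Fin.sum_univ_four, A, B]
      nlinarith)
    (by
      intro z w
      have := mul_nonneg (add_nonneg (pY z) (pY w)) (sub_nonneg.2 (hΨd (X z) (X w)))
      simp [Fin.sum_univ_four, A, B]
      nlinarith)
    (by
      intro k; fin_cases k <;> filter_upwards [hX, hY, hg] with x h1 h2 h3 <;>
        simp [A, h1, h2, h3])
    (by
      intro k; fin_cases k <;> filter_upwards [hX, hY, hg] with x h1 h2 h3 <;>
        simp [B, h1, h3])
  simp [Fin.sum_univ_four] at key
  unfold gam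
  linarith

lemma gam_self_nonneg (f : D.bdd) {φ : D.bdd} (hφ : ∀ᵐ x ∂μ, 0 ≤ (φ : K → ℝ) x) :
    0 ≤ D.gam f f φ := by
  have := D.gam_contraction (f := f) (g := 0) hφ (Ψ := fun _ => 0)
    (LipschitzWith.const 0 |>.weaken zero_le_one) rfl (by simp)
  rwa [gam_zero] at this

/-- At the level of discrete energies the difference of the two sides is `(2C - Y z - Y w) (ΔX)²`,
which is nonnegative because `Y ≤ C`. -/
lemma gam_self_le (f : D.bdd) {φ : D.bdd} (hφ : ∀ᵐ x ∂μ, 0 ≤ (φ : K → ℝ) x) {C : ℝ≥0}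
    (hC : ∀ᵐ x ∂μ, (φ : K → ℝ) x ≤ C) : D.gam f f φ ≤ 2 * C * D.ef f f := by
  obtain ⟨M, hM⟩ := D.exists_nnreal_bound f
  obtain ⟨X, Y, hX, hY, lX, lY, X0, Y0, bX, pY, bY⟩ := D.exists_clamp_lipschitz f φ hφ hM hC
  have bY' : ∀ z, |Y z| ≤ C := fun z => by rw [abs_of_nonneg (pY z)]; exact bY z
  have l2 : LipschitzWith 2 (fun t : ℝ => 2 * t) :=
    LipschitzWith.of_dist_le_mul fun x y => by simp [Real.dist_eq, ← mul_sub, abs_mul]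
  have lC : LipschitzWith C (fun t : ℝ => C * t) :=
    LipschitzWith.of_dist_le_mul fun x y => by simp [Real.dist_eq, ← mul_sub, abs_mul]
  let A : Fin 3 → ℝ × ℝ → ℝ := ![fun z => 2 * (C * X z), fun z => - (2 * (X z * Y z)), Y]
  let B : Fin 3 → ℝ × ℝ → ℝ := ![X, X, fun z => X z * X z]
  have key := D.sum_ef_nonneg f φ (A := A) (B := B)
    (u := ![(2 : ℝ) • (C : ℝ) • f, -((2 : ℝ) • (f * φ)), φ]) (v := ![f, f, f * f])
    (by
      intro k; fin_cases k
      · exact ⟨_, l2.comp (lC.comp lX)⟩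
      · exact ⟨_, (l2.comp (lipschitzWith_mul_of_bounded lX lY bX bY')).neg⟩
      · exact ⟨_, lY⟩)
    (by
      intro k; fin_cases k
      · exact ⟨_, lX⟩
      · exact ⟨_, lX⟩
      · exact ⟨_, lipschitzWith_mul_of_bounded lX lX bX bX⟩)
    (by intro k; fin_cases k <;> simp [A, X0, Y0])
    (by intro k; fin_cases k <;> simp [B, X0])
    (by
      intro z
      have := mul_nonneg (sub_nonneg.2 (bY z)) (sq_nonneg (X z))
      have := mul_nonneg C.2 (sq_nonneg (X z))
      simp [Fin.sum_univ_three, A, B]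
      nlinarith)
    (by
      intro z w
      have := mul_nonneg (sub_nonneg.2 (bY z)) (sq_nonneg (X z - X w))
      have := mul_nonneg (sub_nonneg.2 (bY w)) (sq_nonneg (X z - X w))
      simp [Fin.sum_univ_three, A, B]
      nlinarith)
    (by
      intro k; fin_cases k <;> filter_upwards [hX, hY] with x h1 h2 <;> simp [A, h1, h2])
    (by
      intro k; fin_cases k <;> filter_upwards [hX] with x h1 <;> simp [B, h1])
  simp [Fin.sum_univ_three] at key
  unfold gam
  linarith

lemma ef_mul_self_le {a b : D.bdd} {M : ℝ≥0} (ha : ∀ᵐ x ∂μ, |(a : K → ℝ) x| ≤ M)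
    (hb : ∀ᵐ x ∂μ, |(b : K → ℝ) x| ≤ M) :
    D.ef (a * b) (a * b) ≤ 4 * M ^ 2 * (D.ef a a + D.ef b b) := by
  obtain ⟨p, hp, hE⟩ := (D.represents_el a).exists_mul (D.represents_el b) ha hb
  have : D.el (a * b) = p := Represents.el_eq hp
  rw [ef_apply, this]
  exact hE

lemma norm_el_mul_le {a b : D.bdd} {M : ℝ≥0} (ha : ∀ᵐ x ∂μ, |(a : K → ℝ) x| ≤ M) :
    ‖(D.el (a * b) : Lp ℝ 2 μ)‖ ≤ M * ‖(D.el b : Lp ℝ 2 μ)‖ := by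
  refine Lp.norm_le_mul_norm_of_ae_le_mul ?_
  filter_upwards [ha, D.represents_el (a * b), D.represents_el b] with x h1 h2 h3
  rw [h2, h3]
  simp only [NonUnitalSubalgebra.coe_mul, Pi.mul_apply, norm_mul, Real.norm_eq_abs]
  exact mul_le_mul_of_nonneg_right h1 (abs_nonneg _)

/-- Weak continuity of multiplication along uniformly bounded, energy-bounded families. -/
lemma tendsto_ef_mul {ι : Type*} {l : Filter ι} {φ : ι → D.bdd} {ψ : D.bdd} {C : ℝ≥0} {R : ℝ}
    (hC : ∀ i, ∀ᵐ x ∂μ, |(φ i : K → ℝ) x| ≤ C) (hR : ∀ i, D.ef (φ i) (φ i) ≤ R)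
    (hφ : Tendsto (fun i => ‖(D.el (φ i) : Lp ℝ 2 μ) - D.el ψ‖) l (𝓝 0)) (a b : D.bdd) :
    Tendsto (fun i => D.ef (a * φ i) b) l (𝓝 (D.ef (a * ψ) b)) := by
  obtain ⟨M, hM⟩ := D.exists_nnreal_bound a
  refine D.tendsto_form_of_bounded' (C := 4 * (max M C : ℝ≥0) ^ 2 * (D.ef a a + R)) (fun i => ?_) ?_ _
  · refine (D.ef_mul_self_le (M := max M C)
      (hM.mono fun x hx => hx.trans (by exact_mod_cast le_max_left _ _))
      ((hC i).mono fun x hx => hx.trans (by exact_mod_cast le_max_right _ _))).trans ?_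
    gcongr
    exact hR i
  · have h1 : Tendsto (fun i => (M : ℝ) * ‖(D.el (φ i) : Lp ℝ 2 μ) - D.el ψ‖) l (𝓝 0) := by
      simpa using hφ.const_mul (M : ℝ)
    refine squeeze_zero (fun _ => norm_nonneg _) (fun i => ?_) h1
    have := D.norm_el_mul_le (a := a) (b := φ i - ψ) hM
    rw [mul_sub, map_sub, map_sub] at this
    exact this

lemma tendsto_norm_of_energyOne {ι : Type*} {l : Filter ι} {u : ι → D.domain} {v : D.domain}
    (h : Tendsto (fun i => D.energyOne (u i - v)) l (𝓝 0)) :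
    Tendsto (fun i => ‖(u i : Lp ℝ 2 μ) - v‖) l (𝓝 0) := by
  have h1 := h.sqrt
  rw [Real.sqrt_zero] at h1
  refine squeeze_zero (fun _ => norm_nonneg _) (fun i => ?_) h1
  refine Real.le_sqrt_of_sq_le ?_
  have := D.nonneg (u i - v)
  unfold energyOne
  push_cast
  linarith

lemma tendsto_form_of_energyOne {ι : Type*} {l : Filter ι} {u : ι → D.domain} {v : D.domain}
    (h : Tendsto (fun i => D.energyOne (u i - v)) l (𝓝 0)) (w : D.domain) :
    Tendsto (fun i => D.form (u i) w) l (𝓝 (D.form v w)) := by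
  have h1 : Tendsto (fun i => √(D.energyOne (u i - v)) * √(D.form w w)) l (𝓝 0) := by
    simpa using h.sqrt.mul_const (√(D.form w w))
  rw [tendsto_iff_norm_sub_tendsto_zero]
  refine squeeze_zero (fun _ => norm_nonneg _) (fun i => ?_) h1
  have h2 := (D.abs_form_le (u i - v) w).trans (mul_le_mul_of_nonneg_right
    (Real.sqrt_le_sqrt (D.form_le_energyOne _)) (Real.sqrt_nonneg _))
  rwa [map_sub, LinearMap.sub_apply] at h2

lemma tendsto_form_self_of_energyOne {ι : Type*} {l : Filter ι} {u : ι → D.domain} {v : D.domain}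
    (h : Tendsto (fun i => D.energyOne (u i - v)) l (𝓝 0)) :
    Tendsto (fun i => D.form (u i) (u i)) l (𝓝 (D.form v v)) := by
  have h1 := (D.tendsto_form_of_energyOne h v).const_mul 2
  have h2 : Tendsto (fun i => D.form (u i - v) (u i - v)) l (𝓝 0) :=
    squeeze_zero (fun _ => D.nonneg _) (fun _ => D.form_le_energyOne _) h
  have h3 := (h2.add h1).sub_const (D.form v v)
  have e : 0 + 2 * D.form v v - D.form v v = D.form v v := by ring
  rw [e] at h3
  refine h3.congr fun i => ?_
  rw [form_sub_sub]; ring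

lemma energyOne_sub_comm (u v : D.domain) : D.energyOne (u - v) = D.energyOne (v - u) := by
  rw [← energyOne_neg, neg_sub]

lemma represents_coe (u : D.domain) : D.Represents u (u : Lp ℝ 2 μ) := ae_eq_rfl

/-- Dominated convergence in `L²`. -/
lemma tendsto_norm_of_dominated {v : ℕ → D.domain} {u : D.domain} {w : ℕ → K → ℝ} {z : K → ℝ}
    (hv : ∀ n, D.Represents (v n) (w n)) (hu : D.Represents u z) {g : K → ℝ} (hg : MemLp g 2 μ)
    (hle : ∀ n, ∀ᵐ x ∂μ, |w n x - z x| ≤ g x)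
    (hlim : ∀ᵐ x ∂μ, Tendsto (fun n => w n x) atTop (𝓝 (z x))) :
    Tendsto (fun n => ‖(v n : Lp ℝ 2 μ) - u‖) atTop (𝓝 0) := by
  have h1 : ∀ n, ‖(v n : Lp ℝ 2 μ) - u‖ ^ 2 = ∫ x, (w n x - z x) ^ 2 ∂μ := fun n => by
    rw [← real_inner_self_eq_norm_sq, L2.inner_def]
    refine integral_congr_ae ?_
    filter_upwards [((hv n).sub hu : _ =ᵐ[μ] _)] with x hx
    rw [AddSubgroupClass.coe_sub] at hx
    rw [hx]; simp [pow_two]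
  have h2 : Tendsto (fun n => ∫ x, (w n x - z x) ^ 2 ∂μ) atTop (𝓝 (∫ _, (0 : ℝ) ∂μ)) := by
    refine tendsto_integral_of_dominated_convergence (fun x => g x ^ 2)
      (fun n => (((hv n).memLp.sub hu.memLp).1.pow 2)) hg.integrable_sq (fun n => ?_) ?_
    · filter_upwards [hle n] with x hx
      rw [Real.norm_eq_abs, abs_pow]
      exact pow_le_pow_left₀ (abs_nonneg _) hx 2
    · filter_upwards [hlim] with x hx
      simpa using (hx.sub_const (z x)).pow 2
  rw [integral_zero] at h2
  have h3 := (h2.congr fun n => (h1 n).symm).sqrt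
  simpa [Real.sqrt_sq] using h3

/-- Truncations converge strongly. -/
lemma tendsto_clamp (u : D.domain) {v : ℕ → D.domain}
    (hv : ∀ n, D.Represents (v n) fun x => clamp n ((u : Lp ℝ 2 μ) x)) :
    Tendsto (fun n => D.energyOne (v n - u)) atTop (𝓝 0) := by
  have hE : ∀ n, D.form (v n) (v n) ≤ D.form u u := fun n => by
    obtain ⟨w, hw, hwE⟩ := D.exists_lipschitz_comp u (lipschitzWith_clamp n)
      (clamp_zero (Nat.cast_nonneg n))
    rw [(hv n).unique hw]
    simpa using hwE
  refine D.tendsto_energyOne_of_le hE (a := fun _ => D.form u u) tendsto_const_nhds hE ?_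
  refine D.tendsto_norm_of_dominated hv (D.represents_coe u)
    (g := fun x => 2 * |(u : Lp ℝ 2 μ) x|) ((Lp.memLp _).abs.const_mul 2) (fun n => ?_) ?_
  · refine Eventually.of_forall fun x => ?_
    have h1 := abs_clamp_le_abs (Nat.cast_nonneg n) ((u : Lp ℝ 2 μ) x)
    exact (abs_sub _ _).trans (by linarith)
  · refine Eventually.of_forall fun x => ?_
    obtain ⟨N, hN⟩ := exists_nat_ge |(u : Lp ℝ 2 μ) x|
    refine tendsto_const_nhds.congr' ?_
    filter_upwards [eventually_ge_atTop N] with n hn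
    exact (clamp_eq_self (hN.trans (by exact_mod_cast hn))).symm

end Algebra

end DirichletForm

namespace DirichletForm

section Lcomp

variable {K : Type*} [MeasurableSpace K] {μ : Measure K} (D : DirichletForm μ)

/-- Composition of an element of `bdd` with a Lipschitz function vanishing at `0`. -/
def lcomp {Ψ : ℝ → ℝ} {L : ℝ≥0} (hΨ : LipschitzWith L Ψ) (h0 : Ψ 0 = 0) (a : D.bdd) : D.bdd :=
  ⟨fun x => Ψ ((a : K → ℝ) x),
    ((D.represents_el a).exists_lipschitz hΨ h0).imp fun _ h => h.1, by
      obtain ⟨C, hC⟩ := D.exists_nnreal_bound a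
      refine ⟨L * C, hC.mono fun x hx => ?_⟩
      have := hΨ.dist_le_mul ((a : K → ℝ) x) 0
      simp only [h0, Real.dist_eq, sub_zero] at this
      rw [NNReal.coe_mul]
      exact this.trans (mul_le_mul_of_nonneg_left hx L.2)⟩

@[simp] lemma lcomp_apply {Ψ : ℝ → ℝ} {L : ℝ≥0} (hΨ : LipschitzWith L Ψ) (h0 : Ψ 0 = 0)
    (a : D.bdd) (x : K) : (D.lcomp hΨ h0 a : K → ℝ) x = Ψ ((a : K → ℝ) x) := rfl

lemma ef_lcomp_le {Ψ : ℝ → ℝ} {L : ℝ≥0} (hΨ : LipschitzWith L Ψ) (h0 : Ψ 0 = 0) (a : D.bdd) :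
    D.ef (D.lcomp hΨ h0 a) (D.lcomp hΨ h0 a) ≤ L ^ 2 * D.ef a a := by
  obtain ⟨v, hv, hE⟩ := (D.represents_el a).exists_lipschitz hΨ h0
  have : D.el (D.lcomp hΨ h0 a) = v := Represents.el_eq hv
  rw [ef_apply, this]
  exact hE

end Lcomp

/-! ### Continuous core functions and the construction of energy measures. -/

section Core

variable {K : Type*} [TopologicalSpace K] [MeasurableSpace K] {μ : Measure K} (D : DirichletForm μ)

/-- The elements of `bdd` that are continuous with compact support. -/
def IsCore (φ : D.bdd) : Prop := Continuous (φ : K → ℝ) ∧ HasCompactSupport (φ : K → ℝ)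

variable {D}

lemma exists_isCore {p : D.domain} {φ : K → ℝ} (h1 : Continuous φ) (h2 : HasCompactSupport φ)
    (h3 : D.Represents p φ) : ∃ a : D.bdd, D.IsCore a ∧ (a : K → ℝ) = φ ∧ D.el a = p := by
  obtain ⟨C, hC⟩ := h1.bounded_above_of_compact_support h2
  have hb : ∃ C : ℝ≥0, ∀ᵐ x ∂μ, |φ x| ≤ C :=
    ⟨C.toNNReal, Eventually.of_forall fun x => (hC x).trans (Real.le_coe_toNNReal C)⟩
  exact ⟨h3.toBdd hb, ⟨h1, h2⟩, rfl, h3.el_toBdd hb⟩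

lemma IsCore.lcomp {a : D.bdd} (ha : D.IsCore a) {Ψ : ℝ → ℝ} {L : ℝ≥0} (hΨ : LipschitzWith L Ψ)
    (h0 : Ψ 0 = 0) : D.IsCore (D.lcomp hΨ h0 a) :=
  ⟨hΨ.continuous.comp ha.1, ha.2.comp_left h0⟩

lemma IsCore.add {a b : D.bdd} (ha : D.IsCore a) (hb : D.IsCore b) : D.IsCore (a + b) :=
  ⟨ha.1.add hb.1, ha.2.add hb.2⟩

lemma IsCore.smul {a : D.bdd} (ha : D.IsCore a) (t : ℝ) : D.IsCore (t • a) :=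
  ⟨ha.1.const_smul t, ha.2.smul_left (f := fun _ => t)⟩

lemma IsRegular.exists_core_energyOne (hreg : D.IsRegular) (u : D.domain) {ε : ℝ} (hε : 0 < ε) :
    ∃ a : D.bdd, D.IsCore a ∧ D.energyOne (D.el a - u) < ε := by
  obtain ⟨p, φ, h1, h2, h3, h4⟩ := hreg.1 u ε hε
  obtain ⟨a, ha, -, rfl⟩ := exists_isCore h1 h2 h3
  exact ⟨a, ha, by rwa [energyOne_sub_comm]⟩

lemma IsRegular.exists_core_seq (hreg : D.IsRegular) (u : D.domain) :
    ∃ a : ℕ → D.bdd, (∀ n, D.IsCore (a n)) ∧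
      Tendsto (fun n => D.energyOne (D.el (a n) - u)) atTop (𝓝 0) := by
  choose a ha hE using fun n : ℕ => hreg.exists_core_energyOne u (ε := 1 / ((n : ℝ) + 1)) (by positivity)
  exact ⟨a, ha, squeeze_zero (fun n => D.energyOne_nonneg _) (fun n => (hE n).le)
    tendsto_one_div_add_atTop_nhds_zero_nat⟩

/-- A bounded element of the domain is the limit of a uniformly bounded sequence in the core. -/
lemma IsRegular.exists_core_seq_bounded (hreg : D.IsRegular) {u : D.domain} {w : K → ℝ}
    (hw : D.Represents u w) {C : ℝ≥0} (hC : ∀ᵐ x ∂μ, |w x| ≤ C) :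
    ∃ a : ℕ → D.bdd, (∀ n, D.IsCore (a n)) ∧ (∀ n x, |(a n : K → ℝ) x| ≤ C) ∧
      Tendsto (fun n => D.energyOne (D.el (a n) - u)) atTop (𝓝 0) := by
  obtain ⟨a, ha, hE⟩ := hreg.exists_core_seq u
  have l := lipschitzWith_clamp C
  have l0 : clamp C 0 = 0 := clamp_zero (NNReal.coe_nonneg C)
  refine ⟨fun n => D.lcomp l l0 (a n), fun n => (ha n).lcomp l l0,
    fun n x => abs_clamp_le C.2 _, ?_⟩
  have h1 : ∀ n, D.form (D.el (D.lcomp l l0 (a n))) (D.el (D.lcomp l l0 (a n)))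
      ≤ D.form (D.el (a n)) (D.el (a n)) := fun n => by
    have := D.ef_lcomp_le l l0 (a n)
    rwa [NNReal.coe_one, one_pow, one_mul] at this
  have h2 := D.tendsto_form_self_of_energyOne hE
  obtain ⟨R, hR⟩ := h2.bddAbove_range
  -- Truncation does not raise the energies, and the energies before truncation converge to `E(u,
  -- u)`; this upper bound turns weak convergence into strong convergence.
  refine D.tendsto_energyOne_of_le (C := R)
    (fun n => (h1 n).trans (hR ⟨n, rfl⟩)) h2 h1 ?_
  refine squeeze_zero (fun _ => norm_nonneg _) (fun n => ?_) (D.tendsto_norm_of_energyOne hE)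
  refine Lp.norm_le_norm_of_ae_le ?_
  filter_upwards [Lp.coeFn_sub (D.el (D.lcomp l l0 (a n)) : Lp ℝ 2 μ) u,
    Lp.coeFn_sub (D.el (a n) : Lp ℝ 2 μ) u, D.represents_el (a n),
    D.represents_el (D.lcomp l l0 (a n)), hw, hC] with x h1 h2 h3 h4 h5 h6
  rw [h1, h2, Pi.sub_apply, Pi.sub_apply, h3, h4, h5, lcomp_apply]
  have := l.dist_le_mul ((a n : K → ℝ) x) (w x)
  rw [clamp_eq_self h6, NNReal.coe_one, one_mul] at this
  exact this

lemma IsRegular.exists_core_uniform (hreg : D.IsRegular) {ψ : K → ℝ} (h1 : Continuous ψ)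
    (h2 : HasCompactSupport ψ) {ε : ℝ} (hε : 0 < ε) :
    ∃ a : D.bdd, D.IsCore a ∧ ∀ x, |ψ x - (a : K → ℝ) x| < ε := by
  obtain ⟨p, φ, h3, h4, h5, h6⟩ := hreg.2 ψ h1 h2 ε hε
  obtain ⟨a, ha, rfl, -⟩ := exists_isCore h3 h4 h5
  exact ⟨a, ha, h6⟩

/-- Approximation from below in the core. -/
lemma IsRegular.exists_core_le (hreg : D.IsRegular) {ψ : K → ℝ} (h1 : Continuous ψ)
    (h2 : HasCompactSupport ψ) (h0 : ∀ x, 0 ≤ ψ x) {ε : ℝ} (hε : 0 < ε) :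
    ∃ a : D.bdd, D.IsCore a ∧ ∀ x, 0 ≤ (a : K → ℝ) x ∧ (a : K → ℝ) x ≤ ψ x ∧
      ψ x ≤ (a : K → ℝ) x + ε := by
  obtain ⟨a, ha, hb⟩ := hreg.exists_core_uniform h1 h2 (half_pos hε)
  -- An approximation with error `ε / 2`, lowered by `ε / 2`, lies below `ψ` and within `ε` of it;
  -- the positive part restores nonnegativity and the value `0` at `0`.
  have l : LipschitzWith 1 (fun t : ℝ => max (t - ε / 2) 0) :=
    ((LipschitzWith.id.sub (LipschitzWith.const (ε / 2))).weaken (by simp)).max_const 0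
  have l0 : max ((0 : ℝ) - ε / 2) 0 = 0 := max_eq_right (by linarith)
  refine ⟨D.lcomp l l0 a, ha.lcomp l l0, fun x => ?_⟩
  rw [lcomp_apply]
  have := abs_lt.1 (hb x)
  refine ⟨le_max_right _ _, max_le (by linarith) (h0 x), ?_⟩
  have := le_max_left ((a : K → ℝ) x - ε / 2) 0
  linarith

variable [LocallyCompactSpace K] [TopologicalSpace.MetrizableSpace K]

/-- Cutoff functions in the core. -/
lemma IsRegular.exists_cutoff (hreg : D.IsRegular) {k : Set K} (hk : IsCompact k) :
    ∃ a : D.bdd, D.IsCore a ∧ (∀ x, 0 ≤ (a : K → ℝ) x ∧ (a : K → ℝ) x ≤ 1) ∧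
      ∃ V, IsOpen V ∧ k ⊆ V ∧ ∀ x ∈ V, (a : K → ℝ) x = 1 := by
  obtain ⟨k', hk', hkk'⟩ := exists_compact_superset hk
  obtain ⟨ψ, h1, -, h2, h3⟩ := exists_continuous_one_zero_of_isCompact hk' isClosed_empty
    (disjoint_empty _)
  -- Approximating `2ψ` with error `1` leaves a value of at least `1` wherever `ψ = 1`, so
  -- truncation at `1` gives exactly `1` there.
  obtain ⟨a, ha, hb⟩ := hreg.exists_core_le (ψ := fun x => 2 * ψ x)
    (continuous_const.mul ψ.continuous) (h2.mul_left (f := fun _ => (2 : ℝ)))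
    (fun x => mul_nonneg zero_le_two (h3 x).1) zero_lt_one
  have l : LipschitzWith 1 (fun t : ℝ => min t 1) := LipschitzWith.id.min_const 1
  have l0 : min (0 : ℝ) 1 = 0 := min_eq_left zero_le_one
  refine ⟨D.lcomp l l0 a, ha.lcomp l l0, fun x => ?_, interior k', isOpen_interior, hkk', ?_⟩
  · rw [lcomp_apply]
    exact ⟨le_min (hb x).1 zero_le_one, min_le_right _ _⟩
  · intro x hx
    have h4 : ψ x = 1 := h1 (interior_subset hx)
    have := (hb x).2.2
    rw [h4] at this
    rw [lcomp_apply, min_eq_right (by linarith)]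

variable [BorelSpace K]

section SecondCountable

variable [SecondCountableTopology K]

/-- A finite measure is determined by the integrals of the functions of the core. -/
lemma IsRegular.measure_ext (hreg : D.IsRegular) {P N : Measure K} [IsFiniteMeasure P]
    [IsFiniteMeasure N]
    (h : ∀ φ : D.bdd, D.IsCore φ → ∫ x, (φ : K → ℝ) x ∂P = ∫ x, (φ : K → ℝ) x ∂N) : P = N := by
  let := TopologicalSpace.metrizableSpaceMetric K
  refine Measure.ext_of_integral_eq_on_compactlySupported fun ψ => ?_
  have hint : ∀ (Q : Measure K) [IsFiniteMeasure Q] (φ : K → ℝ), Continuous φ →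
      HasCompactSupport φ → Integrable φ Q := fun Q _ φ h1 h2 =>
    h1.integrable_of_hasCompactSupport h2
  refine eq_of_abs_sub_nonpos ?_
  refine le_of_forall_pos_le_add fun ε hε => ?_
  have hR : 0 < P.real univ + N.real univ + 1 := by positivity
  obtain ⟨a, ha, hb⟩ := hreg.exists_core_uniform (ψ := fun x => ψ x) ψ.continuous ψ.hasCompactSupport
    (div_pos hε hR)
  have e1 : ∀ (Q : Measure K) [IsFiniteMeasure Q],
      |∫ x, ψ x ∂Q - ∫ x, (a : K → ℝ) x ∂Q| ≤ ε / (P.real univ + N.real univ + 1) * Q.real univ := by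
    intro Q _
    rw [← integral_sub (hint Q (fun x => ψ x) ψ.continuous ψ.hasCompactSupport) (hint Q _ ha.1 ha.2)]
    exact norm_integral_le_of_norm_le_const (f := fun x => ψ x - (a : K → ℝ) x) (Eventually.of_forall fun x => (hb x).le)
  have e2 := e1 P
  have e3 := e1 N
  rw [h a ha] at e2
  have e4 : ε / (P.real univ + N.real univ + 1) * P.real univ
      + ε / (P.real univ + N.real univ + 1) * N.real univ ≤ ε := by
    rw [← mul_add, div_mul_eq_mul_div, div_le_iff₀ hR]
    nlinarith
  rw [zero_add]
  calc _ = |(∫ x, ψ x ∂P - ∫ x, (a : K → ℝ) x ∂N) - (∫ x, ψ x ∂N - ∫ x, (a : K → ℝ) x ∂N)| := by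
        congr 1; ring
    _ ≤ _ := abs_sub _ _
    _ ≤ ε := by linarith

/-- A weighted combination of finite measures that annihilates the core annihilates the bounded
Borel functions. -/
lemma IsRegular.sum_integral_eq_zero (hreg : D.IsRegular) {ι : Type*} [Fintype ι]
    (m : ι → Measure K) [∀ i, IsFiniteMeasure (m i)] {c : ι → K → ℝ} (hc : ∀ i, Measurable (c i))
    {C : ℝ} (hC : ∀ i x, |c i x| ≤ C)
    (h : ∀ φ : D.bdd, D.IsCore φ → ∑ i, ∫ x, (φ : K → ℝ) x * c i x ∂(m i) = 0)
    {ψ : K → ℝ} (hψ : Measurable ψ) {M : ℝ} (hM : ∀ x, |ψ x| ≤ M) :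
    ∑ i, ∫ x, ψ x * c i x ∂(m i) = 0 := by
  -- Splitting the weights into positive and negative parts turns the hypothesis into the equality
  -- of two finite measures on the core, hence everywhere.
  let P : Measure K := ∑ i, (m i).withDensity fun x => ((c i x).toNNReal : ℝ≥0∞)
  let N : Measure K := ∑ i, (m i).withDensity fun x => ((- c i x).toNNReal : ℝ≥0∞)
  have hb : ∀ (i) (g : K → ℝ≥0), Measurable g → (∀ x, (g x : ℝ) ≤ C) →
      IsFiniteMeasure ((m i).withDensity fun x => (g x : ℝ≥0∞)) := by
    intro i g hg hgC
    refine isFiniteMeasure_withDensity (lt_of_le_of_lt (lintegral_mono (g := fun _ => ENNReal.ofReal C)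
      fun x => ?_) ?_).ne
    · rw [← ENNReal.ofReal_coe_nnreal]; exact ENNReal.ofReal_le_ofReal (hgC x)
    · rw [lintegral_const]; finiteness
  have hCle : ∀ i x, ((c i x).toNNReal : ℝ) ≤ C := fun i x => by
    rw [Real.coe_toNNReal']
    exact max_le ((le_abs_self _).trans (hC i x)) ((abs_nonneg _).trans (hC i x))
  have hCle' : ∀ i x, ((- c i x).toNNReal : ℝ) ≤ C := fun i x => by
    rw [Real.coe_toNNReal']
    exact max_le ((neg_le_abs _).trans (hC i x)) ((abs_nonneg _).trans (hC i x))
  have f1 : ∀ i, IsFiniteMeasure ((m i).withDensity fun x => ((c i x).toNNReal : ℝ≥0∞)) :=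
    fun i => hb i _ (hc i).real_toNNReal (hCle i)
  have f2 : ∀ i, IsFiniteMeasure ((m i).withDensity fun x => ((- c i x).toNNReal : ℝ≥0∞)) :=
    fun i => hb i _ (hc i).neg.real_toNNReal (hCle' i)
  have hbi : ∀ (Q : Measure K) [IsFiniteMeasure Q] (g : K → ℝ) (R : ℝ), Measurable g →
      (∀ x, |g x| ≤ R) → Integrable g Q := fun Q _ g R hg hR =>
    Integrable.of_bound hg.aestronglyMeasurable R (Eventually.of_forall hR)
  have key : ∀ (g : K → ℝ) (R : ℝ), Measurable g → (∀ x, |g x| ≤ R) →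
      ∫ x, g x ∂P - ∫ x, g x ∂N = ∑ i, ∫ x, g x * c i x ∂(m i) := by
    intro g R hg hR
    have f1' := f1
    have f2' := f2
    have hn : ∀ i, Measurable fun x => (- c i x).toNNReal := fun i => (hc i).neg.real_toNNReal
    rw [integral_finsetSum_measure fun i _ => hbi _ g R hg hR,
      integral_finsetSum_measure fun i _ => hbi _ g R hg hR, ← Finset.sum_sub_distrib]
    refine Finset.sum_congr rfl fun i _ => ?_
    rw [integral_withDensity_eq_integral_smul (hc i).real_toNNReal,
      integral_withDensity_eq_integral_smul (hn i), ← integral_sub]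
    · refine integral_congr_ae (Eventually.of_forall fun x => ?_)
      simp only [NNReal.smul_def, smul_eq_mul, Real.coe_toNNReal']
      rcases le_total 0 (c i x) with h | h
      · rw [max_eq_left h, max_eq_right (by linarith)]; ring
      · rw [max_eq_right h, max_eq_left (by linarith)]; ring
    · refine hbi _ _ (C * R) ((hc i).real_toNNReal.smul hg) fun x => ?_
      simp only [NNReal.smul_def, smul_eq_mul, abs_mul, NNReal.abs_eq]
      exact mul_le_mul (hCle i x) (hR x) (abs_nonneg _) ((abs_nonneg _).trans (hC i x))
    · refine hbi _ _ (C * R) ((hn i).smul hg) fun x => ?_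
      simp only [NNReal.smul_def, smul_eq_mul, abs_mul, NNReal.abs_eq]
      exact mul_le_mul (hCle' i x) (hR x) (abs_nonneg _) ((abs_nonneg _).trans (hC i x))
  have hPN : P = N := by
    refine hreg.measure_ext fun φ hφ => ?_
    obtain ⟨R, hR⟩ := hφ.1.bounded_above_of_compact_support hφ.2
    have := key φ R hφ.1.measurable hR
    rw [h φ hφ] at this
    linarith
  rw [← key ψ M hψ hM, hPN, sub_self]

end SecondCountable

open CompactlySupported CompactlySupportedContinuousMap

/-- Existence of the energy measure of a bounded element. -/
lemma IsRegular.exists_energyMeasure (hreg : D.IsRegular) (f : D.bdd) :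
    ∃ m : Measure K, m univ ≤ ENNReal.ofReal (2 * D.ef f f) ∧
      ∀ φ : D.bdd, D.IsCore φ → ∫ x, (φ : K → ℝ) x ∂m = D.gam f f φ := by
  let := TopologicalSpace.metrizableSpaceMetric K
  have hbd : ∀ ψ : C_c(K, ℝ), ∃ C : ℝ≥0, ∀ᵐ x ∂μ, |ψ x| ≤ C := fun ψ => by
    obtain ⟨C, hC⟩ := ψ.continuous.bounded_above_of_compact_support ψ.hasCompactSupport
    exact ⟨C.toNNReal, Eventually.of_forall fun x => (hC x).trans (Real.le_coe_toNNReal C)⟩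
  let dom : Submodule ℝ C_c(K, ℝ) :=
    { carrier := {ψ | ∃ u : D.domain, D.Represents u ψ}
      add_mem' := by
        rintro a b ⟨u, hu⟩ ⟨v, hv⟩
        exact ⟨u + v, hu.add hv⟩
      zero_mem' := ⟨0, D.represents_zero⟩
      smul_mem' := by
        rintro t a ⟨u, hu⟩
        exact ⟨t • u, hu.smul t⟩ }
  let tb : dom → D.bdd := fun ψ => ⟨(ψ : C_c(K, ℝ)), ψ.2, hbd ψ⟩
  let F : C_c(K, ℝ) →ₗ.[ℝ] ℝ :=
    { domain := dom
      toFun :=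
        { toFun := fun ψ => D.gam f f (tb ψ)
          map_add' := fun ψ χ => D.gam_add_test f f (tb ψ) (tb χ)
          map_smul' := fun t ψ => D.gam_smul_test t f f (tb ψ) } }
  let cone : PointedCone ℝ C_c(K, ℝ) :=
    { carrier := {ψ | ∀ x, 0 ≤ ψ x}
      add_mem' := fun ha hb x => add_nonneg (ha x) (hb x)
      zero_mem' := fun x => le_rfl
      smul_mem' := fun t a ha x => mul_nonneg t.2 (ha x) }
  -- The functional `gam f f` is positive on the core, and every `ψ` in `C_c(K)` becomes nonnegative
  -- after adding a core function. The M. Riesz extension theorem then gives a positive functional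
  -- on all of `C_c(K)`, to which Riesz-Markov-Kakutani applies.
  obtain ⟨g, hg1, hg2⟩ := riesz_extension cone F
    (fun ψ hψ => D.gam_self_nonneg f (Eventually.of_forall fun x => hψ x))
    (fun ψ => by
      have h1 : Continuous fun x => 2 * |ψ x| := continuous_const.mul ψ.continuous.abs
      have h2 : HasCompactSupport fun x => 2 * |ψ x| :=
        ψ.hasCompactSupport.comp_left (g := fun t => 2 * |t|) (by simp)
      obtain ⟨χ, hχ1, -, hχ2, hχ3⟩ := exists_continuous_one_zero_of_isCompact
        ψ.hasCompactSupport.isCompact isClosed_empty (disjoint_empty _)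
      obtain ⟨C, hC⟩ := ψ.continuous.bounded_above_of_compact_support ψ.hasCompactSupport
      obtain ⟨a, ha, hb⟩ := hreg.exists_core_uniform (ψ := fun x => |ψ x| + χ x)
        (ψ.continuous.abs.add χ.continuous)
        ((ψ.hasCompactSupport.comp_left (g := fun t => |t|) (by simp)).add hχ2) zero_lt_one
      have l : LipschitzWith 1 (fun t : ℝ => max t 0) := LipschitzWith.id.max_const 0
      let a' := D.lcomp l (max_self 0) a
      have ha' : D.IsCore a' := ha.lcomp l (max_self 0)
      refine ⟨⟨⟨⟨a', ha'.1⟩, ha'.2⟩, D.el a', D.represents_el a'⟩, ?_⟩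
      intro x
      change 0 ≤ max ((a : K → ℝ) x) 0 + ψ x
      have h3 := abs_lt.1 (hb x)
      by_cases hx : x ∈ tsupport ψ
      · have h4 : χ x = 1 := hχ1 hx
        rw [h4] at h3
        have := neg_abs_le (ψ x)
        have := le_max_left ((a : K → ℝ) x) 0
        linarith
      · rw [image_eq_zero_of_notMem_tsupport hx, add_zero]
        exact le_max_right _ _)
  let Λ : C_c(K, ℝ) →ₚ[ℝ] ℝ := PositiveLinearMap.mk₀ g
    (fun ψ hψ => hg2 ψ fun x => hψ x)
  have hΛ : ∀ φ : D.bdd, D.IsCore φ → ∫ x, (φ : K → ℝ) x ∂(RealRMK.rieszMeasure Λ) = D.gam f f φ := by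
    intro φ hφ
    have h1 := RealRMK.integral_rieszMeasure Λ ⟨⟨φ, hφ.1⟩, hφ.2⟩
    exact h1.trans (hg1 ⟨⟨⟨φ, hφ.1⟩, hφ.2⟩, D.el φ, D.represents_el φ⟩)
  refine ⟨RealRMK.rieszMeasure Λ, ?_, hΛ⟩
  -- A cutoff equal to `1` on `k` with values in `[0, 1]` bounds the mass of `k` by `gam_self_le`
  -- with constant `1`; inner regularity then bounds the total mass.
  have hcomp : ∀ k : Set K, IsCompact k →
      RealRMK.rieszMeasure Λ k ≤ ENNReal.ofReal (2 * D.ef f f) := by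
    intro k hk
    obtain ⟨a, ha, ha1, V, -, hkV, hV⟩ := hreg.exists_cutoff hk
    have h1 := hΛ a ha
    have h2 : D.gam f f a ≤ 2 * D.ef f f := by
      simpa using D.gam_self_le f (φ := a) (C := 1) (Eventually.of_forall fun x => (ha1 x).1)
        (Eventually.of_forall fun x => (ha1 x).2)
    have h3 : Integrable (a : K → ℝ) (RealRMK.rieszMeasure Λ) :=
      ha.1.integrable_of_hasCompactSupport ha.2
    have h4 : (RealRMK.rieszMeasure Λ).real k ≤ ∫ x, (a : K → ℝ) x ∂(RealRMK.rieszMeasure Λ) := by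
      rw [← integral_indicator_one hk.measurableSet]
      refine integral_mono ?_ h3 fun x => ?_
      · exact (integrable_indicator_iff hk.measurableSet).2 (integrableOn_const hk.measure_lt_top.ne)
      · by_cases hx : x ∈ k
        · rw [indicator_of_mem hx, hV x (hkV hx)]; rfl
        · rw [indicator_of_notMem hx]; exact (ha1 x).1
    rw [← ENNReal.ofReal_toReal hk.measure_lt_top.ne]
    exact ENNReal.ofReal_le_ofReal (h4.trans (h1.le.trans h2))
  rw [isOpen_univ.measure_eq_iSup_isCompact]
  exact iSup₂_le fun k _ => iSup_le fun hk => hcomp k hk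

end Core

end DirichletForm

lemma isOpen_union_preimage {X : Type*} [TopologicalSpace X] {w : X → ℝ} {U : Set X}
    (hU : IsOpen U) (hw : ContinuousOn w Uᶜ)
    {O : Set ℝ} (hO : IsOpen O) : IsOpen (U ∪ w ⁻¹' O) := by
  obtain ⟨O', hO', h⟩ := continuousOn_iff'.1 hw O hO
  have : U ∪ w ⁻¹' O = U ∪ O' := by
    ext x
    by_cases hx : x ∈ U
    · simp [hx]
    · have := Set.ext_iff.1 h x
      simp only [mem_inter_iff, mem_compl_iff, hx, not_false_eq_true, and_true] at this
      simp [hx, ← this]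
  rw [this]
  exact hU.union hO'

namespace DirichletForm

/-! ### Capacity test functions and quasi-continuity. -/

section TestFunctions

variable {K : Type*} [MeasurableSpace K] {μ : Measure K} {D : DirichletForm μ}

lemma exists_abs (u : D.domain) : ∃ v : D.domain,
    D.Represents v (fun x => |(u : Lp ℝ 2 μ) x|) ∧ D.energyOne v ≤ D.energyOne u := by
  have l : LipschitzWith 1 (fun t : ℝ => |t|) := lipschitzWith_one_norm
  obtain ⟨v, hv, hE⟩ := D.exists_lipschitz_comp u l abs_zero
  refine ⟨v, hv, ?_⟩
  have h1 : ‖(v : Lp ℝ 2 μ)‖ ≤ ‖(u : Lp ℝ 2 μ)‖ :=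
    Lp.norm_le_norm_of_ae_le (by filter_upwards [hv] with x hx; rw [hx]; simp)
  unfold energyOne
  have h2 := pow_le_pow_left₀ (norm_nonneg _) h1 2
  simp only [NNReal.coe_one, one_pow, one_mul] at hE
  linarith

/-- Capacity is subadditive, up to a constant. -/
lemma exists_test_union {U V : Set K} {e e' : D.domain}
    (he : ∀ᵐ x ∂μ, x ∈ U → 1 ≤ (e : Lp ℝ 2 μ) x) (he' : ∀ᵐ x ∂μ, x ∈ V → 1 ≤ (e' : Lp ℝ 2 μ) x) :
    ∃ p : D.domain, (∀ᵐ x ∂μ, x ∈ U ∪ V → 1 ≤ (p : Lp ℝ 2 μ) x) ∧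
      D.energyOne p ≤ 2 * D.energyOne e + 2 * D.energyOne e' := by
  obtain ⟨p, hp, hpE⟩ := exists_abs e
  obtain ⟨q, hq, hqE⟩ := exists_abs e'
  refine ⟨p + q, ?_, (D.energyOne_add_le p q).trans (by linarith)⟩
  filter_upwards [he, he', (hp.add hq : _ =ᵐ[μ] _)] with x h1 h2 h3 hx
  rw [h3, Pi.add_apply]
  rcases hx with hx | hx
  · linarith [h1 hx, le_abs_self ((e : Lp ℝ 2 μ) x), abs_nonneg ((e' : Lp ℝ 2 μ) x)]
  · linarith [h2 hx, le_abs_self ((e' : Lp ℝ 2 μ) x), abs_nonneg ((e : Lp ℝ 2 μ) x)]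

end TestFunctions

section QuasiContinuity

variable {K : Type*} [TopologicalSpace K] [MeasurableSpace K] {μ : Measure K} (D : DirichletForm μ)

/-- A quantitative form of quasi-continuity, in terms of test functions for the capacity. -/
def QC (w : K → ℝ) : Prop := ∀ ε : ℝ, 0 < ε → ∃ (U : Set K) (e : D.domain), IsOpen U ∧
  D.energyOne e < ε ∧ (∀ᵐ x ∂μ, x ∈ U → 1 ≤ (e : Lp ℝ 2 μ) x) ∧ ContinuousOn w Uᶜ

variable {D}

lemma IsQuasiContinuous.qc {w : K → ℝ} (hw : D.IsQuasiContinuous w) : D.QC w := by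
  intro ε hε
  obtain ⟨U, -, hcap, hcont⟩ := hw (ENNReal.ofReal ε) (ENNReal.ofReal_pos.2 hε)
  unfold cap capOpen at hcap
  simp only [iInf_lt_iff] at hcap
  obtain ⟨U', hU', hUU', e, he, hlt⟩ := hcap
  refine ⟨U', e, hU', ?_, he, hcont.mono (compl_subset_compl.2 hUU')⟩
  exact (ENNReal.ofReal_lt_ofReal_iff hε).1 hlt

lemma QC.isQuasiContinuous {w : K → ℝ} (hw : D.QC w) : D.IsQuasiContinuous w := by
  intro ε hε
  obtain ⟨δ, hδ, hδε⟩ := ENNReal.lt_iff_exists_nnreal_btwn.1 hε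
  obtain ⟨U, e, hU, hlt, he, hcont⟩ := hw δ (by exact_mod_cast hδ)
  refine ⟨U, hU, lt_of_le_of_lt ?_ hδε, hcont⟩
  refine (iInf₂_le U hU).trans ((iInf_le _ subset_rfl).trans ((iInf₂_le e he).trans ?_))
  exact ENNReal.ofReal_le_of_le_toReal (by simpa using hlt.le)

lemma QC.comp₂ {a b : K → ℝ} (ha : D.QC a) (hb : D.QC b) {F : ℝ → ℝ → ℝ}
    (hF : Continuous (Function.uncurry F)) : D.QC (fun x => F (a x) (b x)) := by
  intro ε hε
  obtain ⟨U, e, hU, hlt, he, hcont⟩ := ha (ε / 4) (by positivity)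
  obtain ⟨V, e', hV, hlt', he', hcont'⟩ := hb (ε / 4) (by positivity)
  obtain ⟨p, hp, hpE⟩ := exists_test_union he he'
  refine ⟨U ∪ V, p, hU.union hV, by linarith, hp, ?_⟩
  refine hF.comp_continuousOn (ContinuousOn.prodMk (hcont.mono ?_) (hcont'.mono ?_))
  · exact compl_subset_compl.2 subset_union_left
  · exact compl_subset_compl.2 subset_union_right

lemma QC.comp {a : K → ℝ} (ha : D.QC a) {F : ℝ → ℝ} (hF : Continuous F) :
    D.QC (fun x => F (a x)) :=
  ha.comp₂ ha (F := fun s _ => F s) (hF.comp continuous_fst)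

lemma QC.mul {a b : K → ℝ} (ha : D.QC a) (hb : D.QC b) : D.QC (a * b) :=
  ha.comp₂ hb (F := fun s t => s * t) (by fun_prop)

lemma QC.add {a b : K → ℝ} (ha : D.QC a) (hb : D.QC b) : D.QC (a + b) :=
  ha.comp₂ hb (F := fun s t => s + t) (by fun_prop)

lemma qc_of_continuous {a : K → ℝ} (ha : Continuous a) : D.QC a := fun ε hε =>
  ⟨∅, 0, isOpen_empty, by simpa [energyOne] using hε, by simp, ha.continuousOn⟩

lemma QC.const_smul {a : K → ℝ} (ha : D.QC a) (t : ℝ) : D.QC (t • a) :=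
  ha.comp (F := fun s => t * s) (by fun_prop)

end QuasiContinuity

/-! ### Energy measures of bounded elements against quasi-continuous functions. -/

section EnergyMeasure

variable {K : Type*} [TopologicalSpace K] [MeasurableSpace K] {μ : Measure K} {D : DirichletForm μ}
  [LocallyCompactSpace K] [TopologicalSpace.MetrizableSpace K] [BorelSpace K]
  [SecondCountableTopology K]

/-- The energy measure of a bounded element. -/
def IsRegular.nuB (hreg : D.IsRegular) (f : D.bdd) : Measure K :=
  (hreg.exists_energyMeasure f).choose

instance (hreg : D.IsRegular) (f : D.bdd) : IsFiniteMeasure (hreg.nuB f) :=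
  ⟨(hreg.exists_energyMeasure f).choose_spec.1.trans_lt ENNReal.ofReal_lt_top⟩

lemma IsRegular.nuB_univ_le (hreg : D.IsRegular) (f : D.bdd) :
    hreg.nuB f univ ≤ ENNReal.ofReal (2 * D.ef f f) :=
  (hreg.exists_energyMeasure f).choose_spec.1

lemma IsRegular.integral_nuB_core (hreg : D.IsRegular) (f : D.bdd) {φ : D.bdd} (hφ : D.IsCore φ) :
    ∫ x, (φ : K → ℝ) x ∂(hreg.nuB f) = D.gam f f φ :=
  (hreg.exists_energyMeasure f).choose_spec.2 φ hφ

/-- A core function squeezed under a Urysohn function supported in `V` is almost everywhere at most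
`e`, and `gam f f` is monotone in its test function. Inner regularity passes from compact subsets to
`V`. -/
lemma IsRegular.nuB_open_le (hreg : D.IsRegular) (f : D.bdd) {V : Set K} (hV : IsOpen V)
    {e : D.bdd} (he0 : ∀ᵐ x ∂μ, 0 ≤ (e : K → ℝ) x) (he : ∀ᵐ x ∂μ, x ∈ V → 1 ≤ (e : K → ℝ) x) :
    hreg.nuB f V ≤ ENNReal.ofReal (D.gam f f e) := by
  let := TopologicalSpace.metrizableSpaceMetric K
  rw [hV.measure_eq_iSup_isCompact]
  refine iSup₂_le fun k hkV => iSup_le fun hk => ?_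
  obtain ⟨ψ, h1, h2, h3, h4⟩ := exists_continuous_one_zero_of_isCompact hk hV.isClosed_compl
    (disjoint_compl_right_iff_subset.2 hkV)
  have hint : ∀ φ : K → ℝ, Continuous φ → HasCompactSupport φ → Integrable φ (hreg.nuB f) :=
    fun φ h1 h2 => h1.integrable_of_hasCompactSupport h2
  rw [← ENNReal.ofReal_toReal hk.measure_lt_top.ne]
  refine ENNReal.ofReal_le_ofReal (le_of_forall_pos_le_add fun ε hε => ?_)
  have hR : 0 < (hreg.nuB f).real univ + 1 := by positivity
  obtain ⟨a, ha, hb⟩ := hreg.exists_core_le (ψ := ψ) ψ.continuous h3 (fun x => (h4 x).1)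
    (div_pos hε hR)
  have e1 : (hreg.nuB f).real k ≤ ∫ x, ψ x ∂(hreg.nuB f) := by
    rw [← integral_indicator_one hk.measurableSet]
    refine integral_mono ?_ (hint ψ ψ.continuous h3) fun x => ?_
    · exact (integrable_indicator_iff hk.measurableSet).2 (integrableOn_const hk.measure_lt_top.ne)
    · by_cases hx : x ∈ k
      · rw [indicator_of_mem hx, h1 hx]
      · rw [indicator_of_notMem hx]; exact (h4 x).1
  have e2 : ∫ x, ψ x ∂(hreg.nuB f) ≤ ∫ x, ((a : K → ℝ) x + ε / ((hreg.nuB f).real univ + 1)) ∂(hreg.nuB f) :=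
    integral_mono (hint ψ ψ.continuous h3) ((hint a ha.1 ha.2).add (integrable_const _))
      fun x => (hb x).2.2
  rw [integral_add (hint a ha.1 ha.2) (integrable_const _), hreg.integral_nuB_core f ha,
    integral_const, smul_eq_mul] at e2
  have e3 : (hreg.nuB f).real univ * (ε / ((hreg.nuB f).real univ + 1)) ≤ ε := by
    rw [mul_div_assoc', div_le_iff₀ hR]; nlinarith
  have e4 : D.gam f f a ≤ D.gam f f e := by
    have := D.gam_self_nonneg f (φ := e - a) (by
      filter_upwards [he0, he] with x hx1 hx2
      change 0 ≤ (e : K → ℝ) x - (a : K → ℝ) x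
      by_cases hx : x ∈ V
      · linarith [hx2 hx, (hb x).2.1, (h4 x).2]
      · have : ψ x = 0 := h2 hx
        linarith [(hb x).2.1])
    rw [sub_eq_add_neg, gam_add_test, ← neg_one_smul ℝ a, gam_smul_test] at this
    linarith
  change (hreg.nuB f).real k ≤ _
  linarith

/-- The energy measure of sets of small capacity is small. -/
lemma IsRegular.tendsto_nuB_of_test (hreg : D.IsRegular) (f : D.bdd) {V : ℕ → Set K}
    (hV : ∀ n, IsOpen (V n)) {e : ℕ → D.domain}
    (he : ∀ n, ∀ᵐ x ∂μ, x ∈ V n → 1 ≤ (e n : Lp ℝ 2 μ) x)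
    (hE : Tendsto (fun n => D.energyOne (e n)) atTop (𝓝 0)) :
    Tendsto (fun n => hreg.nuB f (V n)) atTop (𝓝 0) := by
  have l : LipschitzWith 1 (fun t : ℝ => max (min t 1) 0) :=
    (LipschitzWith.id.min_const 1).max_const 0
  have l0 : max (min (0 : ℝ) 1) 0 = 0 := by norm_num
  have hc : ∀ n, ∃ a : D.bdd, D.energyOne (D.el a) ≤ D.energyOne (e n) ∧
      (∀ᵐ x ∂μ, 0 ≤ (a : K → ℝ) x) ∧ (∀ᵐ x ∂μ, |(a : K → ℝ) x| ≤ (1 : ℝ≥0)) ∧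
      (∀ᵐ x ∂μ, x ∈ V n → 1 ≤ (a : K → ℝ) x) := by
    intro n
    obtain ⟨v, hv, hvE⟩ := D.exists_lipschitz_comp (e n) l l0
    have hv' : D.Represents v _ := hv
    have hb : ∀ x, |max (min ((e n : Lp ℝ 2 μ) x) 1) 0| ≤ (1 : ℝ≥0) := fun x => by
      rw [abs_of_nonneg (le_max_right _ _)]
      exact max_le (min_le_right _ _) zero_le_one
    refine ⟨hv'.toBdd ⟨1, Eventually.of_forall hb⟩, ?_,
      Eventually.of_forall fun x => le_max_right _ _, Eventually.of_forall hb, ?_⟩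
    · rw [hv'.el_toBdd]
      have h1 : ‖(v : Lp ℝ 2 μ)‖ ≤ ‖(e n : Lp ℝ 2 μ)‖ :=
        Lp.norm_le_norm_of_ae_le (by
          filter_upwards [hv] with x hx; rw [hx]
          have := l.dist_le_mul ((e n : Lp ℝ 2 μ) x) 0
          rwa [l0, NNReal.coe_one, one_mul, dist_zero_right, dist_zero_right] at this)
      unfold energyOne
      have h2 := pow_le_pow_left₀ (norm_nonneg _) h1 2
      simp only [NNReal.coe_one, one_pow, one_mul] at hvE
      linarith
    · filter_upwards [he n] with x hx hxV
      exact le_max_of_le_left (le_min (hx hxV) le_rfl)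
  choose a haE ha0 ha1 haV using hc
  have hE' : Tendsto (fun n => D.energyOne (D.el (a n) - D.el 0)) atTop (𝓝 0) := by
    simp only [map_zero, sub_zero]
    exact squeeze_zero (fun n => D.energyOne_nonneg _) haE hE
  obtain ⟨R, hR⟩ := hE.bddAbove_range
  -- Once the test functions are truncated to `[0, 1]` they are uniformly bounded, which is what the
  -- weak continuity of multiplication requires in addition to the energy bound.
  have h1 := D.tendsto_ef_mul (ψ := 0) ha1 (R := R)
    (fun n => (D.form_le_energyOne _).trans ((haE n).trans (hR ⟨n, rfl⟩)))
    (D.tendsto_norm_of_energyOne hE') f f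
  have h2 := D.tendsto_form_of_energyOne hE' (D.el (f * f))
  have h3 : Tendsto (fun n => D.gam f f (a n)) atTop (𝓝 0) := by
    have := (h1.add h1).sub h2
    simpa [gam, ef_apply] using this
  have h4 := ENNReal.tendsto_ofReal h3
  rw [ENNReal.ofReal_zero] at h4
  exact tendsto_of_tendsto_of_tendsto_of_le_of_le tendsto_const_nhds h4 (fun n => zero_le)
    (fun n => hreg.nuB_open_le f (hV n) (ha0 n) (haV n))

/-- A quasi-continuous function vanishing almost everywhere vanishes off a set that is null for the
energy measures. -/
lemma IsRegular.nuB_ne_zero_eq_zero (hreg : D.IsRegular) (f : D.bdd) {w : K → ℝ} (hw : D.QC w)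
    (h0 : ∀ᵐ x ∂μ, w x = 0) : hreg.nuB f {x | w x ≠ 0} = 0 := by
  choose U e hU hlt he hcont using fun n : ℕ => hw (1 / ((n : ℝ) + 1)) (by positivity)
  have hV : ∀ n, IsOpen (U n ∪ w ⁻¹' {0}ᶜ) := fun n =>
    isOpen_union_preimage (hU n) (hcont n) isOpen_compl_singleton
  have h1 := hreg.tendsto_nuB_of_test f hV (e := e)
    (fun n => by
      filter_upwards [he n, h0] with x hx1 hx2 hx
      rcases hx with hx | hx
      · exact hx1 hx
      · exact absurd hx2 hx)
    (squeeze_zero (fun n => D.energyOne_nonneg _) (fun n => (hlt n).le)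
      tendsto_one_div_add_atTop_nhds_zero_nat)
  refine le_antisymm (ge_of_tendsto h1 (Eventually.of_forall fun n => measure_mono ?_)) (zero_le)
  exact fun x hx => Or.inr hx

/-- Integrals of quasi-continuous modifications with respect to energy measures. -/
theorem IsRegular.integral_nuB (hreg : D.IsRegular) (f φ : D.bdd) {w : K → ℝ} (hw : D.QC w)
    (hwφ : (φ : K → ℝ) =ᵐ[μ] w) {C : ℝ≥0} (hC : ∀ x, |w x| ≤ C) :
    ∫ x, w x ∂(hreg.nuB f) = D.gam f f φ := by
  have hC' : ∀ᵐ x ∂μ, |(φ : K → ℝ) x| ≤ C := by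
    filter_upwards [hwφ] with x hx; rw [hx]; exact hC x
  obtain ⟨a, ha, hab, haE⟩ := hreg.exists_core_seq_bounded (D.represents_el φ) hC'
  -- The set where `a n` and `w` differ by more than `δ / 2` is open up to the exceptional set `U n`
  -- of `w`. The union of both is tested by `(2 / δ) |a n - φ|` plus a test function for `U n`, and
  -- the energies of these tend to `0`.
  have hmeas : TendstoInMeasure (hreg.nuB f) (fun n => (a n : K → ℝ)) atTop w := by
    refine tendstoInMeasure_iff_norm.2 fun δ hδ => ?_
    choose U e hU hlt he hcont using fun n : ℕ => hw (1 / ((n : ℝ) + 1)) (by positivity)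
    choose q hq hqE using fun n => exists_abs (D.el (a n) - D.el φ)
    have hV : ∀ n, IsOpen (U n ∪ (fun x => |(a n : K → ℝ) x - w x|) ⁻¹' Ioi (δ / 2)) := fun n =>
      isOpen_union_preimage (hU n)
        (((ha n).1.continuousOn.sub (hcont n)).abs) isOpen_Ioi
    have h1 : ∀ n, ∀ᵐ x ∂μ, x ∈ (fun x => |(a n : K → ℝ) x - w x|) ⁻¹' Ioi (δ / 2) →
        1 ≤ (((2 / δ) • q n : D.domain) : Lp ℝ 2 μ) x := fun n => by
      filter_upwards [hwφ, ((hq n).smul (2 / δ) : _ =ᵐ[μ] _),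
        ((D.represents_el (a n)).sub (D.represents_el φ) : _ =ᵐ[μ] _)] with x h1 h2 h3 h4
      rw [h2]
      simp only [Pi.smul_apply, smul_eq_mul]
      rw [h3, Pi.sub_apply, h1]
      simp only [mem_preimage, mem_Ioi] at h4
      rw [div_mul_eq_mul_div, le_div_iff₀ hδ]
      linarith
    choose p hp hpE using fun n => exists_test_union (he n) (h1 n)
    have h2 : Tendsto (fun n => D.energyOne (p n)) atTop (𝓝 0) := by
      have h3 : Tendsto (fun n : ℕ => 2 * (1 / ((n : ℝ) + 1)) +
          2 * ((2 / δ) ^ 2 * D.energyOne (D.el (a n) - D.el φ))) atTop (𝓝 (2 * 0 + 2 * ((2 / δ) ^ 2 * 0))) :=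
        (tendsto_one_div_add_atTop_nhds_zero_nat.const_mul 2).add ((haE.const_mul _).const_mul 2)
      simp only [mul_zero, add_zero] at h3
      refine squeeze_zero (fun n => D.energyOne_nonneg _) (fun n => (hpE n).trans ?_) h3
      rw [energyOne_smul]
      have := hqE n
      have := (hlt n).le
      gcongr
    have h4 := hreg.tendsto_nuB_of_test f hV hp h2
    refine tendsto_of_tendsto_of_tendsto_of_le_of_le tendsto_const_nhds h4 (fun n => zero_le)
      (fun n => measure_mono fun x hx => Or.inr ?_)
    simp only [mem_ofPred_eq, Real.norm_eq_abs] at hx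
    simp only [mem_preimage, mem_Ioi]
    linarith
  obtain ⟨ns, hns, hae⟩ := hmeas.exists_seq_tendsto_ae
  have h1 : Tendsto (fun k => ∫ x, (a (ns k) : K → ℝ) x ∂(hreg.nuB f)) atTop
      (𝓝 (∫ x, w x ∂(hreg.nuB f))) :=
    tendsto_integral_of_dominated_convergence (fun _ => (C : ℝ))
      (fun k => (ha (ns k)).1.aestronglyMeasurable) (integrable_const _)
      (fun k => Eventually.of_forall fun x => hab (ns k) x) hae
  have h2 : Tendsto (fun n => D.gam f f (a n)) atTop (𝓝 (D.gam f f φ)) := by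
    obtain ⟨R, hR⟩ := (D.tendsto_form_self_of_energyOne haE).bddAbove_range
    have e1 := D.tendsto_ef_mul (ψ := φ) (fun n => Eventually.of_forall (hab n)) (R := R)
      (fun n => hR ⟨n, rfl⟩) (D.tendsto_norm_of_energyOne haE) f f
    exact (e1.add e1).sub (D.tendsto_form_of_energyOne haE (D.el (f * f)))
  refine tendsto_nhds_unique h1 ((h2.comp hns.tendsto_atTop).congr fun k => ?_)
  exact (hreg.integral_nuB_core f (ha (ns k))).symm

end EnergyMeasure

end DirichletForm

namespace DirichletForm

/-! ### Strong locality and the derivation property. -/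

section Quartic

variable {K : Type*} [MeasurableSpace K] {μ : Measure K} (D : DirichletForm μ)

/-- The quartic expression whose vanishing expresses the derivation property. -/
def quart (a b c d : D.bdd) : ℝ :=
  D.ef a (b * c * d) + D.ef b (a * c * d) + D.ef c (a * b * d) + D.ef d (a * b * c)
    - D.ef (a * b) (c * d) - D.ef (a * c) (b * d) - D.ef (a * d) (b * c)

lemma quart_swap (a b c d : D.bdd) : D.quart a b c d = D.quart b a c d := by
  unfold quart
  rw [mul_comm b a, D.ef_comm (a * c), D.ef_comm (a * d)]; ring

lemma quart_rotate (a b c d : D.bdd) : D.quart a b c d = D.quart b c d a := by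
  unfold quart
  rw [D.ef_comm (a * b), D.ef_comm (a * c), D.ef_comm (a * d), mul_comm a b, mul_comm a c,
    mul_comm a d, mul_assoc c a d, mul_comm a d, mul_assoc b a d, mul_comm a d, mul_assoc b a c,
    mul_comm a c, ← mul_assoc c d, ← mul_assoc b d, ← mul_assoc b c, D.ef_comm (b * a) (c * d)]
  ring

lemma quart_add (a a' b c d : D.bdd) :
    D.quart (a + a') b c d = D.quart a b c d + D.quart a' b c d := by
  simp only [quart, add_mul, map_add, LinearMap.add_apply]; ring

lemma quart_smul (t : ℝ) (a b c d : D.bdd) : D.quart (t • a) b c d = t * D.quart a b c d := by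
  simp only [quart, smul_mul_assoc, map_smul, LinearMap.smul_apply, smul_eq_mul]; ring

lemma quart_add₂ (a b b' c d : D.bdd) :
    D.quart a (b + b') c d = D.quart a b c d + D.quart a b' c d := by
  rw [quart_swap, quart_add, quart_swap, D.quart_swap b']

lemma quart_smul₂ (t : ℝ) (a b c d : D.bdd) : D.quart a (t • b) c d = t * D.quart a b c d := by
  rw [quart_swap, quart_smul, quart_swap]

lemma quart_add₃ (a b c c' d : D.bdd) :
    D.quart a b (c + c') d = D.quart a b c d + D.quart a b c' d := by
  rw [quart_rotate, quart_add₂, ← D.quart_rotate a b c d, ← D.quart_rotate a b c' d]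

lemma quart_smul₃ (t : ℝ) (a b c d : D.bdd) : D.quart a b (t • c) d = t * D.quart a b c d := by
  rw [quart_rotate, quart_smul₂, ← quart_rotate]

lemma quart_add₄ (a b c d d' : D.bdd) :
    D.quart a b c (d + d') = D.quart a b c d + D.quart a b c d' := by
  rw [quart_rotate, quart_add₃, ← D.quart_rotate a b c d, ← D.quart_rotate a b c d']

lemma quart_smul₄ (t : ℝ) (a b c d : D.bdd) : D.quart a b c (t • d) = t * D.quart a b c d := by
  rw [quart_rotate, quart_smul₃, ← quart_rotate]

/-- Discretely the right-hand side becomes `4 Δu Δ(u³) - 3 (Δ(u²))² = (Δu)⁴`. So `quart` measures a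
quartic variation, which should vanish for a form without jumps or killing. -/
lemma quart_self (u : D.bdd) :
    D.quart u u u u = 4 * D.ef u (u * u * u) - 3 * D.ef (u * u) (u * u) := by
  unfold quart; ring

/-- The defect in the Leibniz rule is exactly `quart`. Because `quart` is symmetric and four-linear,
it suffices to show that it vanishes on the diagonal. -/
lemma gam_mul_left (u v w φ : D.bdd) : D.gam (u * v) w φ
    = D.gam v w (u * φ) + D.gam u w (v * φ) - D.quart u v w φ := by
  unfold gam quart
  have e1 : v * (u * φ) = u * v * φ := by rw [← mul_assoc, mul_comm v u]
  have e2 : u * (v * φ) = u * v * φ := by rw [← mul_assoc]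
  have e3 : w * (u * φ) = u * w * φ := by rw [← mul_assoc, mul_comm w u]
  have e4 : w * (v * φ) = v * w * φ := by rw [← mul_assoc, mul_comm w v]
  rw [e1, e2, e3, e4, D.ef_comm (u * v * φ), D.ef_comm (u * w * φ), D.ef_comm (v * w * φ),
    D.ef_comm (w * φ), D.ef_comm (u * φ) (v * w), D.ef_comm (v * φ) (u * w),
    D.ef_comm (v * w) (u * φ)]
  ring

/-- Only nonnegative multiples are permitted because `P` will include positivity. This is enough: a
polynomial in `t` that vanishes at sufficiently many `t ≥ 0` has zero coefficients. -/
lemma polarize_quart {P : D.bdd → Prop} (hadd : ∀ a b, P a → P b → P (a + b))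
    (hsmul : ∀ (t : ℝ) a, 0 ≤ t → P a → P (t • a)) (hP : ∀ a, P a → D.quart a a a a = 0)
    {a b c d : D.bdd} (ha : P a) (hb : P b) (hc : P c) (hd : P d) : D.quart a b c d = 0 := by
  have s1 : ∀ x y z w, D.quart x y z w = D.quart y x z w := D.quart_swap
  have s2 : ∀ x y z w, D.quart x y z w = D.quart x z y w := fun x y z w => by
    rw [quart_rotate, quart_swap, ← quart_rotate]
  have s3 : ∀ x y z w, D.quart x y z w = D.quart x y w z := fun x y z w => by
    rw [quart_rotate, s2, ← quart_rotate]
  have h1 : ∀ x y, P x → P y → D.quart x x x y = 0 ∧ D.quart x x y y = 0 ∧ D.quart x y y y = 0 := by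
    intro x y hx hy
    have e : ∀ t : ℝ, 0 ≤ t → 4 * t * D.quart x x x y + 6 * t ^ 2 * D.quart x x y y
        + 4 * t ^ 3 * D.quart x y y y = 0 := by
      intro t ht
      have := hP _ (hadd x (t • y) hx (hsmul t y ht hy))
      simp only [quart_add, quart_add₂, quart_add₃, quart_add₄, quart_smul, quart_smul₂,
        quart_smul₃, quart_smul₄, hP x hx, hP y hy] at this
      rw [s1 y x x x, s2 x y x x, s3 x x y x, s1 y x x y, s2 x y x y, s2 y y x x, s1 y x y x,
        s3 x y y x, s2 x y x y, s3 y y y x, s2 y y x y, s1 y x y y] at this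
      linarith [this]
    have e1 := e 1 (by norm_num)
    have e2 := e 2 (by norm_num)
    have e3 := e 3 (by norm_num)
    refine ⟨?_, ?_, ?_⟩ <;> linarith
  have h2 : ∀ x y z, P x → P y → P z → D.quart x x y z = 0 := by
    intro x y z hx hy hz
    have e : ∀ t : ℝ, 0 ≤ t → 3 * t * D.quart x x y z + 3 * t ^ 2 * D.quart x y y z = 0 := by
      intro t ht
      have := (h1 _ z (hadd x (t • y) hx (hsmul t y ht hy)) hz).1
      simp only [quart_add, quart_add₂, quart_add₃, quart_smul, quart_smul₂, quart_smul₃,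
        (h1 x z hx hz).1, (h1 y z hy hz).1] at this
      rw [s1 y x x z, s2 x y x z, s2 y y x z, s1 y x y z] at this
      linarith
    have e1 := e 1 (by norm_num)
    have e2 := e 2 (by norm_num)
    linarith
  have := h2 (a + b) c d (hadd a b ha hb) hc hd
  simp only [quart_add, quart_add₂, h2 a c d ha hc hd, h2 b c d hb hc hd] at this
  rw [s1 b a] at this
  linarith

/-- On `[0, δ]` the square and the cube have Lipschitz constants `2δ` and `3δ²`, so the two terms of
`quart_self` contribute `4 · 3δ²` and `3 · 4δ²`. -/
lemma abs_quart_self_le {u : D.bdd} {δ : ℝ} (hδ : 0 ≤ δ)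
    (h0 : ∀ x, 0 ≤ (u : K → ℝ) x) (h1 : ∀ x, (u : K → ℝ) x ≤ δ) :
    |D.quart u u u u| ≤ 24 * δ ^ 2 * D.ef u u := by
  lift δ to ℝ≥0 using hδ
  have hb : ∀ t, |clamp δ t| ≤ δ := abs_clamp_le δ.2
  have hb2 : ∀ t, |clamp δ t * clamp δ t| ≤ (δ * δ : ℝ≥0) := fun t => by
    rw [abs_mul]; exact mul_le_mul (hb t) (hb t) (abs_nonneg _) δ.2
  have l2 := lipschitzWith_mul_of_bounded (lipschitzWith_clamp δ) (lipschitzWith_clamp δ) hb hb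
  have l3 := lipschitzWith_mul_of_bounded l2 (lipschitzWith_clamp δ) hb2 hb
  have hc : ∀ x, clamp δ ((u : K → ℝ) x) = (u : K → ℝ) x := fun x =>
    clamp_eq_self (by rw [abs_of_nonneg (h0 x)]; exact h1 x)
  have c0 : clamp δ 0 = 0 := clamp_zero δ.2
  have e2 : u * u = D.lcomp l2 (by simp [c0]) u := Subtype.ext (funext fun x => by
    simp [hc])
  have e3 : u * u * u = D.lcomp l3 (by simp [c0]) u := Subtype.ext (funext fun x => by
    simp [hc])
  have b2 := D.ef_lcomp_le l2 (by simp [c0]) u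
  have b3 := D.ef_lcomp_le l3 (by simp [c0]) u
  rw [← e2] at b2
  rw [← e3] at b3
  push_cast at b2 b3
  have hE := D.ef_self_nonneg u
  have b4 : |D.ef u (u * u * u)| ≤ 3 * δ ^ 2 * D.ef u u := by
    refine abs_le_of_sq_le_sq ((D.form_sq_le _ _).trans ?_) (by positivity)
    calc _ ≤ D.ef u u * ((δ * δ * 1 + δ * (δ * 1 + δ * 1)) ^ 2 * D.ef u u) :=
          mul_le_mul_of_nonneg_left b3 hE
      _ = _ := by ring
  rw [quart_self]
  have b5 := abs_le.1 b4
  have b6 := D.ef_self_nonneg (u * u)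
  rw [abs_le]
  constructor <;> nlinarith

end Quartic

section Locality

variable {K : Type*} [TopologicalSpace K] [MeasurableSpace K] {μ : Measure K} {D : DirichletForm μ}

lemma supp_subset {a : D.bdd} {C : Set K} (hC : IsClosed C) (h : ∀ x, x ∉ C → (a : K → ℝ) x = 0)
    [OpensMeasurableSpace K] : D.supp (D.el a) ⊆ C := by
  refine Measure.support_subset_of_isClosed hC ?_
  rw [mem_ae_iff, withDensity_apply _ hC.isOpen_compl.measurableSet]
  refine lintegral_eq_zero_of_ae_eq_zero ?_
  filter_upwards [ae_restrict_of_ae (D.represents_el a), ae_restrict_mem hC.isOpen_compl.measurableSet]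
    with x hx hxC
  rw [hx, h x hxC]; simp

lemma IsStrongLocal.ef_eq_zero (hloc : D.IsStrongLocal) [OpensMeasurableSpace K] [T2Space K]
    {a b : D.bdd} {C C' V : Set K} (hC : IsCompact C) (hC' : IsCompact C')
    (ha : ∀ x, x ∉ C → (a : K → ℝ) x = 0) (hb : ∀ x, x ∉ C' → (b : K → ℝ) x = 0) (hV : IsOpen V)
    (hCV : C ⊆ V) {c : ℝ} (hbV : ∀ x ∈ V, (b : K → ℝ) x = c) : D.ef a b = 0 := by
  have h1 := supp_subset hC.isClosed ha
  have h2 := supp_subset hC'.isClosed hb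
  refine hloc _ _ (hC.of_isClosed_subset Measure.isClosed_support h1)
    (hC'.of_isClosed_subset Measure.isClosed_support h2) ⟨V, hV, h1.trans hCV, c, ?_⟩
  filter_upwards [D.represents_el b] with x hx hxV
  rw [hx, hbV x hxV]

/-- Functions of a core element varying on disjoint ranges of levels have no mutual energy. -/
lemma IsStrongLocal.ef_level_eq_zero (hloc : D.IsStrongLocal) [OpensMeasurableSpace K] [T2Space K]
    {u p q : D.bdd} (hu : D.IsCore u) {α β : ℝ → ℝ} {L : ℝ≥0} (hβ : LipschitzWith L β) {c : ℝ}
    (hc : 0 < c) (hα0 : α 0 = 0) (hαc : ∀ t, c ≤ t → α t = α c) (hβc : ∀ t, t ≤ c → β t = 0)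
    (hp : ∀ x, (p : K → ℝ) x = α ((u : K → ℝ) x)) (hq : ∀ x, (q : K → ℝ) x = β ((u : K → ℝ) x)) :
    D.ef p q = 0 := by
  -- Strong locality needs `p` to be constant on a neighbourhood of the support of the other
  -- function. Shifting the argument of `β` by `1 / (n + 1)` confines that support to `{u ≥ c + 1 /
  -- (n + 1)}`, inside the open set `{u > c}`; the shift is removed by a weak limit.
  have lg : ∀ n : ℕ, LipschitzWith L (fun t => β (max (t - 1 / ((n : ℝ) + 1)) c)) := fun n => by
    have h1 : LipschitzWith 1 (fun t : ℝ => max (t - 1 / ((n : ℝ) + 1)) c) :=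
      ((LipschitzWith.id.sub (LipschitzWith.const (1 / ((n : ℝ) + 1)))).weaken (by simp)).max_const c
    have := hβ.comp h1
    rwa [mul_one] at this
  have hpos : ∀ n : ℕ, (0 : ℝ) < 1 / ((n : ℝ) + 1) := fun n => by positivity
  have g0 : ∀ n : ℕ, β (max ((0 : ℝ) - 1 / ((n : ℝ) + 1)) c) = 0 := fun n => by
    rw [max_eq_right (by linarith [hpos n])]; exact hβc c le_rfl
  let w : ℕ → D.bdd := fun n => D.lcomp (lg n) (g0 n) u
  have hw0 : ∀ n, D.ef (w n) p = 0 := by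
    intro n
    have hC : IsCompact {x | c + 1 / ((n : ℝ) + 1) ≤ (u : K → ℝ) x} := by
      refine hu.2.isCompact.of_isClosed_subset (isClosed_le continuous_const hu.1) fun x hx => ?_
      refine subset_tsupport _ ?_
      have : 0 < (u : K → ℝ) x := lt_of_lt_of_le (by linarith [hpos n]) hx
      exact this.ne'
    refine hloc.ef_eq_zero hC hu.2.isCompact (V := {x | c < (u : K → ℝ) x}) (c := α c) ?_ ?_
      (isOpen_lt continuous_const hu.1) ?_ ?_
    · intro x hx
      simp only [mem_ofPred_eq, not_le] at hx
      simp only [w, lcomp_apply]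
      rw [max_eq_right (by linarith)]
      exact hβc c le_rfl
    · intro x hx
      rw [hp, image_eq_zero_of_notMem_tsupport hx, hα0]
    · intro x hx
      simp only [mem_ofPred_eq] at hx ⊢
      linarith [hpos n]
    · intro x hx
      rw [hp, hαc _ (le_of_lt hx)]
  have hb0 : β 0 = 0 := hβc 0 hc.le
  have hlim : Tendsto (fun n => ‖(D.el (w n) : Lp ℝ 2 μ) - D.el q‖) atTop (𝓝 0) := by
    refine D.tendsto_norm_of_dominated (fun n => D.represents_el (w n)) (D.represents_el q)
      (g := fun x => 2 * (L * |(u : K → ℝ) x|))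
      (((D.represents_el u).memLp.abs.const_mul (L : ℝ)).const_mul 2)
      (fun n => Eventually.of_forall fun x => ?_) (Eventually.of_forall fun x => ?_)
    · have h1 := (lg n).dist_le_mul ((u : K → ℝ) x) 0
      have h2 := hβ.dist_le_mul ((u : K → ℝ) x) 0
      simp only [g0, hb0, Real.dist_eq, sub_zero] at h1 h2
      rw [hq]
      exact (abs_sub _ _).trans (by simp only [w, lcomp_apply]; linarith)
    · rw [hq]
      simp only [w, lcomp_apply]
      have h1 : Tendsto (fun n : ℕ => max ((u : K → ℝ) x - 1 / ((n : ℝ) + 1)) c) atTop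
          (𝓝 (max ((u : K → ℝ) x - 0) c)) :=
        (tendsto_const_nhds.sub tendsto_one_div_add_atTop_nhds_zero_nat).max tendsto_const_nhds
      have h2 : β (max ((u : K → ℝ) x - 0) c) = β ((u : K → ℝ) x) := by
        rw [sub_zero]
        rcases le_total ((u : K → ℝ) x) c with h | h
        · rw [max_eq_right h, hβc c le_rfl, hβc _ h]
        · rw [max_eq_left h]
      rw [← h2]
      exact (hβ.continuous.tendsto _).comp h1
  have := D.tendsto_form_of_bounded' (w := fun n => D.el (w n)) (u := D.el q)
    (fun n => D.ef_lcomp_le (lg n) (g0 n) u) hlim (D.el p)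
  rw [ef_comm]
  refine tendsto_nhds_unique this (tendsto_const_nhds.congr fun n => (hw0 n).symm)

/-- Cut `u` into layers of height `δ`. Distinct layers have no mutual energy, so both `quart` and
the energy add up over the layers, and the one-layer bound sums with a constant independent of `N`.
-/
lemma IsStrongLocal.abs_quart_self_le (hloc : D.IsStrongLocal) [OpensMeasurableSpace K] [T2Space K]
    {δ : ℝ} (hδ : 0 < δ) (N : ℕ) : ∀ u : D.bdd, D.IsCore u → (∀ x, 0 ≤ (u : K → ℝ) x) →
      (∀ x, (u : K → ℝ) x ≤ N * δ) → |D.quart u u u u| ≤ 24 * δ ^ 2 * D.ef u u := by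
  induction N with
  | zero =>
    intro u _ h0 h1
    refine D.abs_quart_self_le hδ.le h0 fun x => ?_
    have := h1 x
    simp only [Nat.cast_zero, zero_mul] at this
    linarith
  | succ N ih =>
    intro u hu h0 h1
    obtain ⟨M, hM⟩ : ∃ M : ℝ≥0, (M : ℝ) = (N + 1) * δ :=
      ⟨⟨(N + 1) * δ, by positivity⟩, rfl⟩
    obtain ⟨d, hd⟩ : ∃ d : ℝ≥0, (d : ℝ) = δ := ⟨⟨δ, hδ.le⟩, rfl⟩
    have hMδ : δ ≤ M := by
      rw [hM]; nlinarith [mul_nonneg (Nat.cast_nonneg (α := ℝ) N) hδ.le]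
    let A : ℝ → ℝ := fun t => max (min t δ) 0
    let B : ℝ → ℝ := fun t => min (max (t - δ) 0) M
    have lA : LipschitzWith 1 A := (LipschitzWith.id.min_const δ).max_const 0
    have lB : LipschitzWith 1 B := 
      (((LipschitzWith.id.sub (LipschitzWith.const δ)).weaken (by simp)).max_const 0).min_const M
    have A0 : A 0 = 0 := by simp only [A]; rw [min_eq_left hδ.le, max_self]
    have B0 : B 0 = 0 := by
      simp only [B]; rw [max_eq_right (by linarith), min_eq_left (NNReal.coe_nonneg M)]
    have Ac : ∀ t, δ ≤ t → A t = δ := fun t ht => by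
      simp only [A]; rw [min_eq_right ht, max_eq_left hδ.le]
    have Bc : ∀ t, t ≤ δ → B t = 0 := fun t ht => by
      simp only [B]; rw [max_eq_right (by linarith), min_eq_left (NNReal.coe_nonneg M)]
    have bB : ∀ t, |B t| ≤ M := fun t => by
      change |min (max (t - δ) 0) (M : ℝ)| ≤ M
      rw [abs_of_nonneg (le_min (le_max_right _ _) (NNReal.coe_nonneg M))]; exact min_le_right _ _
    let a := D.lcomp lA A0 u
    let b := D.lcomp lB B0 u
    have lB2 := lipschitzWith_mul_of_bounded lB lB bB bB
    have bB2 : ∀ t, |B t * B t| ≤ (M * M : ℝ≥0) := fun t => by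
      rw [abs_mul]; exact mul_le_mul (bB t) (bB t) (abs_nonneg _) (NNReal.coe_nonneg M)
    have lB3 := lipschitzWith_mul_of_bounded lB2 lB bB2 bB
    have hab : ∀ x, (u : K → ℝ) x = A ((u : K → ℝ) x) + B ((u : K → ℝ) x) := by
      intro x
      have h3 := h0 x
      have h4 : (u : K → ℝ) x ≤ M := by rw [hM]; exact_mod_cast h1 x
      simp only [A, B]
      rcases le_total ((u : K → ℝ) x) δ with h | h
      · rw [min_eq_left h, max_eq_left h3, max_eq_right (by linarith), min_eq_left (NNReal.coe_nonneg M), add_zero]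
      · rw [min_eq_right h, max_eq_left hδ.le, max_eq_left (by linarith), min_eq_left (by linarith)]
        ring
    have eu : u = a + b := Subtype.ext (funext hab)
    -- The lower layer is full, that is `a = δ`, wherever the upper layer `b` is nonzero.
    have eab : a * b = δ • b := Subtype.ext (funext fun x => by
      change A ((u : K → ℝ) x) * B ((u : K → ℝ) x) = δ * B ((u : K → ℝ) x)
      rcases le_total ((u : K → ℝ) x) δ with h | h
      · rw [Bc _ h]; ring
      · rw [Ac _ h])
    have hA2 : ∀ t, δ ≤ t → A t * A t = A δ * A δ := fun t ht => by rw [Ac t ht, Ac δ le_rfl]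
    have hA3 : ∀ t, δ ≤ t → A t * A t * A t = A δ * A δ * A δ := fun t ht => by
      rw [Ac t ht, Ac δ le_rfl]
    have hA1 : ∀ t, δ ≤ t → A t = A δ := fun t ht => by rw [Ac t ht, Ac δ le_rfl]
    have hB2 : ∀ t, t ≤ δ → B t * B t = 0 := fun t ht => by rw [Bc t ht, zero_mul]
    have hB3 : ∀ t, t ≤ δ → B t * B t * B t = 0 := fun t ht => by rw [Bc t ht, mul_zero]
    have z11 : D.ef a b = 0 := hloc.ef_level_eq_zero hu (α := A) lB hδ A0 hA1 Bc
      (fun _ => rfl) (fun _ => rfl)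
    have z12 : D.ef a (b * b) = 0 := hloc.ef_level_eq_zero hu (α := A) lB2 hδ A0 hA1 hB2
      (fun _ => rfl) (fun _ => rfl)
    have z13 : D.ef a (b * b * b) = 0 := hloc.ef_level_eq_zero hu (α := A) lB3 hδ A0 hA1 hB3
      (fun _ => rfl) (fun _ => rfl)
    have z21 : D.ef (a * a) b = 0 := hloc.ef_level_eq_zero hu (α := fun t => A t * A t) lB hδ
      (by simp [A0]) hA2 Bc (fun _ => rfl) (fun _ => rfl)
    have z22 : D.ef (a * a) (b * b) = 0 := hloc.ef_level_eq_zero hu (α := fun t => A t * A t) lB2 hδ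
      (by simp [A0]) hA2 hB2 (fun _ => rfl) (fun _ => rfl)
    have z31 : D.ef (a * a * a) b = 0 := hloc.ef_level_eq_zero hu (α := fun t => A t * A t * A t)
      lB hδ (by simp [A0]) hA3 Bc (fun _ => rfl) (fun _ => rfl)
    have eba : b * a = δ • b := by rw [mul_comm, eab]
    have e2 : u * u = a * a + (2 * δ) • b + b * b := by
      rw [eu, add_mul, mul_add, mul_add, eab, eba, two_mul, add_smul]; abel
    have e3 : u * u * u = a * a * a + (3 * δ ^ 2) • b + (3 * δ) • (b * b) + b * b * b := by
      rw [e2, eu]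
      simp only [add_mul, mul_add, smul_mul_assoc, eba, mul_assoc, eab, mul_smul_comm, smul_smul]
      have : (3 * δ ^ 2) = δ * δ + 2 * (δ * δ) := by ring
      rw [this]
      have : (3 * δ) = δ + 2 * δ := by ring
      rw [this]
      simp only [add_smul]
      abel
    have hE : D.ef u u = D.ef a a + D.ef b b := by
      rw [eu]
      simp only [map_add, LinearMap.add_apply, D.ef_comm b a, z11]; ring
    -- The extra terms `12 δ² E(b, b) + 12 δ E(b, b²)` arise from `4 E(u, u³)` and from `3 E(u²,
    -- u²)` alike, and cancel.
    have hQ : D.quart u u u u = D.quart a a a a + D.quart b b b b := by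
      rw [quart_self, quart_self, quart_self, e3, e2]
      conv_lhs => rw [eu]
      simp only [map_add, map_smul, LinearMap.add_apply, LinearMap.smul_apply, smul_eq_mul,
        D.ef_comm b (a * a), D.ef_comm b (a * a * a),
        D.ef_comm (b * b) (a * a), D.ef_comm (b * b) b, z11, z12, z13, z21, z22, z31]
      ring
    have ia : |D.quart a a a a| ≤ 24 * δ ^ 2 * D.ef a a :=
      D.abs_quart_self_le hδ.le (fun x => le_max_right _ _)
        (fun x => max_le (min_le_right _ _) hδ.le)
    have ib : |D.quart b b b b| ≤ 24 * δ ^ 2 * D.ef b b := by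
      refine ih b (hu.lcomp lB B0) (fun x => le_min (le_max_right _ _) (NNReal.coe_nonneg M)) fun x => ?_
      refine (min_le_left _ _).trans (max_le ?_ (by positivity))
      have := h1 x
      push_cast at this
      linarith
    rw [hQ, hE, mul_add]
    exact (abs_add_le _ _).trans (add_le_add ia ib)

/-- The layer height is free, and a bound of order `δ²` for every `δ > 0` forces the value `0`. -/
lemma IsStrongLocal.quart_self_eq_zero (hloc : D.IsStrongLocal) [OpensMeasurableSpace K]
    [T2Space K] {u : D.bdd} (hu : D.IsCore u) (h0 : ∀ x, 0 ≤ (u : K → ℝ) x) :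
    D.quart u u u u = 0 := by
  obtain ⟨M, hM⟩ := hu.1.bounded_above_of_compact_support hu.2
  have h1 : ∀ n : ℕ, |D.quart u u u u| ≤ 24 * (1 / ((n : ℝ) + 1)) ^ 2 * D.ef u u := by
    intro n
    have hδ : (0 : ℝ) < 1 / ((n : ℝ) + 1) := by positivity
    obtain ⟨N, hN⟩ := exists_nat_ge (M / (1 / ((n : ℝ) + 1)))
    refine hloc.abs_quart_self_le hδ N u hu h0 fun x => ?_
    rw [div_le_iff₀ hδ] at hN
    exact ((le_abs_self _).trans (hM x)).trans hN
  have h2 : Tendsto (fun n : ℕ => 24 * (1 / ((n : ℝ) + 1)) ^ 2 * D.ef u u) atTop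
      (𝓝 (24 * 0 ^ 2 * D.ef u u)) :=
    ((tendsto_one_div_add_atTop_nhds_zero_nat.pow 2).const_mul 24).mul_const _
  have h3 := ge_of_tendsto h2 (Eventually.of_forall h1)
  norm_num at h3
  exact h3

lemma IsStrongLocal.quart_core_eq_zero (hloc : D.IsStrongLocal) [OpensMeasurableSpace K]
    [T2Space K] {a b c d : D.bdd} (ha : D.IsCore a) (hb : D.IsCore b) (hc : D.IsCore c)
    (hd : D.IsCore d) : D.quart a b c d = 0 := by
  have hP : ∀ a b c d : D.bdd, (D.IsCore a ∧ ∀ x, 0 ≤ (a : K → ℝ) x) →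
      (D.IsCore b ∧ ∀ x, 0 ≤ (b : K → ℝ) x) → (D.IsCore c ∧ ∀ x, 0 ≤ (c : K → ℝ) x) →
      (D.IsCore d ∧ ∀ x, 0 ≤ (d : K → ℝ) x) → D.quart a b c d = 0 := by
    intro a b c d ha hb hc hd
    exact D.polarize_quart (P := fun a => D.IsCore a ∧ ∀ x, 0 ≤ (a : K → ℝ) x)
      (fun a b ha hb => ⟨ha.1.add hb.1, fun x => add_nonneg (ha.2 x) (hb.2 x)⟩)
      (fun t a ht ha => ⟨ha.1.smul t, fun x => mul_nonneg ht (ha.2 x)⟩)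
      (fun a ha => hloc.quart_self_eq_zero ha.1 ha.2) ha hb hc hd
  have l : LipschitzWith 1 (fun t : ℝ => max t 0) := LipschitzWith.id.max_const 0
  have l' : LipschitzWith 1 (fun t : ℝ => max (-t) 0) := LipschitzWith.id.neg.max_const 0
  have ext : ∀ b c d : D.bdd, (∀ a : D.bdd, (D.IsCore a ∧ ∀ x, 0 ≤ (a : K → ℝ) x) →
      D.quart a b c d = 0) → ∀ a : D.bdd, D.IsCore a → D.quart a b c d = 0 := by
    intro b c d h a ha
    have e : a = D.lcomp l (max_self 0) a + (-1 : ℝ) • D.lcomp l' (by simp) a :=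
      Subtype.ext (funext fun x => by
        change (a : K → ℝ) x = max ((a : K → ℝ) x) 0 + (-1) * max (-(a : K → ℝ) x) 0
        rcases le_total 0 ((a : K → ℝ) x) with h | h
        · rw [max_eq_left h, max_eq_right (by linarith)]; ring
        · rw [max_eq_right h, max_eq_left (by linarith)]; ring)
    rw [e, quart_add, quart_smul, h _ ⟨ha.lcomp l _, fun x => le_max_right _ _⟩,
      h _ ⟨ha.lcomp l' _, fun x => le_max_right _ _⟩]
    ring
  refine ext b c d (fun a' ha' => ?_) a ha
  rw [quart_rotate]
  refine ext c d a' (fun b' hb' => ?_) b hb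
  rw [quart_rotate]
  refine ext d a' b' (fun c' hc' => ?_) c hc
  rw [quart_rotate]
  refine ext a' b' c' (fun d' hd' => ?_) d hd
  exact hP _ _ _ _ hd' ha' hb' hc'

/-- The derivation property, in its quartic form. -/
theorem IsStrongLocal.quart_eq_zero (hloc : D.IsStrongLocal) (hreg : D.IsRegular)
    [OpensMeasurableSpace K] [T2Space K] (a b c d : D.bdd) : D.quart a b c d = 0 := by
  have ext : ∀ b c d : D.bdd, (∀ a : D.bdd, D.IsCore a → D.quart a b c d = 0) →
      ∀ a : D.bdd, D.quart a b c d = 0 := by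
    intro b c d h a
    obtain ⟨C, hC⟩ := D.exists_nnreal_bound a
    obtain ⟨s, hs, hsb, hsE⟩ := hreg.exists_core_seq_bounded (D.represents_el a) hC
    obtain ⟨R, hR⟩ := (D.tendsto_form_self_of_energyOne hsE).bddAbove_range
    have e1 := fun x y => D.tendsto_ef_mul (ψ := a) (fun n => Eventually.of_forall (hsb n)) (R := R)
      (fun n => hR ⟨n, rfl⟩) (D.tendsto_norm_of_energyOne hsE) x y
    have e2 := fun y : D.bdd => D.tendsto_form_of_energyOne hsE (D.el y)
    -- Each term is rewritten so that `z` occurs only in the first argument, possibly times a fixed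
    -- element: the shape in which weak continuity applies.
    have q : ∀ z : D.bdd, D.quart z b c d = D.form (D.el z) (D.el (b * c * d)) + D.ef (c * d * z) b
        + D.ef (b * d * z) c + D.ef (b * c * z) d - D.ef (b * z) (c * d) - D.ef (c * z) (b * d)
        - D.ef (d * z) (b * c) := by
      intro z
      unfold quart
      rw [D.ef_comm b, D.ef_comm c, D.ef_comm d, mul_assoc z c d, mul_comm z (c * d),
        mul_assoc z b d, mul_comm z (b * d), mul_assoc z b c, mul_comm z (b * c), mul_comm z b,
        mul_comm z c, mul_comm z d, ef_apply]
    have h1 : Tendsto (fun n => D.quart (s n) b c d) atTop (𝓝 (D.quart a b c d)) := by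
      simp only [q]
      exact ((((((e2 _).add (e1 _ _)).add (e1 _ _)).add (e1 _ _)).sub (e1 _ _)).sub
        (e1 _ _)).sub (e1 _ _)
    exact tendsto_nhds_unique h1 (tendsto_const_nhds.congr fun n => (h _ (hs n)).symm)
  refine ext b c d (fun a' ha' => ?_) a
  rw [quart_rotate]
  refine ext c d a' (fun b' hb' => ?_) b
  rw [quart_rotate]
  refine ext d a' b' (fun c' hc' => ?_) c
  rw [quart_rotate]
  refine ext a' b' c' (fun d' hd' => ?_) d
  exact hloc.quart_core_eq_zero hd' ha' hb' hc'

lemma IsStrongLocal.gam_mul_left (hloc : D.IsStrongLocal) (hreg : D.IsRegular)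
    [OpensMeasurableSpace K] [T2Space K] (u v w φ : D.bdd) :
    D.gam (u * v) w φ = D.gam v w (u * φ) + D.gam u w (v * φ) := by
  rw [D.gam_mul_left, hloc.quart_eq_zero hreg, sub_zero]

end Locality

/-! ### Total mass of energy measures. -/

section Mass

variable {K : Type*} [TopologicalSpace K] [MeasurableSpace K] {μ : Measure K} {D : DirichletForm μ}
  [LocallyCompactSpace K] [TopologicalSpace.MetrizableSpace K] [BorelSpace K]
  [SecondCountableTopology K]

/-- Test with a cutoff `χ` equal to `1` near the support of `a`: then `a χ = a`, and strong locality
removes `E(χ, a²)`. The reverse inequality is the general mass bound. -/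
lemma IsStrongLocal.nuB_core_univ (hloc : D.IsStrongLocal) (hreg : D.IsRegular) {a : D.bdd}
    (ha : D.IsCore a) : (hreg.nuB a).real univ = 2 * D.ef a a := by
  obtain ⟨χ, hχ, h01, V, hV, hkV, hχV⟩ := hreg.exists_cutoff ha.2.isCompact
  have h1 := hreg.integral_nuB_core a hχ
  have e1 : a * χ = a := Subtype.ext (funext fun x => by
    change (a : K → ℝ) x * (χ : K → ℝ) x = (a : K → ℝ) x
    by_cases hx : x ∈ tsupport (a : K → ℝ)
    · rw [hχV x (hkV hx), mul_one]
    · rw [image_eq_zero_of_notMem_tsupport hx, zero_mul])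
  have e2 : D.ef (a * a) χ = 0 := hloc.ef_eq_zero ha.2.isCompact hχ.2.isCompact
    (fun x hx => by
      change (a : K → ℝ) x * (a : K → ℝ) x = 0
      rw [image_eq_zero_of_notMem_tsupport hx, zero_mul])
    (fun x hx => image_eq_zero_of_notMem_tsupport hx) hV hkV (c := 1) hχV
  rw [gam, e1, D.ef_comm χ, e2] at h1
  refine le_antisymm ?_ ?_
  · refine ENNReal.toReal_le_of_le_ofReal ?_ (hreg.nuB_univ_le a)
    exact mul_nonneg zero_le_two (D.ef_self_nonneg a)
  · have h2 : ∫ x, (χ : K → ℝ) x ∂(hreg.nuB a) ≤ ∫ _, (1 : ℝ) ∂(hreg.nuB a) :=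
      integral_mono (hχ.1.integrable_of_hasCompactSupport hχ.2) (integrable_const _)
        fun x => (h01 x).2
    rw [h1, integral_const, smul_eq_mul, mul_one] at h2
    linarith

end Mass

end DirichletForm

/-! ### Quadratic forms and linear relations between measures. -/

/-- A real-valued quadratic form on a real vector space. -/
structure IsQuad {V : Type*} [AddCommGroup V] [Module ℝ V] (q : V → ℝ) : Prop where
  add : ∀ u v w, q (u + v + w) + q u + q v + q w = q (u + v) + q (u + w) + q (v + w)
  smul : ∀ (t : ℝ) u v, q (t • u + v) = t ^ 2 * q u + q v + t * (q (u + v) - q u - q v)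

/-- The bilinear form associated with a quadratic form. -/
def polarForm {V : Type*} [AddCommGroup V] (q : V → ℝ) (u v : V) : ℝ := (q (u + v) - q u - q v) / 2

lemma polarForm_comm {V : Type*} [AddCommGroup V] (q : V → ℝ) (u v : V) :
    polarForm q u v = polarForm q v u := by
  unfold polarForm; rw [add_comm u v]; ring

lemma map_add_eq_polarForm {V : Type*} [AddCommGroup V] (q : V → ℝ) (u v : V) :
    q (u + v) = q u + 2 * polarForm q u v + q v := by
  unfold polarForm; ring

namespace IsQuad

variable {V : Type*} [AddCommGroup V] [Module ℝ V] {q : V → ℝ}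

lemma polar_add_left (hq : IsQuad q) (u v w : V) :
    polarForm q (u + v) w = polarForm q u w + polarForm q v w := by
  unfold polarForm; linarith [hq.add u v w]

lemma map_zero (hq : IsQuad q) : q 0 = 0 := by
  have := hq.add 0 0 0
  simp only [add_zero] at this
  linarith

lemma map_smul (hq : IsQuad q) (t : ℝ) (u : V) : q (t • u) = t ^ 2 * q u := by
  have := hq.smul t u 0
  simp only [add_zero, hq.map_zero] at this
  linarith

lemma polar_smul_left (hq : IsQuad q) (t : ℝ) (u v : V) :
    polarForm q (t • u) v = t * polarForm q u v := by
  unfold polarForm; rw [hq.smul, hq.map_smul]; ring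

lemma polar_self (hq : IsQuad q) (u : V) : polarForm q u u = q u := by
  unfold polarForm; rw [← two_smul ℝ u, hq.map_smul]; ring

lemma polar_sub_left (hq : IsQuad q) (u v w : V) :
    polarForm q (u - v) w = polarForm q u w - polarForm q v w := by
  rw [sub_eq_add_neg, hq.polar_add_left, ← neg_one_smul ℝ v, hq.polar_smul_left]; ring

lemma polar_sq_le (hq : IsQuad q) (h0 : ∀ u, 0 ≤ q u) (u v : V) :
    polarForm q u v ^ 2 ≤ q u * q v := by
  have h : ∀ t : ℝ, 0 ≤ q u * (t * t) + 2 * polarForm q u v * t + q v := fun t => by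
    have := h0 (t • u + v)
    rw [hq.smul] at this
    unfold polarForm
    linarith
  have := discrim_le_zero h
  unfold discrim at this
  linarith

lemma abs_polar_le (hq : IsQuad q) (h0 : ∀ u, 0 ≤ q u) (u v : V) :
    |polarForm q u v| ≤ √(q u) * √(q v) := by
  rw [← Real.sqrt_mul (h0 u)]
  exact Real.abs_le_sqrt (hq.polar_sq_le h0 u v)

lemma sqrt_add_le (hq : IsQuad q) (h0 : ∀ u, 0 ≤ q u) (u v : V) : √(q (u + v)) ≤ √(q u) + √(q v) := by
  rw [Real.sqrt_le_left (by positivity), map_add_eq_polarForm q, add_sq, Real.sq_sqrt (h0 u), Real.sq_sqrt (h0 v)]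
  linarith [le_abs_self (polarForm q u v), hq.abs_polar_le h0 u v]

lemma map_neg (hq : IsQuad q) (u : V) : q (-u) = q u := by
  rw [← neg_one_smul ℝ u, hq.map_smul]; ring

/-- `√q` is a seminorm. Applied to `q(a) = ν_a(B)`, this makes `√(ν_a(B))` depend on `a` in a
Lipschitz way, uniformly in `B`. -/
lemma abs_sqrt_sub_le (hq : IsQuad q) (h0 : ∀ u, 0 ≤ q u) (u v : V) :
    |√(q u) - √(q v)| ≤ √(q (u - v)) := by
  rw [abs_sub_le_iff]
  have h1 := hq.sqrt_add_le h0 (u - v) v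
  have h2 := hq.sqrt_add_le h0 (v - u) u
  rw [sub_add_cancel] at h1 h2
  rw [← neg_sub u v, hq.map_neg] at h2
  exact ⟨by linarith, by linarith⟩

end IsQuad

/-- A linear relation between finite measures extends to integrals of bounded functions. -/
lemma sum_integral_eq_zero_of_sets {X ι : Type*} [MeasurableSpace X] [Fintype ι]
    (m : ι → Measure X) [∀ i, IsFiniteMeasure (m i)] (c : ι → ℝ)
    (h : ∀ B, MeasurableSet B → ∑ i, c i * (m i).real B = 0)
    {ψ : X → ℝ} (hψ : Measurable ψ) {M : ℝ} (hM : ∀ x, |ψ x| ≤ M) :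
    ∑ i, c i * ∫ x, ψ x ∂(m i) = 0 := by
  have e : ∑ i, (c i).toNNReal • m i = ∑ i, (-c i).toNNReal • m i := by
    ext B hB
    rw [← ENNReal.toReal_eq_toReal_iff' (measure_ne_top _ _) (measure_ne_top _ _)]
    change Measure.real _ B = Measure.real _ B
    simp only [measureReal_def, Measure.coe_finsetSum, Finset.sum_apply, Measure.smul_apply]
    rw [ENNReal.toReal_sum (fun i _ => by simp [ENNReal.smul_def, ENNReal.mul_eq_top]),
      ENNReal.toReal_sum (fun i _ => by simp [ENNReal.smul_def, ENNReal.mul_eq_top]),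
      ← sub_eq_zero, ← Finset.sum_sub_distrib, ← h B hB]
    refine Finset.sum_congr rfl fun i _ => ?_
    simp only [ENNReal.smul_def, smul_eq_mul, ENNReal.toReal_mul, ENNReal.coe_toReal,
      Real.coe_toNNReal', measureReal_def]
    rw [← sub_mul, max_zero_sub_max_neg_zero_eq_self]
  have hi : ∀ i, Integrable ψ (m i) := fun i =>
    Integrable.of_bound hψ.aestronglyMeasurable M (Eventually.of_forall hM)
  have h2 : ∫ x, ψ x ∂(∑ i, (c i).toNNReal • m i) = ∫ x, ψ x ∂(∑ i, (-c i).toNNReal • m i) := by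
    rw [e]
  rw [integral_finsetSum_measure (fun i _ => (hi i).smul_measure_nnreal),
    integral_finsetSum_measure (fun i _ => (hi i).smul_measure_nnreal), ← sub_eq_zero,
    ← Finset.sum_sub_distrib] at h2
  rw [← h2]
  refine Finset.sum_congr rfl fun i _ => ?_
  rw [integral_smul_nnreal_measure, integral_smul_nnreal_measure, NNReal.smul_def, NNReal.smul_def,
    smul_eq_mul, smul_eq_mul, ← sub_mul, Real.coe_toNNReal', Real.coe_toNNReal',
    max_zero_sub_max_neg_zero_eq_self]

namespace DirichletForm

section EnergyMeasure

variable {K : Type*} [TopologicalSpace K] [MeasurableSpace K] {μ : Measure K} {D : DirichletForm μ}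
  [LocallyCompactSpace K] [TopologicalSpace.MetrizableSpace K] [BorelSpace K]
  [SecondCountableTopology K]

lemma IsRegular.isQuad_nuB (hreg : D.IsRegular) {B : Set K} (hB : MeasurableSet B) :
    IsQuad (fun a : D.bdd => (hreg.nuB a).real B) := by
  -- A linear relation between the functionals `gam (a i) (a i)` is a relation between measures on
  -- the core, hence on every Borel set; the quadratic identities for `ν` thus follow from the
  -- bilinearity of `gam`.
  have key : ∀ (k : ℕ) (a : Fin k → D.bdd) (c : Fin k → ℝ)
      (_ : ∀ φ : D.bdd, ∑ i, c i * D.gam (a i) (a i) φ = 0),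
      ∑ i, c i * (hreg.nuB (a i)).real B = 0 := by
    intro k a c h
    have hC : ∀ i (_ : K), |c i| ≤ ∑ j, |c j| := fun i _ =>
      Finset.single_le_sum (f := fun j => |c j|) (fun j _ => abs_nonneg _) (Finset.mem_univ i)
    have := hreg.sum_integral_eq_zero (fun i => hreg.nuB (a i)) (c := fun i _ => c i)
      (fun i => measurable_const) hC (fun φ hφ => by
        rw [← h φ]
        refine Finset.sum_congr rfl fun i _ => ?_
        rw [integral_mul_const, hreg.integral_nuB_core _ hφ, mul_comm])
      (measurable_const.indicator hB : Measurable (B.indicator fun _ => (1 : ℝ))) (M := 1)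
      (fun x => by by_cases hx : x ∈ B <;> simp [hx])
    rw [← this]
    refine Finset.sum_congr rfl fun i _ => ?_
    rw [integral_mul_const, integral_indicator_const _ hB, smul_eq_mul, mul_one, mul_comm]
  constructor
  · intro u v w
    have := key 7 ![u + v + w, u, v, w, u + v, u + w, v + w] ![1, 1, 1, 1, -1, -1, -1] (fun φ => by
      simp only [Fin.sum_univ_succ, Matrix.cons_val_zero, Matrix.cons_val_succ, Fin.sum_univ_zero,
        gam_add_left, gam_add_right]
      ring)
    simp only [Fin.sum_univ_succ, Matrix.cons_val_zero, Matrix.cons_val_succ, Fin.sum_univ_zero]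
      at this
    linarith
  · intro t u v
    have := key 4 ![t • u + v, u, v, u + v] ![1, -t ^ 2 + t, -1 + t, -t] (fun φ => by
      simp only [Fin.sum_univ_succ, Matrix.cons_val_zero, Matrix.cons_val_succ, Fin.sum_univ_zero,
        gam_add_left, gam_add_right, gam_smul_left, gam_smul_right]
      ring)
    simp only [Fin.sum_univ_succ, Matrix.cons_val_zero, Matrix.cons_val_succ, Fin.sum_univ_zero]
      at this
    linarith

lemma IsRegular.nuB_real_le (hreg : D.IsRegular) (a : D.bdd) (B : Set K) :
    (hreg.nuB a).real B ≤ 2 * D.ef a a :=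
  ENNReal.toReal_le_of_le_ofReal (mul_nonneg zero_le_two (D.ef_self_nonneg a))
    ((measure_mono (subset_univ B)).trans (hreg.nuB_univ_le a))

lemma IsRegular.abs_sqrt_nuB_sub_le (hreg : D.IsRegular) {B : Set K} (hB : MeasurableSet B)
    (a b : D.bdd) : |√((hreg.nuB a).real B) - √((hreg.nuB b).real B)|
      ≤ √(2 * D.form (D.el a - D.el b) (D.el a - D.el b)) := by
  refine ((hreg.isQuad_nuB hB).abs_sqrt_sub_le (fun _ => measureReal_nonneg) a b).trans
    (Real.sqrt_le_sqrt ?_)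
  rw [← map_sub]
  exact hreg.nuB_real_le _ _

end EnergyMeasure

end DirichletForm

/-! ### Energy measures of general elements as limits. -/

/-- A finite set function that is finitely additive and continuous at the empty set, as
a measure. -/
lemma exists_measure_of_additive {X : Type*} [MeasurableSpace X] (r : Set X → ℝ)
    (h0 : ∀ B, MeasurableSet B → 0 ≤ r B)
    (hadd : ∀ B C, MeasurableSet B → MeasurableSet C → Disjoint B C → r (B ∪ C) = r B + r C)
    (hlim : ∀ B : ℕ → Set X, (∀ n, MeasurableSet (B n)) → Antitone B → ⋂ n, B n = ∅ →
      Tendsto (fun n => r (B n)) atTop (𝓝 0)) :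
    ∃ m : Measure X, IsFiniteMeasure m ∧ ∀ B, MeasurableSet B → m.real B = r B := by
  have he : r ∅ = 0 := by
    have := hadd ∅ ∅ MeasurableSet.empty MeasurableSet.empty (disjoint_empty _)
    rw [union_empty] at this
    linarith
  let m : Measure X := Measure.ofMeasurable (fun B _ => ENNReal.ofReal (r B)) (by simp [he]) (by
    intro f hf hd
    have hpart : ∀ n, r (⋃ i, ⋃ (_ : i < n), f i) = ∑ i ∈ Finset.range n, r (f i) := by
      intro n
      induction n with
      | zero => simp [he]
      | succ n ih =>
        have : (⋃ i, ⋃ (_ : i < n + 1), f i) = (⋃ i, ⋃ (_ : i < n), f i) ∪ f n :=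
          biUnion_lt_succ f n
        rw [this, hadd _ _ (MeasurableSet.iUnion fun i => MeasurableSet.iUnion fun _ => hf i)
          (hf n), ih, Finset.sum_range_succ]
        simp only [disjoint_iUnion_left]
        exact fun i hi => hd hi.ne
    have htail : ∀ n, r (⋃ i, f i) = ∑ i ∈ Finset.range n, r (f i)
        + r (⋃ i, ⋃ (_ : n ≤ i), f i) := by
      intro n
      rw [← hpart, ← hadd]
      · congr 1
        ext x
        simp only [mem_iUnion, mem_union, exists_prop]
        constructor
        · rintro ⟨i, hi⟩
          rcases lt_or_ge i n with h | h
          · exact Or.inl ⟨i, h, hi⟩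
          · exact Or.inr ⟨i, h, hi⟩
        · rintro (⟨i, -, hi⟩ | ⟨i, -, hi⟩) <;> exact ⟨i, hi⟩
      · exact MeasurableSet.iUnion fun i => MeasurableSet.iUnion fun _ => hf i
      · exact MeasurableSet.iUnion fun i => MeasurableSet.iUnion fun _ => hf i
      · simp only [disjoint_iUnion_left, disjoint_iUnion_right]
        exact fun i hi j hj => hd (by omega)
    have hT : Tendsto (fun n => r (⋃ i, ⋃ (_ : n ≤ i), f i)) atTop (𝓝 0) := by
      refine hlim _ (fun n => MeasurableSet.iUnion fun i => MeasurableSet.iUnion fun _ => hf i) ?_ ?_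
      · intro a b hab
        exact iUnion_mono fun i => iUnion_subset fun hi => subset_iUnion_of_subset (hab.trans hi)
          subset_rfl
      · ext x
        simp only [mem_iInter, mem_iUnion, exists_prop, mem_empty_iff_false, iff_false, not_forall]
        by_cases hx : ∃ i, x ∈ f i
        · obtain ⟨i, hi⟩ := hx
          refine ⟨i + 1, ?_⟩
          rintro ⟨j, hj, hxj⟩
          exact disjoint_left.1 (hd (by omega : i ≠ j)) hi hxj
        · exact ⟨0, fun ⟨j, _, hj⟩ => hx ⟨j, hj⟩⟩
    have hs : HasSum (fun i => r (f i)) (r (⋃ i, f i)) := by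
      rw [hasSum_iff_tendsto_nat_of_nonneg fun i => h0 _ (hf i)]
      have := (tendsto_const_nhds (x := r (⋃ i, f i))).sub hT
      rw [sub_zero] at this
      exact this.congr fun n => by rw [htail n]; ring
    rw [← hs.tsum_eq, ENNReal.ofReal_tsum_of_nonneg (fun i => h0 _ (hf i)) hs.summable])
  have hm : ∀ B, MeasurableSet B → m B = ENNReal.ofReal (r B) := fun B hB =>
    Measure.ofMeasurable_apply B hB
  exact ⟨m, ⟨by rw [hm _ MeasurableSet.univ]; exact ENNReal.ofReal_lt_top⟩, fun B hB => by
    rw [measureReal_def, hm B hB, ENNReal.toReal_ofReal (h0 B hB)]⟩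

namespace DirichletForm

section EnergyMeasure

variable {K : Type*} [TopologicalSpace K] [MeasurableSpace K] {μ : Measure K} {D : DirichletForm μ}
  [LocallyCompactSpace K] [TopologicalSpace.MetrizableSpace K] [BorelSpace K]
  [SecondCountableTopology K]

/-- `m` is close to the energy measure of each bounded element close to `u`. -/
def IsRegular.Approximates (hreg : D.IsRegular) (u : D.domain) (m : Measure K) : Prop :=
  ∀ (B : Set K), MeasurableSet B → ∀ b : D.bdd,
    |√(m.real B) - √((hreg.nuB b).real B)| ≤ √(2 * D.form (u - D.el b) (u - D.el b))

lemma tendsto_sqrt_form {ι : Type*} {l : Filter ι} {u : ι → D.domain} {v : D.domain}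
    (h : Tendsto (fun i => D.energyOne (u i - v)) l (𝓝 0)) :
    Tendsto (fun i => √(2 * D.form (v - u i) (v - u i))) l (𝓝 0) := by
  have h1 : Tendsto (fun i => 2 * D.form (v - u i) (v - u i)) l (𝓝 0) := by
    refine squeeze_zero (fun i => mul_nonneg zero_le_two (D.nonneg _)) (fun i => ?_)
      (by simpa using h.const_mul 2)
    rw [D.energyOne_sub_comm]
    exact mul_le_mul_of_nonneg_left (D.form_le_energyOne _) zero_le_two
  simpa using h1.sqrt

lemma IsRegular.Approximates.tendsto {hreg : D.IsRegular} {u : D.domain} {m : Measure K}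
    (hm : hreg.Approximates u m) {ι : Type*} {l : Filter ι} {g : ι → D.bdd}
    (h : Tendsto (fun i => D.energyOne (D.el (g i) - u)) l (𝓝 0)) {B : Set K}
    (hB : MeasurableSet B) :
    Tendsto (fun i => (hreg.nuB (g i)).real B) l (𝓝 (m.real B)) := by
  have h1 : Tendsto (fun i => √((hreg.nuB (g i)).real B)) l (𝓝 √(m.real B)) := by
    rw [tendsto_iff_dist_tendsto_zero]
    refine squeeze_zero (fun _ => dist_nonneg) (fun i => ?_) (tendsto_sqrt_form h)
    rw [dist_comm, Real.dist_eq]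
    exact hm B hB (g i)
  have h2 := h1.pow 2
  simp only [Real.sq_sqrt measureReal_nonneg] at h2
  exact h2

lemma form_sub_comm (u v : D.domain) : D.form (u - v) (u - v) = D.form (v - u) (v - u) := by
  rw [form_sub_sub, form_sub_sub, D.symm u v]; ring

lemma sqrt_form_sub_le (u v w : D.domain) : √(2 * D.form (u - w) (u - w))
    ≤ √(2 * D.form (u - v) (u - v)) + √(2 * D.form (v - w) (v - w)) := by
  have e : u - w = (u - v) + (v - w) := by abel
  have h1 : ∀ z : D.domain, √(2 * D.form z z) = √2 * √(D.form z z) := fun z =>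
    Real.sqrt_mul zero_le_two _
  rw [h1, h1, h1, ← mul_add]
  refine mul_le_mul_of_nonneg_left ?_ (Real.sqrt_nonneg _)
  rw [Real.sqrt_le_left (by positivity), e, form_add_add, add_sq, Real.sq_sqrt (D.nonneg _),
    Real.sq_sqrt (D.nonneg _)]
  linarith [le_abs_self (D.form (u - v) (v - w)), D.abs_form_le (u - v) (v - w)]

/-- Along a core sequence tending to `u`, the roots `√ν(B)` are Cauchy uniformly in `B`. The squared
limit inherits finite additivity, and the uniformity carries over continuity at the empty set, so it
is a measure. -/
lemma IsRegular.exists_approximates (hreg : D.IsRegular) (u : D.domain) :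
    ∃ m : Measure K, IsFiniteMeasure m ∧ hreg.Approximates u m := by
  obtain ⟨s, -, hs⟩ := hreg.exists_core_seq u
  have hδ := tendsto_sqrt_form hs
  have hex : ∀ B, ∃ r, MeasurableSet B →
      Tendsto (fun n => √((hreg.nuB (s n)).real B)) atTop (𝓝 r) := by
    intro B
    by_cases hB : MeasurableSet B
    · have hc : CauchySeq (fun n => √((hreg.nuB (s n)).real B)) := by
        rw [cauchySeq_iff_tendsto_dist_atTop_0, ← prod_atTop_atTop_eq]
        have h2 := (hδ.comp (tendsto_fst (g := atTop))).add (hδ.comp (tendsto_snd (f := atTop)))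
        rw [add_zero] at h2
        refine squeeze_zero (fun _ => dist_nonneg) (fun p => ?_) h2
        refine (hreg.abs_sqrt_nuB_sub_le hB _ _).trans ?_
        refine (sqrt_form_sub_le _ u _).trans (add_le_add_left ?_ _)
        rw [form_sub_comm]
        rfl
      obtain ⟨r, hr⟩ := cauchySeq_tendsto_of_complete hc
      exact ⟨r, fun _ => hr⟩
    · exact ⟨0, fun h => absurd h hB⟩
  choose r hr using hex
  have hrb : ∀ B, MeasurableSet B → ∀ b : D.bdd,
      |r B - √((hreg.nuB b).real B)| ≤ √(2 * D.form (u - D.el b) (u - D.el b)) := by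
    intro B hB b
    have h1 : Tendsto (fun n => √(2 * D.form (u - D.el (s n)) (u - D.el (s n)))
        + √(2 * D.form (u - D.el b) (u - D.el b))) atTop
        (𝓝 (0 + √(2 * D.form (u - D.el b) (u - D.el b)))) := hδ.add_const _
    rw [zero_add] at h1
    refine le_of_tendsto_of_tendsto' (((hr B hB).sub_const _).abs) h1 fun n => ?_
    refine (hreg.abs_sqrt_nuB_sub_le hB _ _).trans ((sqrt_form_sub_le _ u _).trans
      (add_le_add_left (le_of_eq ?_) _))
    rw [form_sub_comm]
  have hr0 : ∀ B, MeasurableSet B → 0 ≤ r B := fun B hB =>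
    ge_of_tendsto' (hr B hB) fun n => Real.sqrt_nonneg _
  have hr2 : ∀ B, MeasurableSet B →
      Tendsto (fun n => (hreg.nuB (s n)).real B) atTop (𝓝 (r B ^ 2)) := by
    intro B hB
    have := (hr B hB).pow 2
    simpa only [Real.sq_sqrt measureReal_nonneg] using this
  obtain ⟨m, hfin, hm⟩ := exists_measure_of_additive (fun B => r B ^ 2) (fun B _ => sq_nonneg _)
    (fun B C hB hC hBC => by
      refine tendsto_nhds_unique (hr2 _ (hB.union hC)) (((hr2 B hB).add (hr2 C hC)).congr fun n => ?_)
      rw [measureReal_union hBC hC])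
    (fun B hB hanti hemp => by
      have h1 : Tendsto (fun n => r (B n)) atTop (𝓝 0) := by
        rw [Metric.tendsto_atTop]
        intro ε hε
        obtain ⟨k, hk⟩ := (hδ.eventually (gt_mem_nhds (half_pos hε))).exists
        have h2 : Tendsto (fun n => √((hreg.nuB (s k)).real (B n))) atTop (𝓝 0) := by
          have h3 := tendsto_measure_iInter_atTop (μ := hreg.nuB (s k))
            (fun n => (hB n).nullMeasurableSet) hanti ⟨0, measure_ne_top _ _⟩
          rw [hemp, measure_empty] at h3
          have h4 := (ENNReal.tendsto_toReal ENNReal.zero_ne_top).comp h3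
          have h5 := h4.sqrt
          rw [ENNReal.toReal_zero, Real.sqrt_zero] at h5
          exact h5
        obtain ⟨N, hN⟩ := eventually_atTop.1 (h2.eventually (gt_mem_nhds (half_pos hε)))
        refine ⟨N, fun n hn => ?_⟩
        rw [Real.dist_eq, sub_zero, abs_of_nonneg (hr0 _ (hB n))]
        have h5 := le_of_abs_le (hrb _ (hB n) (s k))
        linarith [hN n hn]
      simpa using h1.pow 2)
  refine ⟨m, hfin, fun B hB b => ?_⟩
  rw [hm B hB, Real.sqrt_sq (hr0 B hB)]
  exact hrb B hB b

/-- The products in the definition are unique as elements of the domain, so it prescribes the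
integrals of all core functions; these determine a finite measure. -/
lemma IsRegular.isEnergyMeasureBdd_iff (hreg : D.IsRegular) (a : D.bdd) (m : Measure K) :
    D.IsEnergyMeasureBdd (D.el a) m ↔ m = hreg.nuB a := by
  constructor
  · rintro ⟨hfin, h⟩
    refine hreg.measure_ext fun φ hφ => ?_
    obtain ⟨fp, ff, hfp, hff, e⟩ := h (D.el φ) φ hφ.1 hφ.2 (D.represents_el φ)
    have h1 : D.el (a * φ) = fp := Represents.el_eq (hfp.congr (by
      filter_upwards [D.represents_el a] with x hx; rw [hx]; rfl))
    have h2 : D.el (a * a) = ff := Represents.el_eq (hff.congr (by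
      filter_upwards [D.represents_el a] with x hx; rw [hx]; rfl))
    rw [e, hreg.integral_nuB_core a hφ, gam]
    simp only [ef_apply, h1, h2]
    ring
  · rintro rfl
    refine ⟨inferInstance, fun p φ h1 h2 h3 => ?_⟩
    obtain ⟨b, hb, rfl, rfl⟩ := exists_isCore h1 h2 h3
    refine ⟨D.el (a * b), D.el (a * a), (D.represents_el (a * b)).congr ?_,
      (D.represents_el (a * a)).congr ?_, ?_⟩
    · filter_upwards [D.represents_el a] with x hx; rw [hx]; rfl
    · filter_upwards [D.represents_el a] with x hx; rw [hx]; rfl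
    · rw [hreg.integral_nuB_core a hb, gam]
      simp only [ef_apply]
      ring

lemma IsBdd.exists_el {u : D.domain} (hu : D.IsBdd u) : ∃ a : D.bdd, D.el a = u := by
  obtain ⟨C, hC⟩ := hu
  exact ⟨(D.represents_coe u).toBdd ⟨C.toNNReal, hC.mono fun x hx =>
    hx.trans (Real.le_coe_toNNReal C)⟩, Represents.el_toBdd _ _⟩

lemma isBdd_el (a : D.bdd) : D.IsBdd (D.el a) := by
  obtain ⟨C, hC⟩ := D.exists_nnreal_bound a
  exact ⟨C, by filter_upwards [hC, D.represents_el a] with x h1 h2; rwa [h2]⟩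

/-- The energy measure exists and is determined by the energy measures of bounded elements. -/
theorem IsRegular.approximates_energyMeasure (hreg : D.IsRegular) (u : D.domain) :
    hreg.Approximates u (D.energyMeasure u) := by
  obtain ⟨m, hfin, hm⟩ := hreg.exists_approximates u
  obtain ⟨s, -, hs⟩ := hreg.exists_core_seq u
  have H : ∃ m : Measure K, D.IsEnergyMeasure u m := by
    refine ⟨m, hfin, fun n => D.el (s n), fun n => hreg.nuB (s n), fun n => isBdd_el _,
      fun n => (hreg.isEnergyMeasureBdd_iff _ _).2 rfl, hs, fun B hB => ?_⟩
    exact (ENNReal.tendsto_toReal_iff (fun n => measure_ne_top _ _) (measure_ne_top _ _)).1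
      (hm.tendsto hs hB)
  have hspec : D.IsEnergyMeasure u (D.energyMeasure u) := by
    unfold energyMeasure
    rw [dif_pos H]
    exact H.choose_spec
  -- The chosen measure is a setwise limit along some bounded sequence, and `Approximates` forces
  -- the same limit `m` along every such sequence.
  obtain ⟨-, g, k, hg, hk, hgE, hlim⟩ := hspec
  choose b hb using fun n => (hg n).exists_el
  have e : D.energyMeasure u = m := by
    ext B hB
    refine tendsto_nhds_unique (hlim B hB) ?_
    have h1 : ∀ n, k n = hreg.nuB (b n) := fun n =>
      (hreg.isEnergyMeasureBdd_iff _ _).1 (by rw [hb n]; exact hk n)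
    simp only [h1]
    refine (ENNReal.tendsto_toReal_iff (fun n => measure_ne_top _ _) (measure_ne_top _ _)).1 ?_
    refine hm.tendsto (g := b) ?_ hB
    simpa only [hb] using hgE
  rwa [e]

lemma IsRegular.tendsto_energyMeasure (hreg : D.IsRegular) {u : D.domain} {ι : Type*}
    {l : Filter ι} {g : ι → D.bdd} (h : Tendsto (fun i => D.energyOne (D.el (g i) - u)) l (𝓝 0))
    {B : Set K} (hB : MeasurableSet B) :
    Tendsto (fun i => (hreg.nuB (g i)).real B) l (𝓝 ((D.energyMeasure u).real B)) :=
  (hreg.approximates_energyMeasure u).tendsto h hB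

lemma IsRegular.energyMeasure_el (hreg : D.IsRegular) (a : D.bdd) :
    D.energyMeasure (D.el a) = hreg.nuB a := by
  ext B hB
  rw [← ENNReal.toReal_eq_toReal_iff' (measure_ne_top _ _) (measure_ne_top _ _)]
  refine tendsto_nhds_unique (hreg.tendsto_energyMeasure (l := atTop) (g := fun _ : ℕ => a)
    (by simp [energyOne]) hB) tendsto_const_nhds

lemma tendsto_energyOne_add {ι : Type*} {l : Filter ι} {a b : ι → D.domain} {u v : D.domain}
    (ha : Tendsto (fun i => D.energyOne (a i - u)) l (𝓝 0))
    (hb : Tendsto (fun i => D.energyOne (b i - v)) l (𝓝 0)) :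
    Tendsto (fun i => D.energyOne (a i + b i - (u + v))) l (𝓝 0) := by
  refine squeeze_zero (fun i => D.energyOne_nonneg _) (fun i => ?_)
    (by simpa using (ha.const_mul 2).add (hb.const_mul 2))
  rw [add_sub_add_comm]
  exact D.energyOne_add_le _ _

lemma tendsto_energyOne_smul {ι : Type*} {l : Filter ι} {a : ι → D.domain} {u : D.domain}
    (ha : Tendsto (fun i => D.energyOne (a i - u)) l (𝓝 0)) (t : ℝ) :
    Tendsto (fun i => D.energyOne (t • a i - t • u)) l (𝓝 0) := by
  simp only [← smul_sub, energyOne_smul]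
  simpa using ha.const_mul (t ^ 2)

lemma IsRegular.isQuad_energyMeasure (hreg : D.IsRegular) {B : Set K} (hB : MeasurableSet B) :
    IsQuad (fun u : D.domain => (D.energyMeasure u).real B) := by
  have hs := fun u => (hreg.exists_core_seq u)
  choose s hs1 hs2 using hs
  have T : ∀ {u : D.domain} {g : ℕ → D.bdd},
      Tendsto (fun i => D.energyOne (D.el (g i) - u)) atTop (𝓝 0) →
      Tendsto (fun i => (hreg.nuB (g i)).real B) atTop (𝓝 ((D.energyMeasure u).real B)) :=
    fun h => hreg.tendsto_energyMeasure h hB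
  have A : ∀ {u v : D.domain} {g k : ℕ → D.bdd},
      Tendsto (fun i => D.energyOne (D.el (g i) - u)) atTop (𝓝 0) →
      Tendsto (fun i => D.energyOne (D.el (k i) - v)) atTop (𝓝 0) →
      Tendsto (fun i => D.energyOne (D.el (g i + k i) - (u + v))) atTop (𝓝 0) := by
    intro u v g k h1 h2
    simp only [map_add]
    exact tendsto_energyOne_add h1 h2
  have S : ∀ {u : D.domain} {g : ℕ → D.bdd} (t : ℝ),
      Tendsto (fun i => D.energyOne (D.el (g i) - u)) atTop (𝓝 0) →
      Tendsto (fun i => D.energyOne (D.el (t • g i) - t • u)) atTop (𝓝 0) := by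
    intro u g t h1
    simp only [map_smul]
    exact tendsto_energyOne_smul h1 t
  constructor
  · intro u v w
    have hu := hs2 u
    have hv := hs2 v
    have hw := hs2 w
    refine tendsto_nhds_unique ((((T (A (A hu hv) hw)).add (T hu)).add (T hv)).add (T hw))
      (((((T (A hu hv)).add (T (A hu hw))).add (T (A hv hw)))).congr fun n => ?_)
    exact ((hreg.isQuad_nuB hB).add _ _ _).symm
  · intro t u v
    have hu := hs2 u
    have hv := hs2 v
    refine tendsto_nhds_unique (T (A (S t hu) hv)) ((((T hu).const_mul (t ^ 2)).add (T hv)).add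
      ((((T (A hu hv)).sub (T hu)).sub (T hv)).const_mul t) |>.congr fun n => ?_)
    exact ((hreg.isQuad_nuB hB).smul _ _ _).symm

end EnergyMeasure

end DirichletForm

/-! ### Integration against mutual energy measures. -/

/-- Bounded measurable functions. -/
def BddMeas {X : Type*} [MeasurableSpace X] (ψ : X → ℝ) : Prop :=
  Measurable ψ ∧ ∃ C : ℝ, ∀ x, |ψ x| ≤ C

namespace BddMeas

variable {X : Type*} [MeasurableSpace X] {ψ χ : X → ℝ}

lemma const (c : ℝ) : BddMeas (fun _ : X => c) := ⟨measurable_const, |c|, fun _ => le_rfl⟩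

lemma mul (hψ : BddMeas ψ) (hχ : BddMeas χ) : BddMeas (fun x => ψ x * χ x) := by
  obtain ⟨h1, C, hC⟩ := hψ
  obtain ⟨h2, C', hC'⟩ := hχ
  refine ⟨h1.mul h2, C * C', fun x => ?_⟩
  rw [abs_mul]
  exact mul_le_mul (hC x) (hC' x) (abs_nonneg _) ((abs_nonneg _).trans (hC x))

lemma add (hψ : BddMeas ψ) (hχ : BddMeas χ) : BddMeas (fun x => ψ x + χ x) := by
  obtain ⟨h1, C, hC⟩ := hψ
  obtain ⟨h2, C', hC'⟩ := hχ
  exact ⟨h1.add h2, C + C', fun x => (abs_add_le _ _).trans (add_le_add (hC x) (hC' x))⟩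

lemma sub (hψ : BddMeas ψ) (hχ : BddMeas χ) : BddMeas (fun x => ψ x - χ x) := by
  obtain ⟨h1, C, hC⟩ := hψ
  obtain ⟨h2, C', hC'⟩ := hχ
  exact ⟨h1.sub h2, C + C', fun x => (abs_sub _ _).trans (add_le_add (hC x) (hC' x))⟩

lemma integrable (hψ : BddMeas ψ) (m : Measure X) [IsFiniteMeasure m] : Integrable ψ m := by
  obtain ⟨h1, C, hC⟩ := hψ
  exact Integrable.of_bound h1.aestronglyMeasurable C (Eventually.of_forall hC)

lemma prod {ι : Type*} (s : Finset ι) {ψ : ι → X → ℝ} (h : ∀ i ∈ s, BddMeas (ψ i)) :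
    BddMeas (fun x => ∏ i ∈ s, ψ i x) := by
  classical
  induction s using Finset.induction_on with
  | empty => simpa using const 1
  | insert a s ha ih =>
    simp only [Finset.prod_insert ha]
    exact (h a (Finset.mem_insert_self _ _)).mul (ih fun i hi => h i (Finset.mem_insert_of_mem hi))

lemma pow (hψ : BddMeas ψ) (n : ℕ) : BddMeas (fun x => ψ x ^ n) := by
  induction n with
  | zero => simpa using const 1
  | succ n ih => simpa only [pow_succ] using ih.mul hψ

end BddMeas

namespace DirichletForm

section Mutual

variable {K : Type*} [TopologicalSpace K] [MeasurableSpace K] {μ : Measure K} (D : DirichletForm μ)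

/-- The integral of `ψ` against the mutual energy measure of `u` and `v`. -/
def mnu (ψ : K → ℝ) : D.domain → D.domain → ℝ :=
  polarForm (fun u => ∫ x, ψ x ∂(D.energyMeasure u))

lemma mnu_comm (ψ : K → ℝ) (u v : D.domain) : D.mnu ψ u v = D.mnu ψ v u := polarForm_comm _ u v

lemma mnu_mul_const (ψ : K → ℝ) (c : ℝ) (u v : D.domain) :
    D.mnu (fun x => ψ x * c) u v = D.mnu ψ u v * c := by
  unfold mnu polarForm
  simp only [integral_mul_const]
  ring

lemma mnu_add_fun {ψ χ : K → ℝ} (hψ : BddMeas ψ) (hχ : BddMeas χ) (u v : D.domain) :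
    D.mnu (fun x => ψ x + χ x) u v = D.mnu ψ u v + D.mnu χ u v := by
  unfold mnu polarForm
  simp only [integral_add (hψ.integrable _) (hχ.integrable _)]
  ring

lemma mnu_sub_fun {ψ χ : K → ℝ} (hψ : BddMeas ψ) (hχ : BddMeas χ) (u v : D.domain) :
    D.mnu (fun x => ψ x - χ x) u v = D.mnu ψ u v - D.mnu χ u v := by
  unfold mnu polarForm
  simp only [integral_sub (hψ.integrable _) (hχ.integrable _)]
  ring

variable {D}
variable [LocallyCompactSpace K] [TopologicalSpace.MetrizableSpace K] [BorelSpace K]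
  [SecondCountableTopology K]

lemma IsRegular.isQuad_integral (hreg : D.IsRegular) {ψ : K → ℝ} (hψ : BddMeas ψ) :
    IsQuad (fun u : D.domain => ∫ x, ψ x ∂(D.energyMeasure u)) := by
  obtain ⟨h1, C, hC⟩ := hψ
  constructor
  · intro u v w
    have := sum_integral_eq_zero_of_sets (fun i => D.energyMeasure
      (![u + v + w, u, v, w, u + v, u + w, v + w] i)) ![1, 1, 1, 1, -1, -1, -1] (fun B hB => by
      simp only [Fin.sum_univ_succ, Matrix.cons_val_zero, Matrix.cons_val_succ, Fin.sum_univ_zero]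
      linarith [(hreg.isQuad_energyMeasure hB).add u v w]) h1 hC
    simp only [Fin.sum_univ_succ, Matrix.cons_val_zero, Matrix.cons_val_succ, Fin.sum_univ_zero]
      at this
    linarith
  · intro t u v
    have := sum_integral_eq_zero_of_sets (fun i => D.energyMeasure
      (![t • u + v, u, v, u + v] i)) ![1, -t ^ 2 + t, -1 + t, -t] (fun B hB => by
      simp only [Fin.sum_univ_succ, Matrix.cons_val_zero, Matrix.cons_val_succ, Fin.sum_univ_zero]
      linarith [(hreg.isQuad_energyMeasure hB).smul t u v]) h1 hC
    simp only [Fin.sum_univ_succ, Matrix.cons_val_zero, Matrix.cons_val_succ, Fin.sum_univ_zero]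
      at this
    linarith

lemma IsRegular.mnu_self (hreg : D.IsRegular) {ψ : K → ℝ} (hψ : BddMeas ψ) (u : D.domain) :
    D.mnu ψ u u = ∫ x, ψ x ∂(D.energyMeasure u) := (hreg.isQuad_integral hψ).polar_self u

lemma IsRegular.energyMeasure_real_le (hreg : D.IsRegular) (u : D.domain) (B : Set K) :
    (D.energyMeasure u).real B ≤ 2 * D.form u u := by
  refine (measureReal_mono (subset_univ B)).trans ?_
  obtain ⟨s, -, hs⟩ := hreg.exists_core_seq u
  exact le_of_tendsto_of_tendsto' (hreg.tendsto_energyMeasure hs MeasurableSet.univ)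
    ((D.tendsto_form_self_of_energyOne hs).const_mul 2) fun n => hreg.nuB_real_le _ _

/-- Cauchy-Schwarz needs a nonnegative weight, so `ψ` is written as `(ψ + C) - C`; the weights,
bounded by `2C` and `C`, contribute `4C` and `2C`. -/
lemma IsRegular.abs_mnu_le (hreg : D.IsRegular) {ψ : K → ℝ} (hψ : Measurable ψ) {C : ℝ}
    (hC : ∀ x, |ψ x| ≤ C) (hC0 : 0 ≤ C) (u v : D.domain) :
    |D.mnu ψ u v| ≤ 6 * C * (√(D.form u u) * √(D.form v v)) := by
  have pos : ∀ (χ : K → ℝ) (c : ℝ), Measurable χ → (∀ x, 0 ≤ χ x) → (∀ x, χ x ≤ c) → 0 ≤ c →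
      |D.mnu χ u v| ≤ 2 * c * (√(D.form u u) * √(D.form v v)) := by
    intro χ c h1 h2 h3 hc
    have hb : BddMeas χ := ⟨h1, c, fun x => by rw [abs_of_nonneg (h2 x)]; exact h3 x⟩
    have hle : ∀ w : D.domain, ∫ x, χ x ∂(D.energyMeasure w) ≤ 2 * c * D.form w w := by
      intro w
      have : ∫ x, χ x ∂(D.energyMeasure w) ≤ ∫ _, c ∂(D.energyMeasure w) :=
        integral_mono (hb.integrable _) (integrable_const _) h3
      rw [integral_const, smul_eq_mul] at this
      nlinarith [hreg.energyMeasure_real_le w univ]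
    refine ((hreg.isQuad_integral hb).abs_polar_le (fun _ => integral_nonneg h2) u v).trans ?_
    have e : ∀ w : D.domain, √(2 * c * D.form w w) = √(2 * c) * √(D.form w w) := fun w =>
      Real.sqrt_mul (by positivity) _
    calc _ ≤ √(2 * c * D.form u u) * √(2 * c * D.form v v) :=
          mul_le_mul (Real.sqrt_le_sqrt (hle u)) (Real.sqrt_le_sqrt (hle v)) (Real.sqrt_nonneg _)
            (Real.sqrt_nonneg _)
      _ = (√(2 * c) * √(2 * c)) * (√(D.form u u) * √(D.form v v)) := by rw [e, e]; ring
      _ = _ := by rw [Real.mul_self_sqrt (by positivity)]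
  have h1 := pos (fun x => ψ x + C) (2 * C) (hψ.add_const C)
    (fun x => by linarith [neg_le_of_abs_le (hC x)]) (fun x => by linarith [le_of_abs_le (hC x)])
    (by positivity)
  have h2 := pos (fun _ => C) C measurable_const (fun _ => hC0) (fun _ => le_rfl) hC0
  rw [D.mnu_add_fun ⟨hψ, C, hC⟩ (BddMeas.const C)] at h1
  have h3 : D.mnu ψ u v = (D.mnu ψ u v + D.mnu (fun _ => C) u v) - D.mnu (fun _ => C) u v := by ring
  rw [h3]
  exact (abs_sub _ _).trans (by linarith)

lemma IsRegular.tendsto_mnu (hreg : D.IsRegular) {ψ : K → ℝ} (hψ : BddMeas ψ) {ι : Type*}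
    {l : Filter ι} {a : ι → D.domain} {u : D.domain}
    (ha : Tendsto (fun i => D.energyOne (a i - u)) l (𝓝 0)) (v : D.domain) :
    Tendsto (fun i => D.mnu ψ (a i) v) l (𝓝 (D.mnu ψ u v)) := by
  obtain ⟨h1, C, hC⟩ := hψ
  have hC' : ∀ x, |ψ x| ≤ max C 0 := fun x => (hC x).trans (le_max_left _ _)
  rw [tendsto_iff_dist_tendsto_zero]
  have h2 : Tendsto (fun i => √(D.energyOne (a i - u))) l (𝓝 0) := by simpa using ha.sqrt
  refine squeeze_zero (fun _ => dist_nonneg) (fun i => ?_)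
    (by simpa using (h2.mul_const √(D.form v v)).const_mul (6 * max C 0))
  rw [Real.dist_eq]
  have h3 : D.mnu ψ (a i) v - D.mnu ψ u v = D.mnu ψ (a i - u) v :=
    ((hreg.isQuad_integral ⟨h1, C, hC⟩).polar_sub_left _ _ _).symm
  rw [h3]
  refine (hreg.abs_mnu_le h1 hC' (le_max_right _ _) _ _).trans ?_
  refine mul_le_mul_of_nonneg_left ?_ (by positivity)
  exact mul_le_mul_of_nonneg_right (Real.sqrt_le_sqrt (D.form_le_energyOne _)) (Real.sqrt_nonneg _)

/-- The mutual energy measure has total mass `2 E(u, v)`. -/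
lemma IsStrongLocal.mnu_one (hloc : D.IsStrongLocal) (hreg : D.IsRegular) (u v : D.domain) :
    D.mnu (fun _ => 1) u v = 2 * D.form u v := by
  have h : ∀ w : D.domain, ∫ _, (1 : ℝ) ∂(D.energyMeasure w) = 2 * D.form w w := by
    intro w
    obtain ⟨s, hs, hsE⟩ := hreg.exists_core_seq w
    rw [integral_const, smul_eq_mul, mul_one]
    refine tendsto_nhds_unique (hreg.tendsto_energyMeasure hsE MeasurableSet.univ)
      (((D.tendsto_form_self_of_energyOne hsE).const_mul 2).congr fun n => ?_)
    rw [hloc.nuB_core_univ hreg (hs n)]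
    rfl
  simp only [mnu, polarForm, h, form_add_add]
  ring

lemma IsRegular.mnu_el_of_qc (hreg : D.IsRegular) (a b φ : D.bdd) {w : K → ℝ} (hw : D.QC w)
    (hwφ : (φ : K → ℝ) =ᵐ[μ] w) {C : ℝ≥0} (hC : ∀ x, |w x| ≤ C) :
    D.mnu w (D.el a) (D.el b) = D.gam a b φ := by
  simp only [mnu, polarForm]
  rw [← map_add, hreg.energyMeasure_el, hreg.energyMeasure_el, hreg.energyMeasure_el,
    hreg.integral_nuB _ _ hw hwφ hC, hreg.integral_nuB _ _ hw hwφ hC,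
    hreg.integral_nuB _ _ hw hwφ hC]
  simp only [gam_add_left, gam_add_right, D.gam_comm b a]
  ring

/-- A linear relation between mutual energy measures can be tested on continuous functions. -/
lemma IsRegular.sum_mnu_eq_zero (hreg : D.IsRegular) {ι : Type*} [Fintype ι] (u v : ι → D.domain)
    {c : ι → K → ℝ} (hc : ∀ i, BddMeas (c i))
    (h : ∀ φ : D.bdd, D.IsCore φ → ∑ i, D.mnu (fun x => (φ : K → ℝ) x * c i x) (u i) (v i) = 0)
    {ψ : K → ℝ} (hψ : BddMeas ψ) : ∑ i, D.mnu (fun x => ψ x * c i x) (u i) (v i) = 0 := by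
  obtain ⟨h1, M, hM⟩ := hψ
  choose hcm C hC using hc
  have hC' : ∀ i x, |c i x| ≤ ∑ j, max (C j) 0 := fun i x => ((hC i x).trans (le_max_left _ _)).trans
    (Finset.single_le_sum (f := fun j => max (C j) 0) (fun j _ => le_max_right _ _)
      (Finset.mem_univ i))
  let z : ι × Fin 3 → D.domain := fun p => ![u p.1 + v p.1, u p.1, v p.1] p.2
  let s : Fin 3 → ℝ := ![1 / 2, -1 / 2, -1 / 2]
  have hs : ∀ i, |s i| ≤ 1 := by
    intro i; fin_cases i <;> norm_num [s, abs_div]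
  have e : ∀ χ : K → ℝ, ∑ p : ι × Fin 3, ∫ x, χ x * (c p.1 x * s p.2) ∂(D.energyMeasure (z p))
      = ∑ i, D.mnu (fun x => χ x * c i x) (u i) (v i) := by
    intro χ
    rw [Fintype.sum_prod_type]
    refine Finset.sum_congr rfl fun i _ => ?_
    simp only [← mul_assoc, integral_mul_const]
    simp only [Fin.sum_univ_three, z, s, Matrix.cons_val_zero, Matrix.cons_val_one, Matrix.cons_val]
    unfold mnu polarForm
    ring
  rw [← e]
  refine hreg.sum_integral_eq_zero (fun p => D.energyMeasure (z p))
    (c := fun p x => c p.1 x * s p.2) (fun p => (hcm p.1).mul_const _)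
    (C := ∑ j, max (C j) 0) (fun p x => ?_) (fun φ hφ => by rw [e]; exact h φ hφ) h1 hM
  rw [abs_mul]
  calc _ ≤ (∑ j, max (C j) 0) * 1 := mul_le_mul (hC' _ _) (hs _) (abs_nonneg _)
        (Finset.sum_nonneg fun j _ => le_max_right _ _)
    _ = _ := mul_one _

/-- The derivation property of mutual energy measures. -/
theorem IsStrongLocal.mnu_mul (hloc : D.IsStrongLocal) (hreg : D.IsRegular) {a b : D.bdd}
    (ha : D.QC a) (hb : D.QC b) (ha' : BddMeas (a : K → ℝ)) (hb' : BddMeas (b : K → ℝ))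
    {ψ : K → ℝ} (hψ : BddMeas ψ) (w : D.domain) :
    D.mnu ψ (D.el (a * b)) w = D.mnu (fun x => ψ x * (a : K → ℝ) x) (D.el b) w
      + D.mnu (fun x => ψ x * (b : K → ℝ) x) (D.el a) w := by
  -- For bounded second argument and a core test function `φ`, the functions `φ`, `φ a`, `φ b` are
  -- bounded and quasi-continuous, so all integrals are values of `gam`, where the Leibniz rule is
  -- known. A general `w` follows by approximation.
  have core : ∀ c : D.bdd, D.mnu ψ (D.el (a * b)) (D.el c)
      = D.mnu (fun x => ψ x * (a : K → ℝ) x) (D.el b) (D.el c)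
      + D.mnu (fun x => ψ x * (b : K → ℝ) x) (D.el a) (D.el c) := by
    intro c
    have key := hreg.sum_mnu_eq_zero (ι := Fin 3) (fun i => D.el (![a * b, b, a] i))
      (fun _ => D.el c) (c := ![fun _ => -1, a, b])
      (fun i => by
        fin_cases i
        · exact BddMeas.const (-1)
        · exact ha'
        · exact hb') (fun φ hφ => by
        simp only [Fin.sum_univ_three, Matrix.cons_val_zero, Matrix.cons_val_one, Matrix.cons_val]
        have hφq : D.QC φ := qc_of_continuous hφ.1
        obtain ⟨M, hM⟩ := hφ.1.bounded_above_of_compact_support hφ.2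
        have bd : ∀ {χ : K → ℝ}, BddMeas χ → ∃ C : ℝ≥0, ∀ x, |χ x| ≤ C := by
          rintro χ ⟨-, C, hC⟩
          exact ⟨C.toNNReal, fun x => (hC x).trans (Real.le_coe_toNNReal C)⟩
        have hφb : BddMeas (φ : K → ℝ) := ⟨hφ.1.measurable, M, hM⟩
        obtain ⟨C0, hC0⟩ := bd hφb
        obtain ⟨C1, hC1⟩ := bd (hφb.mul ha')
        obtain ⟨C2, hC2⟩ := bd (hφb.mul hb')
        have e1 := hreg.mnu_el_of_qc b c (φ * a) (w := fun x => (φ : K → ℝ) x * (a : K → ℝ) x)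
          (hφq.mul ha) ae_eq_rfl hC1
        have e2 := hreg.mnu_el_of_qc a c (φ * b) (w := fun x => (φ : K → ℝ) x * (b : K → ℝ) x)
          (hφq.mul hb) ae_eq_rfl hC2
        rw [mnu_mul_const, hreg.mnu_el_of_qc _ _ φ hφq ae_eq_rfl hC0, e1, e2, hloc.gam_mul_left hreg,
          mul_comm a φ, mul_comm b φ]
        ring) hψ
    simp only [Fin.sum_univ_three, Matrix.cons_val_zero, Matrix.cons_val_one, Matrix.cons_val,
      mnu_mul_const] at key
    linarith
  obtain ⟨s, -, hs⟩ := hreg.exists_core_seq w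
  have T : ∀ {χ : K → ℝ}, BddMeas χ → ∀ u : D.domain,
      Tendsto (fun n => D.mnu χ u (D.el (s n))) atTop (𝓝 (D.mnu χ u w)) := by
    intro χ hχ u
    simp only [D.mnu_comm χ u]
    exact hreg.tendsto_mnu hχ hs u
  exact tendsto_nhds_unique (T hψ _) (((T (hψ.mul ha') _).add (T (hψ.mul hb') _)).congr
    fun n => (core (s n)).symm)

/-- Energy measures do not charge the sets where a quasi-continuous version of zero is nonzero. -/
lemma IsRegular.energyMeasure_ne_zero (hreg : D.IsRegular) (u : D.domain) {w : K → ℝ} (hw : D.QC w)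
    (hwm : Measurable w) (h0 : ∀ᵐ x ∂μ, w x = 0) : D.energyMeasure u {x | w x ≠ 0} = 0 := by
  obtain ⟨s, -, hs⟩ := hreg.exists_core_seq u
  have h := hreg.tendsto_energyMeasure hs (hwm (measurableSet_singleton 0).compl)
  have h1 : (D.energyMeasure u).real {x | w x ≠ 0} = 0 :=
    tendsto_nhds_unique h (tendsto_const_nhds.congr fun n => by
      have := hreg.nuB_ne_zero_eq_zero (s n) hw h0
      rw [measureReal_def]
      change _ = ((hreg.nuB (s n)) {x | w x ≠ 0}).toReal
      rw [this]; rfl)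
  exact (measureReal_eq_zero_iff).1 h1

end Mutual

end DirichletForm

namespace DirichletForm

/-! ### The chain rule. -/

section Chain

variable {K : Type*} [TopologicalSpace K] [MeasurableSpace K] {μ : Measure K} {D : DirichletForm μ}
  [LocallyCompactSpace K] [TopologicalSpace.MetrizableSpace K] [BorelSpace K]
  [SecondCountableTopology K]

/-- The powers `a, a², a³, …`. -/
def powSucc (a : D.bdd) : ℕ → D.bdd
  | 0 => a
  | n + 1 => a * powSucc a n

lemma powSucc_apply (a : D.bdd) (n : ℕ) (x : K) :
    (powSucc a n : K → ℝ) x = (a : K → ℝ) x ^ (n + 1) := by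
  induction n with
  | zero => simp [powSucc]
  | succ n ih =>
    change (a : K → ℝ) x * (powSucc a n : K → ℝ) x = _
    rw [ih]; ring

lemma powSucc_eq (a : D.bdd) (n : ℕ) :
    (powSucc a n : K → ℝ) = fun x => (a : K → ℝ) x ^ (n + 1) := funext (powSucc_apply a n)

lemma IsStrongLocal.mnu_powSucc (hloc : D.IsStrongLocal) (hreg : D.IsRegular) {a : D.bdd}
    (ha : D.QC a) (ha' : BddMeas (a : K → ℝ)) (n : ℕ) {ψ : K → ℝ} (hψ : BddMeas ψ)
    (w : D.domain) : D.mnu ψ (D.el (powSucc a n)) w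
      = D.mnu (fun x => ψ x * ((a : K → ℝ) x ^ n * (n + 1))) (D.el a) w := by
  induction n generalizing ψ with
  | zero => simp [powSucc]
  | succ n ih =>
    have hq : D.QC (powSucc a n) := by
      rw [powSucc_eq]; exact ha.comp (continuous_pow (n + 1))
    have hb : BddMeas (powSucc a n : K → ℝ) := by
      rw [powSucc_eq]; exact ha'.pow (n + 1)
    change D.mnu ψ (D.el (a * powSucc a n)) w = _
    rw [hloc.mnu_mul hreg ha hq ha' hb hψ, ih (hψ.mul ha'), ← D.mnu_add_fun]
    · congr 1
      funext x
      rw [powSucc_apply]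
      push_cast
      ring
    · exact (hψ.mul ha').mul ((ha'.pow n).mul (BddMeas.const ((n : ℝ) + 1)))
    · exact hψ.mul hb

lemma _root_.BddMeas.comp_continuous {X : Type*} [MeasurableSpace X] {ψ : X → ℝ} (hψ : BddMeas ψ)
    {F : ℝ → ℝ} (hF : Continuous F) : BddMeas (fun x => F (ψ x)) := by
  obtain ⟨h1, C, hC⟩ := hψ
  obtain ⟨B, hB⟩ := (isCompact_Icc (a := -C) (b := C)).exists_bound_of_continuousOn hF.continuousOn
  exact ⟨hF.measurable.comp h1, B, fun x => hB _ (abs_le.1 (hC x))⟩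

/-- The polynomial enters through its derivative `r`, and the primitive is normalized to vanish at
`0`, so that composing it with `a` stays in the domain. -/
lemma IsStrongLocal.exists_polynomial_comp (hloc : D.IsStrongLocal) (hreg : D.IsRegular)
    {a : D.bdd} (ha : D.QC a) (ha' : BddMeas (a : K → ℝ)) (r : Polynomial ℝ) :
    ∃ (P : Polynomial ℝ) (b : D.bdd), Polynomial.derivative P = r ∧ P.eval 0 = 0 ∧
      (∀ x, (b : K → ℝ) x = P.eval ((a : K → ℝ) x)) ∧ ∀ (ψ : K → ℝ) (_ : BddMeas ψ) (w : D.domain),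
        D.mnu ψ (D.el b) w = D.mnu (fun x => ψ x * r.eval ((a : K → ℝ) x)) (D.el a) w := by
  induction r using Polynomial.induction_on' with
  | add r s hr hs =>
    obtain ⟨P, b, h1, h2, h3, h4⟩ := hr
    obtain ⟨Q, c, k1, k2, k3, k4⟩ := hs
    refine ⟨P + Q, b + c, by rw [Polynomial.derivative_add, h1, k1],
      by rw [Polynomial.eval_add, h2, k2, add_zero], fun x => ?_, fun ψ hψ w => ?_⟩
    · rw [Polynomial.eval_add, ← h3, ← k3]; rfl
    · simp only [Polynomial.eval_add, mul_add]
      rw [D.mnu_add_fun (hψ.mul (ha'.comp_continuous r.continuous))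
        (hψ.mul (ha'.comp_continuous s.continuous)), ← h4 ψ hψ, ← k4 ψ hψ, map_add]
      exact (hreg.isQuad_integral hψ).polar_add_left _ _ _
  | monomial n c =>
    refine ⟨Polynomial.monomial (n + 1) (c / (n + 1)), (c / (n + 1)) • powSucc a n, ?_, ?_,
      fun x => ?_, fun ψ hψ w => ?_⟩
    · rw [Polynomial.derivative_monomial]
      congr 1
      push_cast
      field_simp
    · simp
    · rw [Polynomial.eval_monomial, ← powSucc_apply]; rfl
    · rw [map_smul]
      refine ((hreg.isQuad_integral hψ).polar_smul_left _ _ _).trans ?_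
      change _ * D.mnu ψ _ _ = _
      rw [hloc.mnu_powSucc hreg ha ha' n hψ, mul_comm, ← mnu_mul_const]
      congr 1
      funext x
      rw [Polynomial.eval_monomial]
      field_simp

/-- The chain rule for bounded functions. -/
lemma IsStrongLocal.mnu_comp_bdd (hloc : D.IsStrongLocal) (hreg : D.IsRegular) {a : D.bdd}
    (ha : D.QC a) (ha' : BddMeas (a : K → ℝ)) {g : ℝ → ℝ} (hg : ContDiff ℝ 1 g) {c : D.bdd}
    (hc : ∀ x, (c : K → ℝ) x = g ((a : K → ℝ) x) - g 0) {ψ : K → ℝ} (hψ : BddMeas ψ)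
    (w : D.domain) :
    D.mnu ψ (D.el c) w = D.mnu (fun x => ψ x * deriv g ((a : K → ℝ) x)) (D.el a) w := by
  have ha2 := ha'
  have hψ2 := hψ
  obtain ⟨-, M, hM⟩ := ha2
  obtain ⟨hψm, C, hC⟩ := hψ2
  have hM0 : (0 : ℝ) ≤ max M 0 := le_max_right _ _
  have hM' : ∀ x, |(a : K → ℝ) x| ≤ max M 0 := fun x => (hM x).trans (le_max_left _ _)
  have hC' : ∀ x, |ψ x| ≤ max C 0 := fun x => (hC x).trans (le_max_left _ _)
  have hC0 : (0 : ℝ) ≤ max C 0 := le_max_right _ _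
  generalize max M 0 = M at hM0 hM'
  generalize max C 0 = C at hC' hC0
  have hg' : Continuous (deriv g) := hg.continuous_deriv le_rfl
  set R := √(D.form (D.el a) (D.el a)) * √(D.form w w) with hR
  have hR0 : 0 ≤ R := by positivity
  have key : ∀ ε : ℝ≥0, 0 < ε → |D.mnu ψ (D.el c) w
      - D.mnu (fun x => ψ x * deriv g ((a : K → ℝ) x)) (D.el a) w| ≤ 12 * C * R * ε := by
    intro ε hε
    -- Weierstrass approximation is applied to `deriv g` rather than to `g`: the difference `g - g 0
    -- - P` is then `ε`-Lipschitz on the range of `a`, which makes the energy of `c - b` small.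
    obtain ⟨r, hr⟩ := exists_polynomial_near_of_continuousOn (-M) M (deriv g) hg'.continuousOn ε hε
    obtain ⟨P, b, hP, hP0, hb, hmnu⟩ := hloc.exists_polynomial_comp hreg ha ha' r
    let Θ : ℝ → ℝ := fun t => g t - g 0 - P.eval t
    have hΘd : ∀ t, HasDerivAt Θ (deriv g t - r.eval t) t := fun t => by
      rw [← hP]
      exact (((hg.differentiable one_ne_zero) t).hasDerivAt.sub_const _).sub (P.hasDerivAt t)
    have hΘ : LipschitzOnWith ε Θ (Icc (-M) M) := by
      refine (convex_Icc (-M) M).lipschitzOnWith_of_nnnorm_hasDerivWithin_le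
        (fun t _ => (hΘd t).hasDerivWithinAt) fun t ht => ?_
      rw [← NNReal.coe_le_coe, coe_nnnorm, Real.norm_eq_abs, abs_sub_comm]
      exact (hr t ht).le
    have hmaps : ∀ t, clamp M t ∈ Icc (-M) M := fun t => abs_le.1 (abs_clamp_le hM0 t)
    have hL : LipschitzWith ε (fun t => Θ (clamp M t)) := by
      refine LipschitzWith.of_dist_le_mul fun s t => ?_
      refine (hΘ.dist_le_mul _ (hmaps s) _ (hmaps t)).trans ?_
      have := (lipschitzWith_clamp M).dist_le_mul s t
      rw [NNReal.coe_one, one_mul] at this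
      exact mul_le_mul_of_nonneg_left this ε.2
    have h0 : (fun t => Θ (clamp M t)) 0 = 0 := by
      simp only [Θ, clamp_zero hM0, hP0]; ring
    have e : c - b = D.lcomp hL h0 a := Subtype.ext (funext fun x => by
      change (c : K → ℝ) x - (b : K → ℝ) x = Θ (clamp M ((a : K → ℝ) x))
      rw [clamp_eq_self (hM' x), hc, hb])
    have hE : √(D.form (D.el (c - b)) (D.el (c - b))) ≤ ε * √(D.form (D.el a) (D.el a)) := by
      rw [e, Real.sqrt_le_left (by positivity), mul_pow, Real.sq_sqrt (D.nonneg _)]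
      exact D.ef_lcomp_le hL h0 a
    have h1 : |D.mnu ψ (D.el c) w - D.mnu ψ (D.el b) w| ≤ 6 * C * R * ε := by
      have h2 : D.mnu ψ (D.el c) w - D.mnu ψ (D.el b) w = D.mnu ψ (D.el (c - b)) w := by
        rw [map_sub]
        exact ((hreg.isQuad_integral hψ).polar_sub_left _ _ _).symm
      rw [h2]
      refine (hreg.abs_mnu_le hψm hC' hC0 _ _).trans ?_
      calc _ ≤ 6 * C * ((ε * √(D.form (D.el a) (D.el a))) * √(D.form w w)) := by gcongr
        _ = _ := by rw [hR]; ring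
    have h3 : |D.mnu ψ (D.el b) w - D.mnu (fun x => ψ x * deriv g ((a : K → ℝ) x)) (D.el a) w|
        ≤ 6 * C * R * ε := by
      rw [hmnu ψ hψ, ← D.mnu_sub_fun (hψ.mul (ha'.comp_continuous r.continuous))
        (hψ.mul (ha'.comp_continuous hg'))]
      have hm : Measurable fun x => ψ x * r.eval ((a : K → ℝ) x) - ψ x * deriv g ((a : K → ℝ) x) :=
        ((hψ.mul (ha'.comp_continuous r.continuous)).sub (hψ.mul (ha'.comp_continuous hg'))).1
      refine (hreg.abs_mnu_le hm (C := C * ε) (fun x => ?_) (by positivity) _ _).trans (le_of_eq ?_)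
      · rw [← mul_sub, abs_mul]
        exact mul_le_mul (hC' x) (hr _ (abs_le.1 (hM' x))).le (abs_nonneg _) hC0
      · rw [← hR]; ring
    calc _ ≤ |D.mnu ψ (D.el c) w - D.mnu ψ (D.el b) w| + |D.mnu ψ (D.el b) w
          - D.mnu (fun x => ψ x * deriv g ((a : K → ℝ) x)) (D.el a) w| := abs_sub_le _ _ _
      _ ≤ _ := by linarith
  rw [← sub_eq_zero, ← abs_eq_zero]
  refine le_antisymm (le_of_forall_pos_le_add fun δ hδ => ?_) (abs_nonneg _)
  have hpos : 0 < δ / (12 * C * R + 1) := by positivity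
  refine (key ⟨δ / (12 * C * R + 1), hpos.le⟩ hpos).trans ?_
  rw [zero_add]
  change 12 * C * R * (δ / (12 * C * R + 1)) ≤ δ
  rw [mul_div_assoc', div_le_iff₀ (by positivity)]
  nlinarith

/-- The chain rule. -/
theorem IsStrongLocal.mnu_comp (hloc : D.IsStrongLocal) (hreg : D.IsRegular) {h : D.domain}
    {ht : K → ℝ} (hqc : D.QC ht) (hm : Measurable ht) (hrep : D.Represents h ht) {g : ℝ → ℝ}
    (hg : ContDiff ℝ 1 g) (hgs : HasCompactSupport g) {c : D.bdd}
    (hc : ∀ x, (c : K → ℝ) x = g (ht x) - g 0) {ψ : K → ℝ} (hψ : BddMeas ψ) (w : D.domain) :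
    D.mnu ψ (D.el c) w = D.mnu (fun x => ψ x * deriv g (ht x)) h w := by
  obtain ⟨R, hR⟩ := hgs.isCompact.isBounded.subset_closedBall 0
  have z : ∀ t, R < |t| → g t = 0 ∧ deriv g t = 0 := by
    intro t htR
    have : t ∉ tsupport g := fun h => by
      have := hR h
      rw [mem_closedBall_zero_iff, Real.norm_eq_abs] at this
      linarith
    exact ⟨image_eq_zero_of_notMem_tsupport this,
      image_eq_zero_of_notMem_tsupport fun h => this (tsupport_deriv_subset h)⟩
  have hex : ∀ n : ℕ, ∃ a : D.bdd, (a : K → ℝ) = fun x => clamp n (ht x) := by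
    intro n
    obtain ⟨v, hv, -⟩ := hrep.exists_lipschitz (lipschitzWith_clamp n) (clamp_zero n.cast_nonneg)
    exact ⟨hv.toBdd ⟨n, Eventually.of_forall fun x => abs_clamp_le n.cast_nonneg _⟩, rfl⟩
  choose a hae using hex
  have hlim : Tendsto (fun n => D.energyOne (D.el (a n) - h)) atTop (𝓝 0) :=
    D.tendsto_clamp h fun n => (D.represents_el (a n)).congr (by
      filter_upwards [hrep] with x hx; rw [hae, hx])
  have hg' : Continuous (deriv g) := hg.continuous_deriv le_rfl
  have hb : BddMeas fun x => deriv g (ht x) := by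
    obtain ⟨B, hB⟩ := hg'.bounded_above_of_compact_support hgs.deriv
    exact ⟨hg'.measurable.comp hm, B, fun x => hB _⟩
  obtain ⟨N, hN⟩ := exists_nat_gt R
  refine tendsto_nhds_unique (tendsto_const_nhds.congr' ?_) (hreg.tendsto_mnu (hψ.mul hb) hlim w)
  filter_upwards [eventually_ge_atTop N] with n hn
  have hn' : R < n := hN.trans_le (by exact_mod_cast hn)
  -- For `n > R`, truncation at `n` moves only points outside the support, and it moves them to
  -- `±n`, also outside it.
  have hcl : ∀ t, g (clamp n t) = g t ∧ deriv g (clamp n t) = deriv g t := by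
    intro t
    rcases le_or_gt |t| n with h | h
    · rw [clamp_eq_self h]; exact ⟨rfl, rfl⟩
    · have h1 : |clamp n t| = n := by
        rcases le_total 0 t with h0 | h0
        · rw [abs_of_nonneg h0] at h
          rw [clamp, min_eq_right h.le, max_eq_right (by linarith [n.cast_nonneg (α := ℝ)]),
            Nat.abs_cast]
        · rw [abs_of_nonpos h0] at h
          rw [clamp, min_eq_left (by linarith), max_eq_left (by linarith), abs_neg, Nat.abs_cast]
      obtain ⟨e1, e2⟩ := z _ (by rw [h1]; exact hn' : R < |clamp n t|)
      obtain ⟨e3, e4⟩ := z _ (hn'.trans h : R < |t|)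
      exact ⟨e1.trans e3.symm, e2.trans e4.symm⟩
  have hq : D.QC (a n) := by rw [hae]; exact hqc.comp (continuous_clamp n)
  have hbm : BddMeas (a n : K → ℝ) := by
    rw [hae]
    exact ⟨(continuous_clamp n).measurable.comp hm, n, fun x => abs_clamp_le n.cast_nonneg _⟩
  rw [hloc.mnu_comp_bdd hreg hq hbm hg (c := c) (fun x => by rw [hc, hae, (hcl _).1]) hψ]
  simp only [hae, (hcl _).2]

end Chain

end DirichletForm

namespace DirichletForm

/-! ### Leibniz rule for products and integration by parts against harmonic functions. -/

section Product

variable {K : Type*} [TopologicalSpace K] [MeasurableSpace K] {μ : Measure K} {D : DirichletForm μ}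
  [LocallyCompactSpace K] [TopologicalSpace.MetrizableSpace K] [BorelSpace K]
  [SecondCountableTopology K]

/-- The Leibniz rule for `f² ∏ g_j(h_j)`. -/
lemma IsStrongLocal.exists_mnu_prod (hloc : D.IsStrongLocal) (hreg : D.IsRegular) {ι : Type*}
    [DecidableEq ι] {h : ι → D.domain} {ht : ι → K → ℝ} (hqc : ∀ i, D.QC (ht i))
    (hm : ∀ i, Measurable (ht i)) (hrep : ∀ i, D.Represents (h i) (ht i)) {f : D.bdd}
    (hf : D.QC f) (hf' : BddMeas (f : K → ℝ)) {g : ι → ℝ → ℝ} (hg : ∀ i, ContDiff ℝ 1 (g i))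
    (hgs : ∀ i, HasCompactSupport (g i)) (s : Finset ι) :
    ∃ A : D.bdd, (∀ x, (A : K → ℝ) x = (f : K → ℝ) x ^ 2 * ∏ j ∈ s, g j (ht j x)) ∧ D.QC A ∧
      BddMeas (A : K → ℝ) ∧ ∀ (ψ : K → ℝ) (_ : BddMeas ψ) (w : D.domain),
        D.mnu ψ (D.el A) w
          = 2 * D.mnu (fun x => ψ x * ((f : K → ℝ) x * ∏ j ∈ s, g j (ht j x))) (D.el f) w
          + ∑ k ∈ s, D.mnu (fun x => ψ x * ((f : K → ℝ) x ^ 2 *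
              (deriv (g k) (ht k x) * ∏ j ∈ s.erase k, g j (ht j x)))) (h k) w := by
  have gb : ∀ i, BddMeas fun x => g i (ht i x) := fun i => by
    obtain ⟨B, hB⟩ := (hg i).continuous.bounded_above_of_compact_support (hgs i)
    exact ⟨(hg i).continuous.measurable.comp (hm i), B, fun x => hB _⟩
  have gb' : ∀ i, BddMeas fun x => deriv (g i) (ht i x) := fun i => by
    obtain ⟨B, hB⟩ := ((hg i).continuous_deriv le_rfl).bounded_above_of_compact_support (hgs i).deriv
    exact ⟨((hg i).continuous_deriv le_rfl).measurable.comp (hm i), B, fun x => hB _⟩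
  induction s using Finset.induction_on with
  | empty =>
    refine ⟨f * f, fun x => ?_, hf.mul hf, hf'.mul hf', fun ψ hψ w => ?_⟩
    · change (f : K → ℝ) x * (f : K → ℝ) x = _
      rw [Finset.prod_empty]; ring
    · rw [hloc.mnu_mul hreg hf hf hf' hf' hψ]
      simp only [Finset.prod_empty, Finset.sum_empty, mul_one]
      ring
  | insert a s ha ih =>
    obtain ⟨A, hA, hAq, hAb, hAm⟩ := ih
    obtain ⟨L, hL⟩ := (hg a).lipschitzWith_of_hasCompactSupport (hgs a) one_ne_zero
    obtain ⟨v, hv, -⟩ := (hrep a).exists_lipschitz (Ψ := fun t => g a t - g a 0) (L := L)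
      (LipschitzWith.of_dist_le_mul fun s t => by rw [dist_sub_right]; exact hL.dist_le_mul s t)
      (sub_self _)
    obtain ⟨-, B, hB⟩ := (gb a).sub (BddMeas.const (g a 0))
    obtain ⟨c, hc⟩ : ∃ c : D.bdd, (c : K → ℝ) = fun x => g a (ht a x) - g a 0 :=
      ⟨hv.toBdd ⟨B.toNNReal, Eventually.of_forall fun x => (hB x).trans (Real.le_coe_toNNReal B)⟩,
        rfl⟩
    have hcq : D.QC c := by
      rw [hc]; exact (hqc a).comp (F := fun t => g a t - g a 0) ((hg a).continuous.sub continuous_const)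
    have hcb : BddMeas (c : K → ℝ) := by rw [hc]; exact (gb a).sub (BddMeas.const _)
    -- Constants need not lie in the domain, so the new factor `g a (ht a)` is split into `c`, which
    -- does, and the number `g a 0`.
    refine ⟨A * c + g a 0 • A, fun x => ?_, (hAq.mul hcq).add (hAq.const_smul _),
      (hAb.mul hcb).add ((BddMeas.const (g a 0)).mul hAb), fun ψ hψ w => ?_⟩
    · change (A : K → ℝ) x * (c : K → ℝ) x + g a 0 * (A : K → ℝ) x = _
      rw [hA, hc, Finset.prod_insert ha]; ring
    · have e1 : D.mnu ψ (D.el (A * c + g a 0 • A)) w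
          = D.mnu ψ (D.el (A * c)) w + g a 0 * D.mnu ψ (D.el A) w := by
        rw [map_add, map_smul]
        refine ((hreg.isQuad_integral hψ).polar_add_left _ _ _).trans ?_
        rw [(hreg.isQuad_integral hψ).polar_smul_left]
        rfl
      have e2 : D.mnu (fun x => ψ x * (c : K → ℝ) x) (D.el A) w + g a 0 * D.mnu ψ (D.el A) w
          = D.mnu (fun x => ψ x * g a (ht a x)) (D.el A) w := by
        rw [mul_comm, ← mnu_mul_const, ← D.mnu_add_fun (hψ.mul hcb) (hψ.mul (BddMeas.const _))]
        congr 1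
        funext x
        rw [hc]; ring
      rw [e1, hloc.mnu_mul hreg hAq hcq hAb hcb hψ, hloc.mnu_comp hreg (hqc a) (hm a) (hrep a)
        (hg a) (hgs a) (fun x => by rw [hc]) (hψ.mul hAb), add_assoc, e2, hAm _ (hψ.mul (gb a)),
        Finset.sum_insert ha, Finset.erase_insert ha, add_left_comm]
      congr 1
      · congr 2
        funext x
        rw [Finset.prod_insert ha]; ring
      · congr 1
        · congr 1
          funext x
          rw [hA]; ring
        · refine Finset.sum_congr rfl fun k hk => ?_
          have hka : a ≠ k := fun h => ha (h ▸ hk)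
          congr 1
          funext x
          rw [Finset.erase_insert_of_ne hka,
            Finset.prod_insert (fun h => ha (Finset.mem_of_mem_erase h))]
          ring

/-- The first variation: a quadratic polynomial in `t` that is nonnegative and has zero constant
term has zero linear term. -/
lemma IsHarmonic.form_eq_zero {S : Set K} {h : D.domain} (hh : D.IsHarmonic S h) {u : D.domain}
    (hu : ∀ t : ℝ, D.VanishesOn S (t • u)) : D.form u h = 0 := by
  have key : ∀ t : ℝ, 0 ≤ D.form u u * (t * t) + 2 * D.form u h * t + 0 := fun t => by
    have := hh _ (hu t)
    rw [form_add_add, form_smul_smul] at this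
    simp only [map_smul, smul_eq_mul, D.symm h u] at this
    linarith
  have := discrim_le_zero key
  unfold discrim at this
  nlinarith

/-- Integration by parts against harmonic functions. -/
theorem IsStrongLocal.sum_mnu_harmonic (hloc : D.IsStrongLocal) (hreg : D.IsRegular) {ι : Type*}
    [Fintype ι] [DecidableEq ι] {S : Set K} {h : ι → D.domain} (hh : ∀ i, D.IsHarmonic S (h i))
    {ht : ι → K → ℝ} (hht : ∀ i, D.IsQCModification (h i) (ht i))
    {f : D.bdd} (hf : D.QC f) (hf' : BddMeas (f : K → ℝ))
    (hfS : D.cap {x | x ∈ S ∧ (f : K → ℝ) x ≠ 0} = 0)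
    {g : ι → ℝ → ℝ} (hg : ∀ i, ContDiff ℝ 1 (g i)) (hgs : ∀ i, HasCompactSupport (g i)) (i : ι) :
    ∑ k, D.mnu (fun x => (f : K → ℝ) x ^ 2 *
        (deriv (g k) (ht k x) * ∏ j ∈ Finset.univ.erase k, g j (ht j x))) (h k) (h i)
      = -2 * D.mnu (fun x => (f : K → ℝ) x * ∏ j, g j (ht j x)) (D.el f) (h i) := by
  obtain ⟨A, hA, hAq, hAb, hAm⟩ := hloc.exists_mnu_prod hreg (fun i => (hht i).2.1.qc)
    (fun i => (hht i).1) (fun i => (hht i).2.2) hf hf' hg hgs Finset.univ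
  have h1 := hAm (fun _ => 1) (BddMeas.const 1) (h i)
  -- The factor `f²` makes `A` vanish wherever `f` does, so every multiple of `A` is an admissible
  -- variation.
  have h2 : D.form (D.el A) (h i) = 0 := by
    refine (hh i).form_eq_zero fun t => ⟨t • (A : K → ℝ), ⟨hAb.1.const_smul t,
      (hAq.const_smul t).isQuasiContinuous, (D.represents_el A).smul t⟩, ?_⟩
    refine le_antisymm (le_of_le_of_eq ?_ hfS) (zero_le)
    refine le_iInf fun U => le_iInf fun hU => le_iInf fun hsub => iInf_le_of_le U (iInf_le_of_le hU
      (iInf_le_of_le (fun x hx => hsub ⟨hx.1, fun h0 => hx.2 ?_⟩) le_rfl))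
    change t * (A : K → ℝ) x = 0
    rw [hA, h0]; ring
  rw [hloc.mnu_one hreg, h2] at h1
  simp only [one_mul] at h1
  linarith

end Product

/-! ### The Kunita-Watanabe inequality. -/

section KunitaWatanabe

variable {K : Type*} [TopologicalSpace K] [MeasurableSpace K] {μ : Measure K} {D : DirichletForm μ}
  [LocallyCompactSpace K] [TopologicalSpace.MetrizableSpace K] [BorelSpace K]
  [SecondCountableTopology K]

lemma integral_mul_simpleFunc {X : Type*} [MeasurableSpace X] {χ : X → ℝ} (hχ : BddMeas χ)
    (φ : SimpleFunc X ℝ) (F : ℝ → ℝ) (m : Measure X) [IsFiniteMeasure m] :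
    ∫ x, χ x * F (φ x) ∂m
      = ∑ y ∈ φ.range, F y * ∫ x, χ x * (φ ⁻¹' {y}).indicator (fun _ => 1) x ∂m := by
  simp only [← integral_const_mul]
  rw [← integral_finsetSum]
  · congr 1
    funext x
    rw [Finset.sum_eq_single (φ x)]
    · simp [mul_comm]
    · intro y _ hy
      rw [indicator_of_notMem (fun h => hy (by simpa using h.symm))]; ring
    · intro h; exact absurd (φ.mem_range_self x) h
  · intro y _
    refine ((hχ.mul ⟨measurable_const.indicator (φ.measurableSet_fiber y), 1, fun x => ?_⟩).integrable
      m).const_mul _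
    by_cases h : x ∈ φ ⁻¹' {y}
    · rw [indicator_of_mem h]; simp
    · rw [indicator_of_notMem h]; simp

/-- For simple `ψ`, the contribution of the level set `{ψ = y}` is the integral of `χ` over it
against `ν_{a + y b}`, hence nonnegative. General `ψ` follow by dominated convergence. -/
lemma IsRegular.mnu_quadratic_nonneg (hreg : D.IsRegular) (a b : D.domain) {χ ψ : K → ℝ}
    (hχ : BddMeas χ) (hχ0 : ∀ x, 0 ≤ χ x) (hψ : BddMeas ψ) :
    0 ≤ ∫ x, χ x ∂(D.energyMeasure a) + 2 * D.mnu (fun x => χ x * ψ x) a b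
      + ∫ x, χ x * ψ x ^ 2 ∂(D.energyMeasure b) := by
  have simple : ∀ φ : SimpleFunc K ℝ, 0 ≤ ∫ x, χ x ∂(D.energyMeasure a)
      + 2 * D.mnu (fun x => χ x * φ x) a b + ∫ x, χ x * φ x ^ 2 ∂(D.energyMeasure b) := by
    intro φ
    have e0 := integral_mul_simpleFunc hχ φ (fun _ => 1) (D.energyMeasure a)
    have e1 := fun u => integral_mul_simpleFunc hχ φ (fun y => y) (D.energyMeasure u)
    have e2 := integral_mul_simpleFunc hχ φ (fun y => y ^ 2) (D.energyMeasure b)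
    simp only [mul_one] at e0
    have hib : ∀ y, BddMeas fun x => χ x * (φ ⁻¹' {y}).indicator (fun _ => (1 : ℝ)) x := fun y => by
      refine hχ.mul ⟨measurable_const.indicator (φ.measurableSet_fiber y), 1, fun x => ?_⟩
      by_cases h : x ∈ φ ⁻¹' {y}
      · rw [indicator_of_mem h]; simp
      · rw [indicator_of_notMem h]; simp
    simp only [mnu, polarForm]
    rw [e0, e1, e1, e1, e2]
    have : ∀ S1 S2 S3 S4 S5 : ℝ, S1 + 2 * ((S2 - S3 - S4) / 2) + S5 = S1 + (S2 - S3 - S4) + S5 := by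
      intros; ring
    rw [this, ← Finset.sum_sub_distrib, ← Finset.sum_sub_distrib, ← Finset.sum_add_distrib,
      ← Finset.sum_add_distrib]
    refine Finset.sum_nonneg fun y _ => ?_
    have q := (hreg.isQuad_integral (hib y)).smul y b a
    have hpos : 0 ≤ ∫ x, χ x * (φ ⁻¹' {y}).indicator (fun _ => (1 : ℝ)) x
        ∂(D.energyMeasure (y • b + a)) :=
      integral_nonneg fun x => mul_nonneg (hχ0 x) (indicator_nonneg (fun _ _ => zero_le_one) x)
    rw [q, add_comm b a] at hpos
    linarith
  obtain ⟨hψm, C, hC⟩ := hψ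
  obtain ⟨hχm, B, hB⟩ := hχ
  have hsm : StronglyMeasurable ψ := hψm.stronglyMeasurable
  have hC0 : ∀ x, ‖ψ x‖ ≤ max C 0 := fun x => (hC x).trans (le_max_left _ _)
  have hlim : ∀ x, Tendsto (fun n => hsm.approxBounded (max C 0) n x) atTop (𝓝 (ψ x)) := fun x =>
    hsm.tendsto_approxBounded_of_norm_le (hC0 x)
  have hbd : ∀ n x, ‖hsm.approxBounded (max C 0) n x‖ ≤ max C 0 := fun n x =>
    hsm.norm_approxBounded_le (le_max_right _ _) n x
  have L1 : ∀ u, Tendsto (fun n => ∫ x, χ x * hsm.approxBounded (max C 0) n x ∂(D.energyMeasure u))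
      atTop (𝓝 (∫ x, χ x * ψ x ∂(D.energyMeasure u))) := fun u => by
    refine tendsto_integral_of_dominated_convergence (fun _ => B * max C 0)
      (fun n => (hχm.mul (SimpleFunc.measurable _)).aestronglyMeasurable) (integrable_const _)
      (fun n => Eventually.of_forall fun x => ?_) (Eventually.of_forall fun x => (hlim x).const_mul _)
    rw [norm_mul]
    exact mul_le_mul (hB x) (hbd n x) (norm_nonneg _) ((abs_nonneg _).trans (hB x))
  have L2 : Tendsto (fun n => ∫ x, χ x * hsm.approxBounded (max C 0) n x ^ 2 ∂(D.energyMeasure b))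
      atTop (𝓝 (∫ x, χ x * ψ x ^ 2 ∂(D.energyMeasure b))) := by
    refine tendsto_integral_of_dominated_convergence (fun _ => B * max C 0 ^ 2)
      (fun n => (hχm.mul ((SimpleFunc.measurable _).pow_const 2)).aestronglyMeasurable)
      (integrable_const _)
      (fun n => Eventually.of_forall fun x => ?_)
      (Eventually.of_forall fun x => ((hlim x).pow 2).const_mul _)
    rw [norm_mul, norm_pow]
    exact mul_le_mul (hB x) (pow_le_pow_left₀ (norm_nonneg _) (hbd n x) 2) (by positivity)
      ((abs_nonneg _).trans (hB x))
  have L3 : Tendsto (fun n => D.mnu (fun x => χ x * hsm.approxBounded (max C 0) n x) a b) atTop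
      (𝓝 (D.mnu (fun x => χ x * ψ x) a b)) :=
    (((L1 (a + b)).sub (L1 a)).sub (L1 b)).div_const 2
  exact ge_of_tendsto' (((L3.const_mul 2).const_add _).add L2) fun n => simple _

/-- A weighted Kunita-Watanabe inequality. -/
theorem IsRegular.mnu_mul_sq_le (hreg : D.IsRegular) (a b : D.domain) {G ψ : K → ℝ}
    (hG : BddMeas G) (hψ : BddMeas ψ) : D.mnu (fun x => ψ x * G x) a b ^ 2
      ≤ (∫ x, |G x| ∂(D.energyMeasure a)) * ∫ x, |G x| * ψ x ^ 2 ∂(D.energyMeasure b) := by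
  have hχ : BddMeas fun x => |G x| := hG.comp_continuous continuous_abs
  -- Inserting the sign of `G` turns the weight `|G|` into `G` in the mixed term and disappears from
  -- the square.
  have hσ : BddMeas fun x => if 0 ≤ G x then (1 : ℝ) else -1 :=
    ⟨Measurable.ite (measurableSet_le measurable_const hG.1) measurable_const measurable_const, 1,
      fun x => by dsimp only; split_ifs <;> simp⟩
  have key : ∀ t : ℝ, 0 ≤ (∫ x, |G x| * ψ x ^ 2 ∂(D.energyMeasure b)) * (t * t)
      + 2 * D.mnu (fun x => ψ x * G x) a b * t + ∫ x, |G x| ∂(D.energyMeasure a) := by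
    intro t
    have := hreg.mnu_quadratic_nonneg a b hχ (fun x => abs_nonneg _)
      ((hσ.mul hψ).mul (BddMeas.const t))
    have e1 : (fun x => |G x| * ((if 0 ≤ G x then (1 : ℝ) else -1) * ψ x * t))
        = fun x => (ψ x * G x) * t := by
      funext x
      split_ifs with h
      · rw [abs_of_nonneg h]; ring
      · rw [abs_of_neg (not_le.1 h)]; ring
    have e2 : (fun x => |G x| * ((if 0 ≤ G x then (1 : ℝ) else -1) * ψ x * t) ^ 2)
        = fun x => (|G x| * ψ x ^ 2) * (t * t) := by
      funext x
      split_ifs <;> ring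
    rw [e1, e2, mnu_mul_const, integral_mul_const] at this
    linarith
  have := discrim_le_zero key
  unfold discrim at this
  linarith

end KunitaWatanabe

end DirichletForm

namespace DirichletForm

/-! ### Mutual energy measures when the matrix is the identity. -/

section IdentityMatrix

variable {K : Type*} [TopologicalSpace K] [MeasurableSpace K] {μ : Measure K} {D : DirichletForm μ}

instance isFiniteMeasure_energyMeasureVec {d : ℕ} (h : Fin d → D.domain) :
    IsFiniteMeasure (D.energyMeasureVec h) := by
  unfold energyMeasureVec; infer_instance

lemma energyMeasure_eq_zero_of_vec {d : ℕ} {h : Fin d → D.domain} {B : Set K}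
    (hB : D.energyMeasureVec h B = 0) (i : Fin d) : D.energyMeasure (h i) B = 0 := by
  have hd : (d : ℝ≥0)⁻¹ ≠ 0 := by
    have : 0 < d := i.pos
    positivity
  rw [energyMeasureVec, Measure.smul_apply, ENNReal.smul_def, smul_eq_mul, mul_eq_zero] at hB
  have h1 := hB.resolve_left (by exact_mod_cast hd)
  rw [Measure.coe_finsetSum, Finset.sum_apply, Finset.sum_eq_zero_iff] at h1
  exact h1 i (Finset.mem_univ i)

lemma energyMeasureVec_absolutelyContinuous {d : ℕ} (h : Fin d → D.domain) {n : Measure K}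
    (hn : ∀ f : D.domain, D.energyMeasure f ≪ n) : D.energyMeasureVec h ≪ n := by
  intro B hB
  rw [energyMeasureVec, Measure.smul_apply, Measure.coe_finsetSum, Finset.sum_apply,
    Finset.sum_eq_zero fun i _ => hn _ hB, smul_zero]

lemma mutualEnergyMeasure_apply (u v : D.domain) {B : Set K} (hB : MeasurableSet B) :
    D.mutualEnergyMeasure u v B = polarForm (fun u => (D.energyMeasure u).real B) u v := by
  unfold mutualEnergyMeasure polarForm
  rw [_root_.smul_apply, _root_.sub_apply, _root_.sub_apply,
    Measure.toSignedMeasure_apply_measurable hB, Measure.toSignedMeasure_apply_measurable hB,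
    Measure.toSignedMeasure_apply_measurable hB, smul_eq_mul]
  ring

variable [LocallyCompactSpace K] [TopologicalSpace.MetrizableSpace K] [BorelSpace K]
  [SecondCountableTopology K]

/-- On `Z = {dν_h/dn > 0}` the hypothesis on `Phi` compares the two densities. The complement of `Z`
is null for `ν_h`, hence for `ν_{h_i}`, and the mutual measure vanishes on its Borel subsets by
Cauchy-Schwarz. -/
lemma IsRegular.mutualEnergyMeasure_eq (hreg : D.IsRegular) {n : Measure K} [SigmaFinite n]
    (hn : ∀ f : D.domain, D.energyMeasure f ≪ n) {d : ℕ} (h : Fin d → D.domain)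
    (hPhi : ∀ᵐ x ∂(D.energyMeasureVec h), D.Phi n h x = 1) (i j : Fin d) {B : Set K}
    (hB : MeasurableSet B) : D.mutualEnergyMeasure (h i) (h j) B
      = (if i = j then 1 else 0) * (D.energyMeasureVec h).real B := by
  set V := D.energyMeasureVec h with hV
  set s := D.mutualEnergyMeasure (h i) (h j) with hs
  have hVn : V ≪ n := energyMeasureVec_absolutelyContinuous h hn
  let Z : Set K := {x | 0 < (V.rnDeriv n x).toReal}
  have hZ : MeasurableSet Z :=
    measurableSet_lt measurable_const (Measure.measurable_rnDeriv V n).ennreal_toReal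
  have hsn : s ≪ᵥ n.toENNRealVectorMeasure := by
    refine VectorMeasure.AbsolutelyContinuous.mk fun A hA hA0 => ?_
    rw [Measure.toENNRealVectorMeasure_apply_measurable hA] at hA0
    rw [hs, mutualEnergyMeasure_apply _ _ hA]
    simp only [polarForm, measureReal_def, hn _ hA0]
    simp
  have hVZ : V Zᶜ = 0 := by
    rw [← Measure.withDensity_rnDeriv_eq V n hVn, withDensity_apply _ hZ.compl,
      setLIntegral_eq_zero_iff hZ.compl (Measure.measurable_rnDeriv V n)]
    filter_upwards [Measure.rnDeriv_ne_top V n] with x hx hxZ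
    simp only [Z, mem_compl_iff, mem_ofPred_eq, not_lt] at hxZ
    exact ((ENNReal.toReal_eq_zero_iff _).1 (le_antisymm hxZ ENNReal.toReal_nonneg)).resolve_right hx
  have hae : ∀ᵐ x ∂n, x ∈ Z →
      s.rnDeriv n x = (if i = j then 1 else 0) * (V.rnDeriv n x).toReal := by
    have h1 := hPhi
    rw [← Measure.withDensity_rnDeriv_eq V n hVn,
      ae_withDensity_iff (Measure.measurable_rnDeriv V n)] at h1
    filter_upwards [h1] with x hx hxZ
    have hxZ' : 0 < (V.rnDeriv n x).toReal := hxZ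
    have h2 := hx (fun h0 => by rw [h0] at hxZ'; simp at hxZ')
    have h3 := congrFun (congrFun h2 i) j
    rw [Phi, if_pos hxZ', Matrix.of_apply, Matrix.one_apply, div_eq_iff hxZ'.ne'] at h3
    exact h3
  have hsplit : s B = s (B ∩ Z) + s (B ∩ Zᶜ) := by
    rw [← VectorMeasure.of_union (disjoint_compl_right.mono inter_subset_right inter_subset_right)
      (hB.inter hZ) (hB.inter hZ.compl), inter_union_compl]
  have hzero : s (B ∩ Zᶜ) = 0 := by
    have hm := hB.inter hZ.compl
    have h0 : D.energyMeasure (h i) (B ∩ Zᶜ) = 0 :=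
      energyMeasure_eq_zero_of_vec (measure_mono_null inter_subset_right hVZ) i
    have h1 := (hreg.isQuad_energyMeasure hm).polar_sq_le (fun _ => measureReal_nonneg) (h i) (h j)
    rw [measureReal_def, h0, ENNReal.toReal_zero, zero_mul] at h1
    rw [hs, mutualEnergyMeasure_apply _ _ hm]
    exact pow_eq_zero_iff two_ne_zero |>.1 (le_antisymm h1 (sq_nonneg _))
  have hmain : s (B ∩ Z) = (if i = j then 1 else 0) * V.real (B ∩ Z) := by
    have hm := hB.inter hZ
    rw [← SignedMeasure.withDensityᵥ_rnDeriv_eq s n hsn,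
      withDensityᵥ_apply (SignedMeasure.integrable_rnDeriv s n) hm,
      ← Measure.setIntegral_toReal_rnDeriv hVn, ← integral_const_mul]
    refine setIntegral_congr_ae hm ?_
    filter_upwards [hae] with x hx hxB using hx hxB.2
  have hVB : V.real B = V.real (B ∩ Z) := by
    rw [measureReal_def, measureReal_def, ← measure_inter_add_sdiff B hZ,
      measure_mono_null (fun x hx => hx.2 : B \ Z ⊆ Zᶜ) hVZ, add_zero]
  rw [hsplit, hzero, hmain, hVB, add_zero]

lemma IsRegular.mnu_eq_of_phi (hreg : D.IsRegular) {n : Measure K} [SigmaFinite n]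
    (hn : ∀ f : D.domain, D.energyMeasure f ≪ n) {d : ℕ} (h : Fin d → D.domain)
    (hPhi : ∀ᵐ x ∂(D.energyMeasureVec h), D.Phi n h x = 1) (i j : Fin d) {ψ : K → ℝ}
    (hψ : BddMeas ψ) :
    D.mnu ψ (h i) (h j) = (if i = j then 1 else 0) * ∫ x, ψ x ∂(D.energyMeasureVec h) := by
  let m : Fin 4 → Measure K := ![D.energyMeasure (h i + h j), D.energyMeasure (h i),
    D.energyMeasure (h j), D.energyMeasureVec h]
  have : ∀ k, IsFiniteMeasure (m k) := by
    intro k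
    fin_cases k
    · exact (inferInstance : IsFiniteMeasure (D.energyMeasure _))
    · exact (inferInstance : IsFiniteMeasure (D.energyMeasure _))
    · exact (inferInstance : IsFiniteMeasure (D.energyMeasure _))
    · exact (inferInstance : IsFiniteMeasure (D.energyMeasureVec h))
  obtain ⟨hm, C, hC⟩ := hψ
  have key := sum_integral_eq_zero_of_sets m ![1 / 2, -1 / 2, -1 / 2, -(if i = j then 1 else 0)]
    (fun B hB => by
      have h1 := hreg.mutualEnergyMeasure_eq hn h hPhi i j hB
      rw [mutualEnergyMeasure_apply _ _ hB] at h1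
      unfold polarForm at h1
      simp only [m, Fin.sum_univ_succ, Matrix.cons_val_zero, Matrix.cons_val_succ,
        Fin.sum_univ_zero]
      linarith) hm hC
  simp only [m, Fin.sum_univ_succ, Matrix.cons_val_zero, Matrix.cons_val_succ,
    Fin.sum_univ_zero] at key
  unfold mnu polarForm
  linarith

end IdentityMatrix

/-! ### The derivative estimate for the push-forward measure. -/

section Pushforward

variable {K : Type*} [TopologicalSpace K] [MeasurableSpace K] {μ : Measure K} {D : DirichletForm μ}
  [LocallyCompactSpace K] [TopologicalSpace.MetrizableSpace K] [BorelSpace K]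
  [SecondCountableTopology K]

/-- The estimate on the derivatives of the push-forward measure `κ` of `f² ν_𝐡` that governs
its regularity. -/
theorem IsStrongLocal.exists_derivative_estimate (hloc : D.IsStrongLocal) (hreg : D.IsRegular)
    {n : Measure K} [SigmaFinite n] (hn : ∀ f : D.domain, D.energyMeasure f ≪ n) {S : Set K} {d : ℕ}
    {h : Fin d → D.domain} (hharm : ∀ i, D.IsHarmonic S (h i))
    (hPhi : ∀ᵐ x ∂(D.energyMeasureVec h), D.Phi n h x = 1)
    {f : D.domain} (hfb : D.IsBdd f) (hfD : D.VanishesOn S f)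
    {ht : Fin d → K → ℝ} (hht : ∀ i, D.IsQCModification (h i) (ht i))
    {ft : K → ℝ} (hft : D.IsQCModification f ft)
    {κ : Measure (EuclideanSpace ℝ (Fin d))}
    (hκ : κ = ((D.energyMeasureVec h).withDensity (fun x => ENNReal.ofReal (ft x ^ 2))).map
      (fun x => WithLp.toLp 2 (fun i => ht i x))) :
    IsFiniteMeasure κ ∧ ∃ η : Measure (EuclideanSpace ℝ (Fin d)), IsFiniteMeasure η ∧
      ∀ (i : Fin d) (g : Fin d → ℝ → ℝ), (∀ j, ContDiff ℝ 1 (g j)) →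
        (∀ j, HasCompactSupport (g j)) →
        (∫ y, deriv (g i) (y i) * ∏ j ∈ Finset.univ.erase i, g j (y j) ∂κ) ^ 2
          ≤ 4 * (∫ y, |∏ j, g j (y j)| ∂η) * ∫ y, |∏ j, g j (y j)| ∂κ := by
  set V := D.energyMeasureVec h with hV
  obtain ⟨C, hC⟩ := hfb
  obtain ⟨w, ⟨hwm, hwq, hwr⟩, hwS⟩ := hfD
  have hM0 : (0 : ℝ) ≤ max C 0 := le_max_right _ _
  -- The modification `w` that witnesses `f ∈ F_D` is truncated at the essential bound of `f`. The
  -- result is Borel, quasi-continuous, bounded everywhere, and still vanishes quasi-everywhere on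
  -- `S`.
  let f0f : K → ℝ := fun x => clamp (max C 0) (w x)
  have hrep : D.Represents f f0f := by
    have hwr' : (f : Lp ℝ 2 μ) =ᵐ[μ] w := hwr
    change (f : Lp ℝ 2 μ) =ᵐ[μ] f0f
    filter_upwards [hwr', hC] with x h1 h2
    simp only [f0f]
    rw [clamp_eq_self (by rw [← h1]; exact h2.trans (le_max_left _ _)), h1]
  obtain ⟨f0, hf0⟩ : ∃ f0 : D.bdd, (f0 : K → ℝ) = f0f :=
    ⟨hrep.toBdd ⟨⟨max C 0, hM0⟩, Eventually.of_forall fun x => abs_clamp_le hM0 _⟩, rfl⟩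
  have hel : D.el f0 = f := Represents.el_eq (hrep.congr (by rw [hf0]))
  have hf0q : D.QC f0 := by rw [hf0]; exact hwq.qc.comp (continuous_clamp _)
  have hf0b : BddMeas (f0 : K → ℝ) := by
    rw [hf0]
    exact ⟨(continuous_clamp _).measurable.comp hwm, max C 0, fun x => abs_clamp_le hM0 _⟩
  have hf0S : D.cap {x | x ∈ S ∧ (f0 : K → ℝ) x ≠ 0} = 0 := by
    refine le_antisymm (le_of_le_of_eq ?_ hwS) (zero_le)
    refine le_iInf fun U => le_iInf fun hU => le_iInf fun hsub => iInf_le_of_le U (iInf_le_of_le hU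
      (iInf_le_of_le (fun x hx => hsub ⟨hx.1, fun h0 => hx.2 ?_⟩) le_rfl))
    rw [hf0]
    simp only [f0f, h0, clamp_zero hM0]
  -- Two quasi-continuous modifications of the same element agree almost everywhere for every energy
  -- measure, so `κ` does not depend on the choice.
  have hae : ∀ᵐ x ∂V, ft x = (f0 : K → ℝ) x := by
    have hq : D.QC fun x => ft x + (-1) * (f0 : K → ℝ) x := hft.2.1.qc.add (hf0q.const_smul (-1))
    have h0 : ∀ᵐ x ∂μ, ft x + (-1) * (f0 : K → ℝ) x = 0 := by
      have e1 : (f : Lp ℝ 2 μ) =ᵐ[μ] ft := hft.2.2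
      have e2 : (f : Lp ℝ 2 μ) =ᵐ[μ] f0f := hrep
      filter_upwards [e1, e2] with x h1 h2
      rw [hf0, ← h1, ← h2]; ring
    have hz : V {x | ft x + (-1) * (f0 : K → ℝ) x ≠ 0} = 0 := by
      rw [hV, energyMeasureVec, Measure.smul_apply, Measure.coe_finsetSum, Finset.sum_apply,
        Finset.sum_eq_zero fun i _ => hreg.energyMeasure_ne_zero (h i) hq
          (hft.1.add (hf0b.1.const_mul (-1))) h0, smul_zero]
    rw [ae_iff]
    refine measure_mono_null (fun x hx => ?_) hz
    simp only [mem_ofPred_eq] at hx ⊢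
    exact fun h' => hx (by linarith)
  let H : K → EuclideanSpace ℝ (Fin d) := fun x => WithLp.toLp 2 (fun i => ht i x)
  have hH : Measurable H := (PiLp.continuous_toLp 2 _).measurable.comp
    (measurable_pi_lambda _ fun i => (hht i).1)
  have hκ' : κ = (V.withDensity (fun x => ENNReal.ofReal ((f0 : K → ℝ) x ^ 2))).map H := by
    rw [hκ]
    congr 1
    refine withDensity_congr_ae ?_
    filter_upwards [hae] with x hx
    rw [hx]
  have hint : ∀ F : EuclideanSpace ℝ (Fin d) → ℝ, Continuous F →
      ∫ y, F y ∂κ = ∫ x, (f0 : K → ℝ) x ^ 2 * F (H x) ∂V := by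
    intro F hF
    rw [hκ', integral_map hH.aemeasurable hF.aestronglyMeasurable,
      integral_withDensity_eq_integral_toReal_smul (hf0b.1.pow_const 2).ennreal_ofReal
        (Eventually.of_forall fun x => ENNReal.ofReal_lt_top)]
    refine integral_congr_ae (Eventually.of_forall fun x => ?_)
    simp only [smul_eq_mul, ENNReal.toReal_ofReal (sq_nonneg _)]
  have hfin : IsFiniteMeasure κ := by
    rw [hκ']
    have : IsFiniteMeasure (V.withDensity (fun x => ENNReal.ofReal ((f0 : K → ℝ) x ^ 2))) :=
      isFiniteMeasure_withDensity_ofReal ((hf0b.pow 2).integrable V).2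
    infer_instance
  refine ⟨hfin, (D.energyMeasure f).map H, inferInstance, fun i g hg hgs => ?_⟩
  have hgb : ∀ j, BddMeas fun x => g j (ht j x) := fun j => by
    obtain ⟨B, hB⟩ := (hg j).continuous.bounded_above_of_compact_support (hgs j)
    exact ⟨(hg j).continuous.measurable.comp (hht j).1, B, fun x => hB _⟩
  have hgb' : ∀ j, BddMeas fun x => deriv (g j) (ht j x) := fun j => by
    obtain ⟨B, hB⟩ := ((hg j).continuous_deriv le_rfl).bounded_above_of_compact_support (hgs j).deriv
    exact ⟨((hg j).continuous_deriv le_rfl).measurable.comp (hht j).1, B, fun x => hB _⟩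
  have ibp := hloc.sum_mnu_harmonic hreg hharm hht hf0q hf0b hf0S hg hgs i
  have hterm : ∀ k, BddMeas fun x => (f0 : K → ℝ) x ^ 2 *
      (deriv (g k) (ht k x) * ∏ j ∈ Finset.univ.erase k, g j (ht j x)) := fun k =>
    (hf0b.pow 2).mul ((hgb' k).mul (BddMeas.prod _ fun j _ => hgb j))
  -- Since the mutual measure of `h k` and `h i` is zero for `k ≠ i`, only the derivative in
  -- direction `i` survives the sum.
  simp only [hreg.mnu_eq_of_phi hn h hPhi _ i (hterm _), ite_mul, one_mul, zero_mul,
    Finset.sum_ite_eq', Finset.mem_univ, if_true, hel] at ibp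
  have hcont : ∀ s : Finset (Fin d),
      Continuous fun y : EuclideanSpace ℝ (Fin d) => ∏ j ∈ s, g j (y j) := fun s =>
    continuous_finsetProd s fun j _ => (hg j).continuous.comp (PiLp.continuous_apply 2 _ j)
  have hcont' : Continuous fun y : EuclideanSpace ℝ (Fin d) => deriv (g i) (y i) :=
    ((hg i).continuous_deriv le_rfl).comp (PiLp.continuous_apply 2 _ i)
  rw [hint (fun y => deriv (g i) (y i) * ∏ j ∈ Finset.univ.erase i, g j (y j))
    (hcont'.mul (hcont _)), hint _ (hcont _).abs,
    integral_map hH.aemeasurable (hcont _).abs.aestronglyMeasurable]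
  have kw := hreg.mnu_mul_sq_le f (h i) (BddMeas.prod Finset.univ fun j _ => hgb j) hf0b
  have hGb : BddMeas fun x => |∏ j, g j (ht j x)| * (f0 : K → ℝ) x ^ 2 :=
    ((BddMeas.prod Finset.univ fun j _ => hgb j).comp_continuous continuous_abs).mul (hf0b.pow 2)
  -- The diagonal case says that `ν_{h_i} = ν_h`, which turns the second factor of the
  -- Kunita-Watanabe inequality into an integral against `κ`.
  have e1 := hreg.mnu_eq_of_phi hn h hPhi i i hGb
  rw [hreg.mnu_self hGb, if_pos rfl, one_mul] at e1
  rw [e1] at kw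
  have ibp' : ∫ x, (f0 : K → ℝ) x ^ 2 * (deriv (g i) (H x i)
      * ∏ j ∈ Finset.univ.erase i, g j (H x j)) ∂V
      = -2 * D.mnu (fun x => (f0 : K → ℝ) x * ∏ j, g j (ht j x)) f (h i) := ibp
  rw [ibp']
  have e2 : ∫ x, (f0 : K → ℝ) x ^ 2 * |∏ j, g j (H x j)| ∂V
      = ∫ x, |∏ j, g j (ht j x)| * (f0 : K → ℝ) x ^ 2 ∂V :=
    integral_congr_ae (Eventually.of_forall fun x => mul_comm _ _)
  rw [e2, mul_pow, mul_assoc]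
  have e3 : ∫ x, |∏ j, g j (H x j)| ∂(D.energyMeasure f)
      = ∫ x, |∏ j, g j (ht j x)| ∂(D.energyMeasure f) := rfl
  rw [e3]
  norm_num
  exact kw

end Pushforward

end DirichletForm

set_option linter.unusedVariables false

/-! ### Cauchy-Schwarz and Riesz duality. -/

/-- The Cauchy-Schwarz inequality for integrals. -/
lemma integral_mul_sq_le {X : Type*} [MeasurableSpace X] {m : Measure X} {f g : X → ℝ}
    (hf : MemLp f 2 m) (hg : MemLp g 2 m) :
    (∫ x, f x * g x ∂m) ^ 2 ≤ (∫ x, f x ^ 2 ∂m) * ∫ x, g x ^ 2 ∂m := by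
  have key : ∀ t : ℝ, 0 ≤ (∫ x, f x ^ 2 ∂m) * (t * t) + 2 * (∫ x, f x * g x ∂m) * t
      + ∫ x, g x ^ 2 ∂m := by
    intro t
    have h0 : 0 ≤ ∫ x, (t * f x + g x) ^ 2 ∂m := integral_nonneg fun x => sq_nonneg _
    have e : ∀ x, (t * f x + g x) ^ 2 = (t * t) * f x ^ 2 + (2 * t) * (f x * g x) + g x ^ 2 :=
      fun x => by ring
    have hfg : Integrable (fun x => f x * g x) m := hf.integrable_mul hg
    have e1 : ∫ x, (t * f x + g x) ^ 2 ∂m = ∫ x, ((t * t) * f x ^ 2 + (2 * t) * (f x * g x)) ∂m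
        + ∫ x, g x ^ 2 ∂m := by
      simp only [e]
      exact integral_add ((hf.integrable_sq.const_mul _).add (hfg.const_mul _)) hg.integrable_sq
    rw [e1, integral_add (hf.integrable_sq.const_mul _) (hfg.const_mul _), integral_const_mul,
      integral_const_mul] at h0
    linarith
  have := discrim_le_zero key
  unfold discrim at this
  linarith

/-- A linear functional that is bounded for the norm induced by a linear map into a Hilbert space
is represented by a vector of that space. -/
lemma exists_inner_eq_of_bounded {T H : Type*} [AddCommGroup T] [Module ℝ T]
    [NormedAddCommGroup H] [InnerProductSpace ℝ H] [CompleteSpace H] (ι : T →ₗ[ℝ] H)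
    (Λ : T →ₗ[ℝ] ℝ) {C : ℝ} (hΛ : ∀ φ, |Λ φ| ≤ C * ‖ι φ‖) : ∃ g : H, ∀ φ, Λ φ = inner ℝ g (ι φ) := by
  have hker : LinearMap.ker ι ≤ LinearMap.ker Λ := fun φ hφ => by
    have := hΛ φ
    rw [LinearMap.mem_ker.1 hφ, norm_zero, mul_zero] at this
    exact abs_eq_zero.1 (le_antisymm this (abs_nonneg _))
  let l : LinearMap.range ι →ₗ[ℝ] ℝ :=
    ((LinearMap.ker ι).liftQ Λ hker) ∘ₗ ι.quotKerEquivRange.symm.toLinearMap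
  have hl : ∀ φ, l ⟨ι φ, LinearMap.mem_range_self ι φ⟩ = Λ φ := fun φ => by
    have : ι.quotKerEquivRange.symm ⟨ι φ, LinearMap.mem_range_self ι φ⟩
        = (LinearMap.ker ι).mkQ φ := by
      rw [LinearEquiv.symm_apply_eq]; rfl
    change (LinearMap.ker ι).liftQ Λ hker (ι.quotKerEquivRange.symm _) = _
    rw [this]; rfl
  let L : LinearMap.range ι →L[ℝ] ℝ := l.mkContinuous C (by
    rintro ⟨_, φ, rfl⟩
    have := hΛ φ
    rw [← hl] at this
    exact this)
  obtain ⟨G, hG, -⟩ := exists_extension_norm_eq _ L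
  refine ⟨(InnerProductSpace.toDual ℝ H).symm G, fun φ => ?_⟩
  rw [InnerProductSpace.toDual_symm_apply]
  have := hG ⟨ι φ, LinearMap.mem_range_self ι φ⟩
  rw [this, ← hl]; rfl

/-! ### Tensor products and convolutions with finite measures. -/

section Tensor

variable {ι : Type*} [Fintype ι]

/-- The tensor product of functions of one variable. -/
def tensor (g : ι → ℝ → ℝ) (x : EuclideanSpace ℝ ι) : ℝ := ∏ j, g j (x j)

/-- Convolution of a measure with a function. -/
def mconv (m : Measure (EuclideanSpace ℝ ι)) (G : EuclideanSpace ℝ ι → ℝ)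
    (x : EuclideanSpace ℝ ι) : ℝ := ∫ y, G (x - y) ∂m

lemma tensor_update [DecidableEq ι] (g : ι → ℝ → ℝ) (i : ι) (a : ℝ → ℝ)
    (x : EuclideanSpace ℝ ι) :
    tensor (Function.update g i a) x = a (x i) * ∏ j ∈ Finset.univ.erase i, g j (x j) := by
  unfold tensor
  rw [← Finset.mul_prod_erase _ _ (Finset.mem_univ i), Function.update_self]
  congr 1
  refine Finset.prod_congr rfl fun j hj => ?_
  rw [Function.update_of_ne (Finset.ne_of_mem_erase hj)]

lemma tensor_eq_mul [DecidableEq ι] (g : ι → ℝ → ℝ) (i : ι) (x : EuclideanSpace ℝ ι) :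
    tensor g x = g i (x i) * ∏ j ∈ Finset.univ.erase i, g j (x j) := by
  rw [← tensor_update, Function.update_eq_self]

lemma continuous_tensor {g : ι → ℝ → ℝ} (hg : ∀ j, Continuous (g j)) : Continuous (tensor g) :=
  continuous_finsetProd _ fun j _ => (hg j).comp (PiLp.continuous_apply 2 _ j)

lemma hasCompactSupport_tensor {g : ι → ℝ → ℝ} (hg : ∀ j, HasCompactSupport (g j)) :
    HasCompactSupport (tensor g) := by
  have hK : IsCompact ((WithLp.toLp 2) '' (Set.pi univ fun j => tsupport (g j)) :
      Set (EuclideanSpace ℝ ι)) :=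
    (isCompact_univ_pi fun j => (hg j).isCompact).image (PiLp.continuous_toLp 2 _)
  refine HasCompactSupport.intro hK fun x hx => ?_
  by_contra h0
  refine hx ⟨fun j => x j, fun j _ => subset_tsupport _ fun h => h0 ?_, rfl⟩
  exact Finset.prod_eq_zero (Finset.mem_univ j) h

lemma exists_bound_tensor {g : ι → ℝ → ℝ} (hg : ∀ j, Continuous (g j))
    (hgs : ∀ j, HasCompactSupport (g j)) : ∃ C, ∀ x, |tensor g x| ≤ C :=
  (continuous_tensor hg).bounded_above_of_compact_support (hasCompactSupport_tensor hgs)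

lemma integrable_tensor {g : ι → ℝ → ℝ} (hg : ∀ j, Continuous (g j))
    (hgs : ∀ j, HasCompactSupport (g j)) : Integrable (tensor g) :=
  (continuous_tensor hg).integrable_of_hasCompactSupport (hasCompactSupport_tensor hgs)

lemma integral_tensor (g : ι → ℝ → ℝ) : ∫ x, tensor g x = ∏ j, ∫ t, g j t := by
  rw [← integral_fintype_prod_volume_eq_prod,
    ← (PiLp.volume_preserving_toLp ι).integral_comp
      (MeasurableEquiv.toLp 2 (ι → ℝ)).measurableEmbedding]
  rfl

variable (m : Measure (EuclideanSpace ℝ ι)) [IsFiniteMeasure m]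

lemma mconv_eq_convolution (G : EuclideanSpace ℝ ι → ℝ) :
    mconv m G = MeasureTheory.convolution (fun _ => (1 : ℝ)) G (ContinuousLinearMap.mul ℝ ℝ) m := by
  funext x
  simp [mconv, MeasureTheory.convolution]

lemma integrable_mconv_integrand {G : EuclideanSpace ℝ ι → ℝ} (hG : Integrable G) :
    Integrable (fun p : EuclideanSpace ℝ ι × EuclideanSpace ℝ ι => G (p.1 - p.2))
      (volume.prod m) := by
  have := (integrable_const (μ := m) (1 : ℝ)).convolution_integrand (ContinuousLinearMap.mul ℝ ℝ) hG
  simpa using this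

lemma integrable_mconv {G : EuclideanSpace ℝ ι → ℝ} (hG : Integrable G) :
    Integrable (mconv m G) := (integrable_mconv_integrand m hG).integral_prod_left

lemma integral_mconv {G : EuclideanSpace ℝ ι → ℝ} (hG : Integrable G) :
    ∫ x, mconv m G x = m.real univ * ∫ x, G x := by
  rw [mconv_eq_convolution, integral_convolution _ (integrable_const _) hG]
  simp

lemma continuous_mconv {G : EuclideanSpace ℝ ι → ℝ} (hG : Continuous G) {C : ℝ}
    (hC : ∀ x, |G x| ≤ C) : Continuous (mconv m G) :=
  continuous_of_dominated (bound := fun _ => C)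
    (fun x => (hG.comp (continuous_const.sub continuous_id)).aestronglyMeasurable)
    (fun x => Eventually.of_forall fun y => hC _) (integrable_const _)
    (Eventually.of_forall fun y => hG.comp (continuous_id.sub continuous_const))

lemma integrable_sub_of_bound {G : EuclideanSpace ℝ ι → ℝ} (hG : Continuous G) {C : ℝ}
    (hC : ∀ x, |G x| ≤ C) (x : EuclideanSpace ℝ ι) : Integrable (fun y => G (x - y)) m :=
  Integrable.of_bound (hG.comp (continuous_const.sub continuous_id)).aestronglyMeasurable C
    (Eventually.of_forall fun y => hC _)

lemma mconv_nonneg {G : EuclideanSpace ℝ ι → ℝ} (hG : ∀ x, 0 ≤ G x) (x : EuclideanSpace ℝ ι) :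
    0 ≤ mconv m G x := integral_nonneg fun _ => hG _

lemma hasDerivAt_tensor_line [DecidableEq ι] {g : ι → ℝ → ℝ} (hg : ∀ j, ContDiff ℝ 1 (g j))
    (i : ι) (z : EuclideanSpace ℝ ι) (t : ℝ) :
    HasDerivAt (fun s : ℝ => tensor g (z + s • EuclideanSpace.single i 1))
      (tensor (Function.update g i (deriv (g i))) (z + t • EuclideanSpace.single i 1)) t := by
  have e1 : ∀ s : ℝ, ∀ j ∈ Finset.univ.erase i,
      (z + s • EuclideanSpace.single i (1 : ℝ)) j = z j := fun s j hj => by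
    simp [Finset.ne_of_mem_erase hj]
  have e2 : ∀ s : ℝ, (z + s • EuclideanSpace.single i (1 : ℝ)) i = z i + s := fun s => by simp
  have e3 : ∀ s : ℝ, ∏ j ∈ Finset.univ.erase i, g j ((z + s • EuclideanSpace.single i (1 : ℝ)) j)
      = ∏ j ∈ Finset.univ.erase i, g j (z j) := fun s =>
    Finset.prod_congr rfl fun j hj => by rw [e1 s j hj]
  have e : (fun s : ℝ => tensor g (z + s • EuclideanSpace.single i 1))
      = fun s => g i (z i + s) * ∏ j ∈ Finset.univ.erase i, g j (z j) := by
    funext s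
    rw [tensor_eq_mul g i, e2, e3]
  rw [e, tensor_update, e2, e3]
  refine HasDerivAt.mul_const ?_ _
  have h1 : HasDerivAt (fun s : ℝ => z i + s) 1 t := (hasDerivAt_id t).const_add _
  have h2 := ((hg i).differentiable one_ne_zero (z i + t)).hasDerivAt.comp t h1
  rwa [mul_one] at h2

lemma continuous_update_deriv [DecidableEq ι] {g : ι → ℝ → ℝ} (hg : ∀ j, ContDiff ℝ 1 (g j))
    (i j : ι) : Continuous (Function.update g i (deriv (g i)) j) := by
  by_cases h : j = i
  · subst h; rw [Function.update_self]; exact (hg j).continuous_deriv le_rfl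
  · rw [Function.update_of_ne h]; exact (hg j).continuous

lemma hasCompactSupport_update [DecidableEq ι] {g : ι → ℝ → ℝ}
    (hg : ∀ j, HasCompactSupport (g j)) (i : ι) {a : ℝ → ℝ} (ha : HasCompactSupport a) (j : ι) :
    HasCompactSupport (Function.update g i a j) := by
  by_cases h : j = i
  · subst h; rwa [Function.update_self]
  · rw [Function.update_of_ne h]; exact hg j

/-- The partial derivatives of the convolution with a tensor product. -/
lemma hasLineDerivAt_mconv_tensor [DecidableEq ι] {g : ι → ℝ → ℝ} (hg : ∀ j, ContDiff ℝ 1 (g j))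
    (hgs : ∀ j, HasCompactSupport (g j)) (i : ι) (x : EuclideanSpace ℝ ι) :
    HasLineDerivAt ℝ (mconv m (tensor g))
      (mconv m (tensor (Function.update g i (deriv (g i)))) x) x (EuclideanSpace.single i 1) := by
  have hc := continuous_update_deriv hg i
  obtain ⟨C, hC⟩ := exists_bound_tensor hc (hasCompactSupport_update hgs i (hgs i).deriv)
  obtain ⟨C', hC'⟩ := exists_bound_tensor (fun j => (hg j).continuous) hgs
  have hT := continuous_tensor (fun j => (hg j).continuous)
  have hT' := continuous_tensor hc
  have hd : ∀ (y : EuclideanSpace ℝ ι) (t : ℝ),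
      HasDerivAt (fun s : ℝ => tensor g (x + s • EuclideanSpace.single i 1 - y))
        (tensor (Function.update g i (deriv (g i))) (x + t • EuclideanSpace.single i 1 - y)) t := by
    intro y t
    have h := hasDerivAt_tensor_line hg i (x - y) t
    simp only [sub_add_eq_add_sub] at h
    exact h
  generalize tensor (Function.update g i (deriv (g i))) = T' at *
  generalize tensor g = T at *
  unfold HasLineDerivAt
  have hm : ∀ F : EuclideanSpace ℝ ι → ℝ, Continuous F → ∀ z : EuclideanSpace ℝ ι,
      AEStronglyMeasurable (fun y => F (z - y)) m := fun F hF z =>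
    (hF.comp (continuous_const.sub continuous_id)).aestronglyMeasurable
  have key := hasDerivAt_integral_of_dominated_loc_of_deriv_le (μ := m) (x₀ := (0 : ℝ))
    (s := univ) (bound := fun _ => C)
    (F := fun t y => T (x + t • EuclideanSpace.single i 1 - y))
    (F' := fun t y => T' (x + t • EuclideanSpace.single i 1 - y)) univ_mem
    (Eventually.of_forall fun t => hm T hT _)
    (integrable_sub_of_bound m hT hC' _)
    (hm T' hT' _)
    (Eventually.of_forall fun y t _ => hC _) (integrable_const _)
    (Eventually.of_forall fun y t _ => hd y t)
  have h2 := key.2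
  simp only [zero_smul, add_zero] at h2
  exact h2

end Tensor

/-! ### One-dimensional mollifiers. -/

section Bump

/-- A smooth probability density supported in `[-1 / (n + 1), 1 / (n + 1)]`. -/
def bump (n : ℕ) : ℝ → ℝ :=
  (⟨1 / ((n : ℝ) + 1) / 2, 1 / ((n : ℝ) + 1), by positivity, half_lt_self (by positivity)⟩ :
    ContDiffBump (0 : ℝ)).normed volume

lemma contDiff_bump (n : ℕ) : ContDiff ℝ 1 (bump n) :=
  ContDiffBump.contDiff_normed (n := 1) _

lemma continuous_bump (n : ℕ) : Continuous (bump n) := (contDiff_bump n).continuous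

lemma hasCompactSupport_bump (n : ℕ) : HasCompactSupport (bump n) :=
  ContDiffBump.hasCompactSupport_normed _

lemma bump_nonneg (n : ℕ) (t : ℝ) : 0 ≤ bump n t := ContDiffBump.nonneg_normed _ t

lemma integral_bump (n : ℕ) : ∫ t, bump n t = 1 := ContDiffBump.integral_normed _

lemma integrable_bump (n : ℕ) : Integrable (bump n) := ContDiffBump.integrable_normed _

lemma bump_neg (n : ℕ) (t : ℝ) : bump n (-t) = bump n t := ContDiffBump.normed_neg _ t

lemma support_bump (n : ℕ) : Function.support (bump n) = Metric.ball 0 (1 / ((n : ℝ) + 1)) :=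
  ContDiffBump.support_normed_eq _

lemma one_div_succ_le_one (n : ℕ) : 1 / ((n : ℝ) + 1) ≤ 1 := by
  rw [div_le_one (by positivity)]
  linarith [n.cast_nonneg (α := ℝ)]

lemma bump_eq_zero {n : ℕ} {t : ℝ} (h : 1 / ((n : ℝ) + 1) ≤ |t|) : bump n t = 0 := by
  by_contra h0
  have : t ∈ Function.support (bump n) := h0
  rw [support_bump, mem_ball_zero_iff, Real.norm_eq_abs] at this
  linarith

/-- The distribution function of `bump n`. -/
def bumpCdf (n : ℕ) (t : ℝ) : ℝ := ∫ s in (-1)..t, bump n s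

lemma hasDerivAt_bumpCdf (n : ℕ) (t : ℝ) : HasDerivAt (bumpCdf n) (bump n t) t :=
  intervalIntegral.integral_hasDerivAt_right ((continuous_bump n).intervalIntegrable _ _)
    ((continuous_bump n).stronglyMeasurableAtFilter _ _) (continuous_bump n).continuousAt

lemma bumpCdf_of_le {n : ℕ} {t : ℝ} (h : t ≤ -(1 / ((n : ℝ) + 1))) : bumpCdf n t = 0 := by
  refine intervalIntegral.integral_zero_ae (Eventually.of_forall fun s hs => bump_eq_zero ?_)
  have h1 := one_div_succ_le_one n
  have h2 : s ≤ -(1 / ((n : ℝ) + 1)) := by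
    rcases mem_uIoc.1 hs with h3 | h3
    · exact h3.2.trans h
    · exact h3.2.trans (by linarith)
  rw [abs_of_nonpos (h2.trans (by simp; positivity))]
  linarith

lemma bumpCdf_of_ge {n : ℕ} {t : ℝ} (h : 1 / ((n : ℝ) + 1) ≤ t) : bumpCdf n t = 1 := by
  rw [bumpCdf, intervalIntegral.integral_eq_integral_of_support_subset, integral_bump]
  intro s hs
  rw [support_bump, mem_ball_zero_iff, Real.norm_eq_abs, abs_lt] at hs
  have h1 := one_div_succ_le_one n
  exact ⟨by linarith [hs.1], by linarith [hs.2]⟩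

lemma bumpCdf_mem (n : ℕ) (t : ℝ) : bumpCdf n t ∈ Icc (0 : ℝ) 1 := by
  rcases le_total t (-1) with h | h
  · rw [bumpCdf_of_le (h.trans (by linarith [one_div_succ_le_one n]))]; simp
  · refine ⟨intervalIntegral.integral_nonneg h fun s _ => bump_nonneg n s, ?_⟩
    rw [bumpCdf, intervalIntegral.integral_of_le h, ← integral_bump n]
    exact setIntegral_le_integral (integrable_bump n) (Eventually.of_forall (bump_nonneg n))

/-- The difference of two mollifiers is the derivative of a small function. -/
lemma exists_primitive_bump_sub (n m : ℕ) : ∃ τ : ℝ → ℝ, ContDiff ℝ 1 τ ∧ HasCompactSupport τ ∧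
    (deriv τ = fun t => bump n t - bump m t) ∧
    ∫ t, |τ t| ≤ 2 * (1 / ((n : ℝ) + 1) + 1 / ((m : ℝ) + 1)) := by
  -- Both distribution functions are `0` to the left of `-R` and `1` to the right of `R`, so `τ` is
  -- supported in `[-R, R]`; moreover `|τ| ≤ 1`.
  let τ : ℝ → ℝ := fun t => bumpCdf n t - bumpCdf m t
  let R : ℝ := 1 / ((n : ℝ) + 1) + 1 / ((m : ℝ) + 1)
  have hn : (0 : ℝ) < 1 / ((n : ℝ) + 1) := by positivity
  have hm : (0 : ℝ) < 1 / ((m : ℝ) + 1) := by positivity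
  have hd : ∀ t, HasDerivAt τ (bump n t - bump m t) t := fun t =>
    (hasDerivAt_bumpCdf n t).sub (hasDerivAt_bumpCdf m t)
  have hd' : deriv τ = fun t => bump n t - bump m t := funext fun t => (hd t).deriv
  have h0 : ∀ t, t ∉ Icc (-R) R → τ t = 0 := by
    intro t ht
    rw [mem_Icc, not_and_or, not_le, not_le] at ht
    rcases ht with h | h
    · simp only [τ]
      rw [bumpCdf_of_le (by simp only [R] at h; linarith),
        bumpCdf_of_le (by simp only [R] at h; linarith), sub_zero]
    · simp only [τ]
      rw [bumpCdf_of_ge (by simp only [R] at h; linarith),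
        bumpCdf_of_ge (by simp only [R] at h; linarith), sub_self]
  have h1 : ∀ t, |τ t| ≤ 1 := fun t => by
    obtain ⟨a, b⟩ := bumpCdf_mem n t
    obtain ⟨c, d⟩ := bumpCdf_mem m t
    exact abs_le.2 ⟨by simp only [τ]; linarith, by simp only [τ]; linarith⟩
  have hc : Continuous τ := continuous_iff_continuousAt.2 fun t => (hd t).continuousAt
  have hs : HasCompactSupport τ := HasCompactSupport.intro isCompact_Icc h0
  refine ⟨τ, ?_, hs, hd', ?_⟩
  · rw [contDiff_one_iff_deriv]
    exact ⟨fun t => (hd t).differentiableAt,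
      by rw [hd']; exact (continuous_bump n).sub (continuous_bump m)⟩
  · calc ∫ t, |τ t| ≤ ∫ t, (Icc (-R) R).indicator (fun _ => (1 : ℝ)) t := by
          refine integral_mono (hc.abs.integrable_of_hasCompactSupport (hs.comp_left abs_zero))
            ((integrable_indicator_iff measurableSet_Icc).2 (integrableOn_const (by simp)))
            fun t => ?_
          by_cases ht : t ∈ Icc (-R) R
          · rw [indicator_of_mem ht]; exact h1 t
          · rw [indicator_of_notMem ht, h0 t ht, abs_zero]
      _ = 2 * R := by
          rw [integral_indicator_const _ measurableSet_Icc, Real.volume_real_Icc_of_le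
            (by simp only [R]; linarith), smul_eq_mul, mul_one]
          ring

end Bump

lemma integral_abs_sub_le_add {X : Type*} [MeasurableSpace X] {m : Measure X} {a b c : X → ℝ}
    (ha : Integrable a m) (hb : Integrable b m) (hc : Integrable c m) :
    ∫ x, |a x - c x| ∂m ≤ (∫ x, |a x - b x| ∂m) + ∫ x, |b x - c x| ∂m := by
  have h1 : Integrable (fun x => |a x - b x|) m := (ha.sub hb).abs
  have h2 : Integrable (fun x => |b x - c x|) m := (hb.sub hc).abs
  rw [← integral_add h1 h2]
  exact integral_mono (ha.sub hc).abs (h1.add h2) fun x => abs_sub_le _ _ _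

/-! ### The derivative estimate for mollified measures. -/

section Estimate

variable {d : ℕ}

/-- The derivatives of `κ` are controlled by `κ` and `η`. -/
def DerivativeEstimate (κ η : Measure (EuclideanSpace ℝ (Fin d))) : Prop :=
  ∀ (i : Fin d) (g : Fin d → ℝ → ℝ), (∀ j, ContDiff ℝ 1 (g j)) → (∀ j, HasCompactSupport (g j)) →
    (∫ y, deriv (g i) (y i) * ∏ j ∈ Finset.univ.erase i, g j (y j) ∂κ) ^ 2
      ≤ 4 * (∫ y, |∏ j, g j (y j)| ∂η) * ∫ y, |∏ j, g j (y j)| ∂κ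

variable {κ η : Measure (EuclideanSpace ℝ (Fin d))} [IsFiniteMeasure κ] [IsFiniteMeasure η]

/-- The estimate is applied to the reflected translate `y ↦ G(x - y)`, again a tensor product; the
sign produced by the reflection disappears in the square. -/
lemma DerivativeEstimate.mconv_sq_le (hE : DerivativeEstimate κ η) (i : Fin d)
    {g : Fin d → ℝ → ℝ} (hg : ∀ j, ContDiff ℝ 1 (g j)) (hgs : ∀ j, HasCompactSupport (g j))
    (x : EuclideanSpace ℝ (Fin d)) :
    mconv κ (tensor (Function.update g i (deriv (g i)))) x ^ 2
      ≤ 4 * mconv η (tensor fun j t => |g j t|) x * mconv κ (tensor fun j t => |g j t|) x := by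
  have h := hE i (fun j t => g j (x j - t)) (fun j => (hg j).comp (contDiff_const.sub contDiff_id))
    (fun j => (hgs j).comp_homeomorph (Homeomorph.subLeft (x j)))
  have e1 : ∀ y : EuclideanSpace ℝ (Fin d), deriv (fun t => g i (x i - t)) (y i)
      * ∏ j ∈ Finset.univ.erase i, g j (x j - y j)
      = -tensor (Function.update g i (deriv (g i))) (x - y) := fun y => by
    rw [tensor_update, deriv_comp_const_sub, neg_mul]
    rfl
  have e2 : ∀ y : EuclideanSpace ℝ (Fin d), |∏ j, g j (x j - y j)|
      = tensor (fun j t => |g j t|) (x - y) := fun y => Finset.abs_prod _ _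
  simp only [e1, e2, integral_neg, neg_sq] at h
  exact h

lemma hasCompactSupport_abs {g : ℝ → ℝ} (hg : HasCompactSupport g) :
    HasCompactSupport fun t => |g t| := hg.comp_left abs_zero

/-- The bound `4ab ≤ (a + b)²` removes the square root, after which integration only sees the total
masses and the product of the one-dimensional integrals. -/
lemma DerivativeEstimate.integral_abs_le (hE : DerivativeEstimate κ η) (i : Fin d)
    {g : Fin d → ℝ → ℝ} (hg : ∀ j, ContDiff ℝ 1 (g j)) (hgs : ∀ j, HasCompactSupport (g j)) :
    ∫ x, |mconv κ (tensor (Function.update g i (deriv (g i)))) x|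
      ≤ (η.real univ + κ.real univ) * ∏ j, ∫ t, |g j t| := by
  have hi : Integrable (tensor fun j t => |g j t|) :=
    integrable_tensor (fun j => (hg j).continuous.abs) fun j => hasCompactSupport_abs (hgs j)
  have h0 : ∀ x, 0 ≤ tensor (fun j t => |g j t|) x := fun x =>
    Finset.prod_nonneg fun j _ => abs_nonneg _
  have h1 : Integrable (tensor (Function.update g i (deriv (g i)))) :=
    integrable_tensor (continuous_update_deriv hg i) (hasCompactSupport_update hgs i (hgs i).deriv)
  calc _ ≤ ∫ x, (mconv η (tensor fun j t => |g j t|) x + mconv κ (tensor fun j t => |g j t|) x) := by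
        refine integral_mono (integrable_mconv κ h1).abs
          ((integrable_mconv η hi).add (integrable_mconv κ hi)) fun x => ?_
        have h2 := hE.mconv_sq_le i hg hgs x
        have h3 := mconv_nonneg η h0 x
        have h4 := mconv_nonneg κ h0 x
        refine abs_le_of_sq_le_sq (h2.trans ?_) (add_nonneg h3 h4)
        nlinarith [sq_nonneg (mconv η (tensor fun j t => |g j t|) x
          - mconv κ (tensor fun j t => |g j t|) x)]
    _ = _ := by
        rw [integral_add (integrable_mconv η hi) (integrable_mconv κ hi), integral_mconv η hi,
          integral_mconv κ hi, integral_tensor]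
        ring

/-- The product mollifier. -/
def kernelT (d n : ℕ) : EuclideanSpace ℝ (Fin d) → ℝ := tensor fun _ => bump n

lemma continuous_kernelT (d n : ℕ) : Continuous (kernelT d n) :=
  continuous_tensor fun _ => continuous_bump n

lemma integrable_kernelT (d n : ℕ) : Integrable (kernelT d n) :=
  integrable_tensor (fun _ => continuous_bump n) fun _ => hasCompactSupport_bump n

lemma kernelT_nonneg (d n : ℕ) (x : EuclideanSpace ℝ (Fin d)) : 0 ≤ kernelT d n x := by
  unfold kernelT tensor
  exact Finset.prod_nonneg fun _ _ => bump_nonneg n _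

lemma integral_kernelT (d n : ℕ) : ∫ x, kernelT d n x = 1 := by
  unfold kernelT
  rw [integral_tensor, Finset.prod_congr rfl fun j _ => integral_bump n, Finset.prod_const_one]

lemma mconv_sub {m : Measure (EuclideanSpace ℝ (Fin d))} [IsFiniteMeasure m]
    {F G : EuclideanSpace ℝ (Fin d) → ℝ} (hF : Continuous F) (hFb : ∃ C, ∀ x, |F x| ≤ C)
    (hG : Continuous G) (hGb : ∃ C, ∀ x, |G x| ≤ C) (x : EuclideanSpace ℝ (Fin d)) :
    mconv m F x - mconv m G x = mconv m (fun z => F z - G z) x := by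
  obtain ⟨C, hC⟩ := hFb
  obtain ⟨C', hC'⟩ := hGb
  exact (integral_sub (integrable_sub_of_bound m hF hC x)
    (integrable_sub_of_bound m hG hC' x)).symm

/-- The factors are exchanged one coordinate at a time. Each exchange is a partial derivative of the
tensor product with `τ` in that coordinate, and the remaining factors have integral `1`, so its cost
is at most the total mass times `∫ |τ|`. -/
lemma DerivativeEstimate.integral_abs_mixed_sub_le (hE : DerivativeEstimate κ η) (n m : ℕ)
    (s : Finset (Fin d)) :
    ∫ x, |mconv κ (tensor fun j => if j ∈ s then bump n else bump m) x - mconv κ (kernelT d m) x|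
      ≤ s.card * ((η.real univ + κ.real univ)
        * (2 * (1 / ((n : ℝ) + 1) + 1 / ((m : ℝ) + 1)))) := by
  obtain ⟨τ, hτ, hτs, hτd, hτi⟩ := exists_primitive_bump_sub n m
  have hcd : ∀ (s : Finset (Fin d)) (j : Fin d),
      ContDiff ℝ 1 (if j ∈ s then bump n else bump m) := fun s j => by
    split_ifs
    · exact contDiff_bump n
    · exact contDiff_bump m
  have hcs : ∀ (s : Finset (Fin d)) (j : Fin d),
      HasCompactSupport (if j ∈ s then bump n else bump m) := fun s j => by
    split_ifs
    · exact hasCompactSupport_bump n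
    · exact hasCompactSupport_bump m
  have hint : ∀ s : Finset (Fin d),
      Integrable (mconv κ (tensor fun j => if j ∈ s then bump n else bump m)) := fun s =>
    integrable_mconv κ (integrable_tensor (fun j => (hcd s j).continuous) (hcs s))
  have hint' := integrable_mconv κ (integrable_kernelT d m)
  induction s using Finset.induction_on with
  | empty => simp [kernelT]
  | insert i s hi ih =>
    set g : Fin d → ℝ → ℝ := fun j => if j ∈ s then bump n else bump m with hg
    have eg : (fun j => if j ∈ insert i s then bump n else bump m) = Function.update g i (bump n) := by
      funext j
      by_cases h : j = i
      · subst h; simp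
      · rw [Function.update_of_ne h]; simp [hg, h]
    have eg' : g = Function.update g i (bump m) := by
      rw [eq_comm, Function.update_eq_self_iff]
      simp [hg, hi]
    let G := Function.update g i τ
    have hGi : G i = τ := Function.update_self _ _ _
    have hGc : ∀ j, ContDiff ℝ 1 (G j) := fun j => by
      by_cases h : j = i
      · subst h; rw [hGi]; exact hτ
      · simp only [G]; rw [Function.update_of_ne h]; exact hcd s j
    have hGs : ∀ j, HasCompactSupport (G j) := hasCompactSupport_update (hcs s) i hτs
    have hstep : ∀ x, mconv κ (tensor fun j => if j ∈ insert i s then bump n else bump m) x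
        - mconv κ (tensor g) x = mconv κ (tensor (Function.update G i (deriv (G i)))) x := by
      intro x
      rw [mconv_sub (continuous_tensor fun j => (hcd _ j).continuous)
        (exists_bound_tensor (fun j => (hcd _ j).continuous) (hcs _))
        (continuous_tensor fun j => (hcd _ j).continuous)
        (exists_bound_tensor (fun j => (hcd _ j).continuous) (hcs _))]
      congr 1
      funext z
      rw [eg, hGi]
      simp only [G, Function.update_idem]
      have et : tensor g z = bump m (z i) * ∏ j ∈ Finset.univ.erase i, g j (z j) := by
        conv_lhs => rw [eg']
        rw [tensor_update]
      change _ - tensor g z = _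
      rw [tensor_update, tensor_update, hτd, et]
      ring
    have hprod : ∏ j, ∫ t, |G j t| = ∫ t, |τ t| := by
      rw [← Finset.mul_prod_erase _ _ (Finset.mem_univ i), hGi, Finset.prod_eq_one, mul_one]
      intro j hj
      simp only [G]
      rw [Function.update_of_ne (Finset.ne_of_mem_erase hj)]
      simp only [hg]
      split_ifs
      · simp only [abs_of_nonneg (bump_nonneg n _), integral_bump]
      · simp only [abs_of_nonneg (bump_nonneg m _), integral_bump]
    have hb := hE.integral_abs_le i hGc hGs
    rw [hprod] at hb
    simp only [← hstep] at hb
    have hC : 0 ≤ η.real univ + κ.real univ := by positivity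
    have hb' := hb.trans (mul_le_mul_of_nonneg_left hτi hC)
    have htri : ∫ x, |mconv κ (tensor fun j => if j ∈ insert i s then bump n else bump m) x
          - mconv κ (kernelT d m) x|
        ≤ (∫ x, |mconv κ (tensor fun j => if j ∈ insert i s then bump n else bump m) x
          - mconv κ (tensor g) x|) + ∫ x, |mconv κ (tensor g) x - mconv κ (kernelT d m) x| :=
      integral_abs_sub_le_add (hint _) (hint s) hint'
    rw [Finset.card_insert_of_notMem hi]
    push_cast
    linarith

/-- The mollifications of `κ` form a Cauchy sequence in `L¹`. -/
lemma DerivativeEstimate.integral_abs_sub_le (hE : DerivativeEstimate κ η) (n m : ℕ) :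
    ∫ x, |mconv κ (kernelT d n) x - mconv κ (kernelT d m) x|
      ≤ (2 * d * (η.real univ + κ.real univ)) * (1 / ((n : ℝ) + 1) + 1 / ((m : ℝ) + 1)) := by
  have h := hE.integral_abs_mixed_sub_le n m Finset.univ
  simp only [Finset.mem_univ, if_true, Finset.card_univ, Fintype.card_fin] at h
  refine h.trans (le_of_eq ?_)
  ring

end Estimate

/-! ### The density as an `L¹` limit of mollifications. -/

section Density

variable {d : ℕ} {κ η : Measure (EuclideanSpace ℝ (Fin d))} [IsFiniteMeasure κ] [IsFiniteMeasure η]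

/-- Completeness of `L¹` gives the limit. Passing to its positive part makes it nonnegative at every
point and does not increase the distance to the mollifications, which are nonnegative. -/
lemma DerivativeEstimate.exists_limit (hE : DerivativeEstimate κ η) :
    ∃ ξ : EuclideanSpace ℝ (Fin d) → ℝ, Measurable ξ ∧ (∀ x, 0 ≤ ξ x) ∧ Integrable ξ ∧
      Tendsto (fun n => ∫ x, |mconv κ (kernelT d n) x - ξ x|) atTop (𝓝 0) := by
  have hp := fun n => integrable_mconv κ (integrable_kernelT d n)
  have hdist : ∀ n m, dist ((hp n).toL1 _) ((hp m).toL1 _)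
      = ∫ x, |mconv κ (kernelT d n) x - mconv κ (kernelT d m) x| := fun n m => by
    rw [dist_eq_norm, ← Integrable.toL1_sub, L1.norm_of_fun_eq_integral_norm]
    rfl
  have hδ : Tendsto (fun n : ℕ => 1 / ((n : ℝ) + 1)) atTop (𝓝 0) :=
    tendsto_one_div_add_atTop_nhds_zero_nat
  have hc : CauchySeq fun n => (hp n).toL1 _ := by
    rw [cauchySeq_iff_tendsto_dist_atTop_0, ← prod_atTop_atTop_eq]
    have h2 := ((hδ.comp (tendsto_fst (g := atTop))).add
      (hδ.comp (tendsto_snd (f := atTop)))).const_mul (2 * d * (η.real univ + κ.real univ))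
    rw [add_zero, mul_zero] at h2
    refine squeeze_zero (fun _ => dist_nonneg) (fun q => ?_) h2
    rw [hdist]
    exact hE.integral_abs_sub_le _ _
  obtain ⟨F, hF⟩ := cauchySeq_tendsto_of_complete hc
  have hFm : Measurable F := (Lp.stronglyMeasurable F).measurable
  have hFi : Integrable F := L1.integrable_coeFn F
  refine ⟨fun x => max (F x) 0, hFm.max measurable_const, fun x => le_max_right _ _,
    hFi.pos_part, ?_⟩
  rw [tendsto_iff_dist_tendsto_zero] at hF
  refine squeeze_zero (fun n => integral_nonneg fun x => abs_nonneg _) (fun n => ?_) hF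
  have h3 : dist ((hp n).toL1 _) F = ∫ x, |mconv κ (kernelT d n) x - F x| := by
    rw [dist_eq_norm, L1.norm_eq_integral_norm]
    refine integral_congr_ae ?_
    filter_upwards [Lp.coeFn_sub ((hp n).toL1 _) F, (hp n).coeFn_toL1] with x h4 h5
    rw [h4, Pi.sub_apply, h5]
    rfl
  rw [h3]
  refine integral_mono ((hp n).sub hFi.pos_part).abs ((hp n).sub hFi).abs fun x => ?_
  have h0 := mconv_nonneg κ (kernelT_nonneg d n) x
  simp only
  rcases le_total (F x) 0 with h | h
  · rw [max_eq_right h, sub_zero, abs_of_nonneg h0, abs_of_nonneg (by linarith)]; linarith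
  · rw [max_eq_left h]

lemma kernelT_neg (d n : ℕ) (x : EuclideanSpace ℝ (Fin d)) : kernelT d n (-x) = kernelT d n x := by
  unfold kernelT tensor
  exact Finset.prod_congr rfl fun j _ => bump_neg n (x j)

lemma tendsto_support_kernelT (d : ℕ) :
    Tendsto (fun n => Function.support (kernelT d n)) atTop (𝓝 0).smallSets := by
  rw [tendsto_smallSets_iff]
  intro t ht
  have hcont : Tendsto (fun v : Fin d → ℝ => (WithLp.toLp 2 v : EuclideanSpace ℝ (Fin d))) (𝓝 0)
      (𝓝 0) := (PiLp.continuous_toLp 2 _).tendsto 0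
  obtain ⟨ε, hε, hsub⟩ := Metric.mem_nhds_iff.1 (hcont ht)
  have hδ : Tendsto (fun n : ℕ => 1 / ((n : ℝ) + 1)) atTop (𝓝 0) :=
    tendsto_one_div_add_atTop_nhds_zero_nat
  filter_upwards [hδ.eventually (gt_mem_nhds hε)] with n hn x hx
  have hx' : ∏ j, bump n (x j) ≠ 0 := hx
  refine hsub (a := fun j => x j) ?_
  rw [mem_ball_zero_iff, pi_norm_lt_iff hε]
  intro j
  by_contra h
  exact Finset.prod_ne_zero_iff.1 hx' j (Finset.mem_univ j) (bump_eq_zero (hn.le.trans (not_lt.1 h)))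

/-- Fubini and the evenness of the mollifier move the convolution onto `ψ`, where it converges
pointwise and stays bounded by `‖ψ‖`. -/
lemma tendsto_integral_mconv_mul (ψ : BoundedContinuousFunction (EuclideanSpace ℝ (Fin d)) ℝ) :
    Tendsto (fun n => ∫ x, ψ x * mconv κ (kernelT d n) x) atTop (𝓝 (∫ y, ψ y ∂κ)) := by
  have hψ : ∀ x, ‖ψ x‖ ≤ ‖ψ‖ := ψ.norm_coe_le_norm
  have e : ∀ n, ∫ x, ψ x * mconv κ (kernelT d n) x
      = ∫ y, (∫ z, kernelT d n z * ψ (y - z)) ∂κ := by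
    intro n
    have h1 : ∀ x, ψ x * mconv κ (kernelT d n) x = ∫ y, ψ x * kernelT d n (x - y) ∂κ := fun x =>
      (integral_const_mul _ _).symm
    simp only [h1]
    rw [integral_integral_swap]
    · refine integral_congr_ae (Eventually.of_forall fun y => ?_)
      simp only
      rw [← integral_sub_left_eq_self (fun x => ψ x * kernelT d n (x - y)) volume y]
      refine integral_congr_ae (Eventually.of_forall fun z => ?_)
      simp only
      rw [sub_sub_cancel_left, kernelT_neg, mul_comm]
    · exact (integrable_mconv_integrand κ (integrable_kernelT d n)).bdd_mul
        (ψ.continuous.comp continuous_fst).aestronglyMeasurable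
        (Eventually.of_forall fun p => hψ p.1)
  simp only [e]
  refine tendsto_integral_of_dominated_convergence (fun _ => ‖ψ‖) (fun n => ?_)
    (integrable_const _) (fun n => Eventually.of_forall fun y => ?_)
    (Eventually.of_forall fun y => ?_)
  · refine Continuous.aestronglyMeasurable (continuous_of_dominated
      (bound := fun z => kernelT d n z * ‖ψ‖) (fun y => ?_)
      (fun y => Eventually.of_forall fun z => ?_) ((integrable_kernelT d n).mul_const _)
      (Eventually.of_forall fun z => ?_))
    · exact ((continuous_kernelT d n).mul
        (ψ.continuous.comp (continuous_const.sub continuous_id))).aestronglyMeasurable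
    · rw [norm_mul, Real.norm_of_nonneg (kernelT_nonneg d n z)]
      exact mul_le_mul_of_nonneg_left (hψ _) (kernelT_nonneg d n z)
    · exact continuous_const.mul (ψ.continuous.comp (continuous_id.sub continuous_const))
  · refine (norm_integral_le_of_norm_le ((integrable_kernelT d n).mul_const ‖ψ‖)
      (Eventually.of_forall fun z => ?_)).trans ?_
    · rw [norm_mul, Real.norm_of_nonneg (kernelT_nonneg d n z)]
      exact mul_le_mul_of_nonneg_left (hψ _) (kernelT_nonneg d n z)
    · rw [integral_mul_const, integral_kernelT, one_mul]
  · exact convolution_tendsto_right (μ := volume) (φ := fun n => kernelT d n) (g := fun _ => ψ)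
      (k := fun _ => y) (x₀ := y)
      (Eventually.of_forall fun n => kernelT_nonneg d n)
      (Eventually.of_forall fun n => integral_kernelT d n) (tendsto_support_kernelT d)
      (Eventually.of_forall fun n => ψ.continuous.aestronglyMeasurable)
      ((ψ.continuous.tendsto y).comp tendsto_snd) tendsto_const_nhds

/-- The mollifications tend to `κ` weakly and to `ξ` in `L¹`, so both measures give the same
integrals to bounded continuous functions. -/
lemma eq_withDensity_of_tendsto {ξ : EuclideanSpace ℝ (Fin d) → ℝ} (hξ : Measurable ξ)
    (hξ0 : ∀ x, 0 ≤ ξ x) (hξi : Integrable ξ)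
    (hlim : Tendsto (fun n => ∫ x, |mconv κ (kernelT d n) x - ξ x|) atTop (𝓝 0)) :
    κ = volume.withDensity fun x => ENNReal.ofReal (ξ x) := by
  have : IsFiniteMeasure (volume.withDensity fun x => ENNReal.ofReal (ξ x)) :=
    isFiniteMeasure_withDensity_ofReal hξi.2
  refine ext_of_forall_integral_eq_of_IsFiniteMeasure fun ψ => ?_
  rw [integral_withDensity_eq_integral_toReal_smul hξ.ennreal_ofReal
    (Eventually.of_forall fun x => ENNReal.ofReal_lt_top)]
  simp only [ENNReal.toReal_ofReal (hξ0 _), smul_eq_mul]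
  refine tendsto_nhds_unique (tendsto_integral_mconv_mul ψ) ?_
  have hψ : ∀ x, ‖ψ x‖ ≤ ‖ψ‖ := ψ.norm_coe_le_norm
  have hψm : AEStronglyMeasurable ψ (volume : Measure (EuclideanSpace ℝ (Fin d))) :=
    ψ.continuous.aestronglyMeasurable
  rw [tendsto_iff_dist_tendsto_zero]
  refine squeeze_zero (fun _ => dist_nonneg) (fun n => ?_) (by simpa using hlim.const_mul ‖ψ‖)
  have hp := integrable_mconv κ (integrable_kernelT d n)
  have e : (∫ x, ψ x * mconv κ (kernelT d n) x) - ∫ x, ξ x * ψ x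
      = ∫ x, ψ x * (mconv κ (kernelT d n) x - ξ x) := by
    have i1 : Integrable fun x => ψ x * mconv κ (kernelT d n) x :=
      hp.bdd_mul hψm (Eventually.of_forall hψ)
    have i2 : Integrable fun x => ξ x * ψ x := hξi.mul_bdd hψm (Eventually.of_forall hψ)
    refine (integral_sub i1 i2).symm.trans (integral_congr_ae (Eventually.of_forall fun x => ?_))
    simp only
    ring
  rw [Real.dist_eq, e, ← integral_const_mul ‖ψ‖ fun x => |mconv κ (kernelT d n) x - ξ x|]
  change ‖∫ x, ψ x * (mconv κ (kernelT d n) x - ξ x)‖ ≤ _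
  refine norm_integral_le_of_norm_le ((hp.sub hξi).abs.const_mul _) (Eventually.of_forall fun x => ?_)
  rw [norm_mul]
  exact mul_le_mul_of_nonneg_right (hψ x) (norm_nonneg _)

end Density

/-! ### The Sobolev bound for the root of the density. -/

section WeakDerivative

variable {d : ℕ} {κ η : Measure (EuclideanSpace ℝ (Fin d))} [IsFiniteMeasure κ] [IsFiniteMeasure η]

lemma continuous_mconv_kernelT (n : ℕ) : Continuous (mconv κ (kernelT d n)) := by
  obtain ⟨C, hC⟩ := exists_bound_tensor (fun _ : Fin d => continuous_bump n)
    (fun _ => hasCompactSupport_bump n)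
  exact continuous_mconv κ (continuous_kernelT d n) hC

/-- From `(∂_i p)² ≤ 4 q p`, where `q` is the mollification of `η`, follows `(∂_i √(p + δ))² = (∂_i
p)² / (4 (p + δ)) ≤ q`, and `q` has integral `η(ℝ^d)`. The shift `δ` keeps the root differentiable
where `p` vanishes. -/
lemma DerivativeEstimate.integral_sqrt_mul_sq_le (hE : DerivativeEstimate κ η) (n : ℕ) {δ : ℝ}
    (hδ : 0 < δ) (i : Fin d) {φ : EuclideanSpace ℝ (Fin d) → ℝ} (hφ : ContDiff ℝ ∞ φ)
    (hφs : HasCompactSupport φ) :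
    (∫ y, √(mconv κ (kernelT d n) y + δ) * fderiv ℝ φ y (EuclideanSpace.single i 1)) ^ 2
      ≤ η.real univ * ∫ y, φ y ^ 2 := by
  set p := mconv κ (kernelT d n) with hp
  set g : Fin d → ℝ → ℝ := fun _ => bump n
  have hg : ∀ j, ContDiff ℝ 1 (g j) := fun _ => contDiff_bump n
  have hgs : ∀ j, HasCompactSupport (g j) := fun _ => hasCompactSupport_bump n
  set p' := mconv κ (tensor (Function.update g i (deriv (g i)))) with hp'
  have hpc : Continuous p := continuous_mconv_kernelT n
  have hp'c : Continuous p' := by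
    have hc := continuous_update_deriv hg i
    obtain ⟨C, hC⟩ := exists_bound_tensor hc (hasCompactSupport_update hgs i (hgs i).deriv)
    exact continuous_mconv κ (continuous_tensor hc) hC
  have hp0 : ∀ x, 0 ≤ p x := mconv_nonneg κ (kernelT_nonneg d n)
  have hpos : ∀ x, 0 < p x + δ := fun x => by linarith [hp0 x]
  have hsq : ∀ x, 0 < √(p x + δ) := fun x => Real.sqrt_pos.2 (hpos x)
  set w : EuclideanSpace ℝ (Fin d) → ℝ := fun x => p' x / (2 * √(p x + δ)) with hw
  have huc : Continuous fun x => √(p x + δ) := (hpc.add continuous_const).sqrt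
  have hwc : Continuous w := hp'c.div (continuous_const.mul huc) fun x => by
    have := hsq x; positivity
  have hder : ∀ x, HasLineDerivAt ℝ (fun x => √(p x + δ)) (w x) x (EuclideanSpace.single i 1) := by
    intro x
    have h1 : HasDerivAt (fun t : ℝ => p (x + t • EuclideanSpace.single i 1)) (p' x) 0 :=
      hasLineDerivAt_mconv_tensor κ hg hgs i x
    have h2 := (h1.add_const δ).sqrt (hpos _).ne'
    simp only [zero_smul, add_zero] at h2
    exact h2
  have hw2 : ∀ x, w x ^ 2 ≤ mconv η (kernelT d n) x := by
    intro x
    have h1 := hE.mconv_sq_le i hg hgs x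
    have h2 : (tensor fun (j : Fin d) t => |g j t|) = kernelT d n := by
      simp only [g, abs_of_nonneg (bump_nonneg n _)]
      rfl
    rw [h2, ← hp, ← hp'] at h1
    have hq0 := mconv_nonneg η (kernelT_nonneg d n) x
    simp only [hw]
    rw [div_pow, mul_pow, Real.sq_sqrt (hpos x).le, div_le_iff₀ (by have := hpos x; positivity)]
    nlinarith [mul_nonneg hq0 hδ.le]
  have hφd : Continuous fun y => fderiv ℝ φ y (EuclideanSpace.single i 1) :=
    (hφ.continuous_fderiv (by simp)).clm_apply continuous_const
  have hφds : HasCompactSupport fun y => fderiv ℝ φ y (EuclideanSpace.single i 1) :=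
    hφs.fderiv_apply ℝ _
  have hibp : ∫ y, √(p y + δ) * fderiv ℝ φ y (EuclideanSpace.single i 1) = -∫ y, w y * φ y :=
    integral_bilinear_hasLineDerivAt_right_eq_neg_left_of_integrable
      (B := ContinuousLinearMap.mul ℝ ℝ)
      ((hwc.mul hφ.continuous).integrable_of_hasCompactSupport hφs.mul_left)
      ((huc.mul hφd).integrable_of_hasCompactSupport hφds.mul_left)
      ((huc.mul hφ.continuous).integrable_of_hasCompactSupport hφs.mul_left)
      (fun x _ => hder x)
      (fun x _ => ((hφ.differentiable (by simp)) x).hasFDerivAt.hasLineDerivAt _)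
  have hqi := integrable_mconv η (integrable_kernelT d n)
  have hwi : Integrable fun x => w x ^ 2 :=
    hqi.mono' (hwc.pow 2).aestronglyMeasurable (Eventually.of_forall fun x => by
      rw [Real.norm_of_nonneg (sq_nonneg _)]; exact hw2 x)
  rw [hibp, neg_sq]
  refine (integral_mul_sq_le ((memLp_two_iff_integrable_sq hwc.aestronglyMeasurable).2 hwi)
    (hφ.continuous.memLp_of_hasCompactSupport hφs)).trans ?_
  refine mul_le_mul_of_nonneg_right ?_ (integral_nonneg fun x => sq_nonneg _)
  refine (integral_mono hwi hqi hw2).trans ?_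
  rw [integral_mconv η (integrable_kernelT d n), integral_kernelT, mul_one]

lemma abs_sqrt_add_sub_sqrt_le {a b δ : ℝ} (ha : 0 ≤ a) (hb : 0 ≤ b) (hδ : 0 ≤ δ) :
    |√(a + δ) - √b| ≤ √δ + √|a - b| := by
  have key : ∀ {x y : ℝ}, 0 ≤ x → 0 ≤ y → √(x + y) ≤ √x + √y := fun {x y} hx hy =>
    Real.sqrt_le_iff.2 ⟨by positivity, by
      nlinarith [Real.sq_sqrt hx, Real.sq_sqrt hy, Real.sqrt_nonneg x, Real.sqrt_nonneg y,
        mul_nonneg (Real.sqrt_nonneg x) (Real.sqrt_nonneg y)]⟩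
  have h1 : √a ≤ √b + √|a - b| :=
    (Real.sqrt_le_sqrt (by linarith [le_abs_self (a - b)])).trans (key hb (abs_nonneg _))
  have h2 : √b ≤ √(a + δ) + √|a - b| :=
    (Real.sqrt_le_sqrt (by linarith [neg_abs_le (a - b)])).trans
      (key (add_nonneg ha hδ) (abs_nonneg _))
  have h3 := key ha hδ
  exact abs_le.2 ⟨by linarith [Real.sqrt_nonneg δ], by linarith⟩

/-- The shift `1 / (n + 1)` vanishes along with the mollification. Since `|√a - √b| ≤ √|a - b|`,
Cauchy-Schwarz turns `L¹` convergence of the densities into convergence of the roots against `ψ`. -/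
lemma tendsto_integral_sqrt_mul {ξ : EuclideanSpace ℝ (Fin d) → ℝ} (hξ : Measurable ξ)
    (hξ0 : ∀ x, 0 ≤ ξ x) (hξi : Integrable ξ)
    (hlim : Tendsto (fun n => ∫ x, |mconv κ (kernelT d n) x - ξ x|) atTop (𝓝 0))
    {ψ : EuclideanSpace ℝ (Fin d) → ℝ} (hψ : Continuous ψ) (hψs : HasCompactSupport ψ) :
    Tendsto (fun n : ℕ => ∫ x, √(mconv κ (kernelT d n) x + 1 / ((n : ℝ) + 1)) * ψ x) atTop
      (𝓝 (∫ x, √(ξ x) * ψ x)) := by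
  have hψi : Integrable ψ := hψ.integrable_of_hasCompactSupport hψs
  have hψ2 : MemLp ψ 2 := hψ.memLp_of_hasCompactSupport hψs
  have hξ2 : MemLp (fun x => √(ξ x)) 2 := by
    rw [memLp_two_iff_integrable_sq hξ.sqrt.aestronglyMeasurable]
    simpa only [Real.sq_sqrt (hξ0 _)] using hξi
  have hξψ : Integrable fun x => √(ξ x) * ψ x := hξ2.integrable_mul hψ2
  have hδ : Tendsto (fun n : ℕ => 1 / ((n : ℝ) + 1)) atTop (𝓝 0) :=
    tendsto_one_div_add_atTop_nhds_zero_nat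
  have hb : Tendsto (fun n : ℕ => √(1 / ((n : ℝ) + 1)) * (∫ x, |ψ x|) +
      √((∫ x, |mconv κ (kernelT d n) x - ξ x|) * ∫ x, |ψ x| ^ 2)) atTop (𝓝 0) := by
    have h1 := (hδ.sqrt.mul_const (∫ x, |ψ x|)).add (hlim.mul_const (∫ x, |ψ x| ^ 2)).sqrt
    simpa using h1
  rw [tendsto_iff_dist_tendsto_zero]
  refine squeeze_zero (fun _ => dist_nonneg) (fun n => ?_) hb
  set p := mconv κ (kernelT d n) with hp
  have hpi : Integrable p := integrable_mconv κ (integrable_kernelT d n)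
  have hpc : Continuous p := continuous_mconv_kernelT n
  have hp0 : ∀ x, 0 ≤ p x := mconv_nonneg κ (kernelT_nonneg d n)
  have hδ0 : (0 : ℝ) ≤ 1 / ((n : ℝ) + 1) := by positivity
  have hpψ : Integrable fun x => √(p x + 1 / ((n : ℝ) + 1)) * ψ x :=
    ((hpc.add continuous_const).sqrt.mul hψ).integrable_of_hasCompactSupport hψs.mul_left
  have hr2 : MemLp (fun x => √|p x - ξ x|) 2 := by
    have hm : Measurable fun x => √|p x - ξ x| := (hpc.measurable.sub hξ).norm.sqrt
    rw [memLp_two_iff_integrable_sq hm.aestronglyMeasurable]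
    simp only [Real.sq_sqrt (abs_nonneg _)]
    exact (hpi.sub hξi).abs
  have hψa : MemLp (fun x => |ψ x|) 2 := hψ2.norm
  have hrψ : Integrable fun x => √|p x - ξ x| * |ψ x| := hr2.integrable_mul hψa
  have hcs := integral_mul_sq_le hr2 hψa
  simp only [Real.sq_sqrt (abs_nonneg _)] at hcs
  rw [Real.dist_eq, ← integral_sub hpψ hξψ]
  calc |∫ x, (√(p x + 1 / ((n : ℝ) + 1)) * ψ x - √(ξ x) * ψ x)|
      ≤ ∫ x, (√(1 / ((n : ℝ) + 1)) * |ψ x| + √|p x - ξ x| * |ψ x|) := by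
        change ‖∫ x, (√(p x + 1 / ((n : ℝ) + 1)) * ψ x - √(ξ x) * ψ x)‖ ≤ _
        refine norm_integral_le_of_norm_le ((hψi.abs.const_mul _).add hrψ)
          (Eventually.of_forall fun x => ?_)
        rw [← sub_mul, norm_mul, ← add_mul]
        exact mul_le_mul_of_nonneg_right (abs_sqrt_add_sub_sqrt_le (hp0 x) (hξ0 x) hδ0)
          (norm_nonneg _)
    _ = √(1 / ((n : ℝ) + 1)) * (∫ x, |ψ x|) + ∫ x, √|p x - ξ x| * |ψ x| := by
        rw [integral_add (hψi.abs.const_mul _) hrψ, integral_const_mul]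
    _ ≤ _ := by
        gcongr
        exact Real.le_sqrt_of_sq_le hcs

/-- Smooth compactly supported functions. -/
def testFunctions (d : ℕ) : Submodule ℝ (EuclideanSpace ℝ (Fin d) → ℝ) where
  carrier := {φ | ContDiff ℝ ∞ φ ∧ HasCompactSupport φ}
  add_mem' h h' := ⟨h.1.add h'.1, h.2.add h'.2⟩
  zero_mem' := ⟨contDiff_const, HasCompactSupport.zero⟩
  smul_mem' _ _ h := ⟨contDiff_const.smul h.1, h.2.smul_left⟩

lemma memLp_testFunctions (φ : testFunctions d) :
    MemLp (φ : EuclideanSpace ℝ (Fin d) → ℝ) 2 volume :=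
  φ.2.1.continuous.memLp_of_hasCompactSupport φ.2.2

/-- The functional `φ ↦ -∫ u ∂_i φ` is bounded for the `L²` norm, so it extends to `L²` and Riesz
representation yields the weak derivative. -/
lemma exists_weak_derivative {u : EuclideanSpace ℝ (Fin d) → ℝ} (hu : MemLp u 2 volume) {C : ℝ}
    (hC : 0 ≤ C) (i : Fin d)
    (hle : ∀ φ : EuclideanSpace ℝ (Fin d) → ℝ, ContDiff ℝ ∞ φ → HasCompactSupport φ →
      (∫ y, u y * fderiv ℝ φ y (EuclideanSpace.single i 1)) ^ 2 ≤ C * ∫ y, φ y ^ 2) :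
    ∃ g : EuclideanSpace ℝ (Fin d) → ℝ, MemLp g 2 volume ∧
      ∀ φ : EuclideanSpace ℝ (Fin d) → ℝ, ContDiff ℝ ∞ φ → HasCompactSupport φ →
        ∫ y, u y * fderiv ℝ φ y (EuclideanSpace.single i 1) = - ∫ y, g y * φ y := by
  have hint : ∀ φ : testFunctions d, Integrable fun y =>
      u y * fderiv ℝ (φ : EuclideanSpace ℝ (Fin d) → ℝ) y (EuclideanSpace.single i 1) := fun φ =>
    hu.integrable_mul (q := 2) (((φ.2.1.continuous_fderiv (by simp)).clm_apply
      continuous_const).memLp_of_hasCompactSupport (φ.2.2.fderiv_apply ℝ _))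
  have hdiff : ∀ φ : testFunctions d, Differentiable ℝ (φ : EuclideanSpace ℝ (Fin d) → ℝ) :=
    fun φ => φ.2.1.differentiable (by simp)
  let ι : testFunctions d →ₗ[ℝ] Lp ℝ 2 (volume : Measure (EuclideanSpace ℝ (Fin d))) :=
    { toFun := fun φ => (memLp_testFunctions φ).toLp _
      map_add' := fun φ ψ => (memLp_testFunctions φ).toLp_add (memLp_testFunctions ψ)
      map_smul' := fun c φ => (memLp_testFunctions φ).toLp_const_smul c }
  let Λ : testFunctions d →ₗ[ℝ] ℝ :=
    { toFun := fun φ => -∫ y, u y *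
        fderiv ℝ (φ : EuclideanSpace ℝ (Fin d) → ℝ) y (EuclideanSpace.single i 1)
      map_add' := fun φ ψ => by
        rw [← neg_add, ← integral_add (hint φ) (hint ψ)]
        refine congrArg Neg.neg (integral_congr_ae (Eventually.of_forall fun y => ?_))
        simp only [Submodule.coe_add]
        rw [fderiv_add (hdiff φ y) (hdiff ψ y), add_apply, mul_add]
      map_smul' := fun c φ => by
        rw [RingHom.id_apply, smul_eq_mul, mul_neg, ← integral_const_mul]
        refine congrArg Neg.neg (integral_congr_ae (Eventually.of_forall fun y => ?_))
        simp only [Submodule.coe_smul]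
        rw [fderiv_const_smul (hdiff φ y), smul_apply, smul_eq_mul]
        ring }
  have hinner : ∀ (g : Lp ℝ 2 (volume : Measure (EuclideanSpace ℝ (Fin d)))) (φ : testFunctions d),
      inner ℝ g (ι φ) = ∫ y, g y * (φ : EuclideanSpace ℝ (Fin d) → ℝ) y := by
    intro g φ
    rw [L2.inner_def]
    refine integral_congr_ae ?_
    filter_upwards [(memLp_testFunctions φ).coeFn_toLp] with y hy
    change inner ℝ (g y) ((memLp_testFunctions φ).toLp _ y) = _
    rw [hy]
    exact mul_comm _ _
  have hnorm : ∀ φ : testFunctions d, ‖ι φ‖ ^ 2 =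
      ∫ y, (φ : EuclideanSpace ℝ (Fin d) → ℝ) y ^ 2 := by
    intro φ
    rw [← real_inner_self_eq_norm_sq, hinner]
    refine integral_congr_ae ?_
    filter_upwards [(memLp_testFunctions φ).coeFn_toLp] with y hy
    change ((memLp_testFunctions φ).toLp _ y) * _ = _
    rw [hy, sq]
  obtain ⟨g, hg⟩ := exists_inner_eq_of_bounded (C := √C) ι Λ fun φ => by
    refine abs_le_of_sq_le_sq ?_ (by positivity)
    rw [mul_pow, Real.sq_sqrt hC, hnorm]
    change (-_) ^ 2 ≤ _
    rw [neg_sq]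
    exact hle φ φ.2.1 φ.2.2
  refine ⟨g, Lp.memLp g, fun φ hφ hφs => ?_⟩
  have h1 := hg ⟨φ, hφ, hφs⟩
  rw [hinner] at h1
  rw [← h1]
  exact (neg_neg _).symm

/-- The bound on the regularized roots depends neither on `n` nor on the shift, so it survives the
limit. -/
lemma DerivativeEstimate.memW12_sqrt (hE : DerivativeEstimate κ η)
    {ξ : EuclideanSpace ℝ (Fin d) → ℝ} (hξ : Measurable ξ)
    (hξ0 : ∀ x, 0 ≤ ξ x) (hξi : Integrable ξ)
    (hlim : Tendsto (fun n => ∫ x, |mconv κ (kernelT d n) x - ξ x|) atTop (𝓝 0)) :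
    MemW12 fun y => √(ξ y) := by
  have hξ2 : MemLp (fun x => √(ξ x)) 2 := by
    rw [memLp_two_iff_integrable_sq hξ.sqrt.aestronglyMeasurable]
    simpa only [Real.sq_sqrt (hξ0 _)] using hξi
  refine ⟨hξ2, fun i => exists_weak_derivative hξ2 measureReal_nonneg (C := η.real univ) i
    fun φ hφ hφs => ?_⟩
  exact le_of_tendsto' ((tendsto_integral_sqrt_mul hξ hξ0 hξi hlim
    ((hφ.continuous_fderiv (by simp)).clm_apply continuous_const)
    (hφs.fderiv_apply ℝ (EuclideanSpace.single i 1))).pow 2) fun n =>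
    hE.integral_sqrt_mul_sq_le n (by positivity) i hφ hφs

end WeakDerivative

end

theorem mainTheorem4 {K : Type*} [TopologicalSpace K] [LocallyCompactSpace K]
    [TopologicalSpace.SeparableSpace K] [TopologicalSpace.MetrizableSpace K]
    [MeasurableSpace K] [BorelSpace K]
    (μ : Measure K) [IsFiniteMeasureOnCompacts μ] [μ.IsOpenPosMeasure]
    (D : DirichletForm μ) (hreg : D.IsRegular) (hloc : D.IsStrongLocal)
    (n : Measure K) (hn : D.IsMinimalEnergyDominant n)
    (S : Set K) (hS : IsClosed S)
    (d : ℕ) (hd : 1 ≤ d)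
    (h : Fin d → D.domain) (hharm : ∀ i, D.IsHarmonic S (h i))
    (hPhi : ∀ᵐ x ∂(D.energyMeasureVec h), D.Phi n h x = 1)
    (f : D.domain) (hfb : D.IsBdd f) (hfD : D.VanishesOn S f)
    (ht : Fin d → K → ℝ) (hht : ∀ i, D.IsQCModification (h i) (ht i))
    (ft : K → ℝ) (hft : D.IsQCModification f ft)
    (κ : Measure (EuclideanSpace ℝ (Fin d)))
    (hκ : κ = ((D.energyMeasureVec h).withDensity (fun x => ENNReal.ofReal (ft x ^ 2))).map
      (fun x => WithLp.toLp 2 (fun i => ht i x))) :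
    κ ≪ volume ∧
    ∃ ξ : EuclideanSpace ℝ (Fin d) → ℝ, Measurable ξ ∧ (∀ y, 0 ≤ ξ y) ∧
      κ = volume.withDensity (fun y => ENNReal.ofReal (ξ y)) ∧
      MemW12 (fun y => Real.sqrt (ξ y)) := by
  -- Separability gives second countability only through a metric; the core determines finite
  -- measures under the latter.
  have : SecondCountableTopology K := by
    let _ := TopologicalSpace.metrizableSpaceMetric K
    exact UniformSpace.secondCountable_of_separable K
  have := hn.1
  obtain ⟨_, η, _, hE⟩ := hloc.exists_derivative_estimate hreg hn.2.1 hharm hPhi hfb hfD hht hft hκ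
  obtain ⟨ξ, hξ, hξ0, hξi, hlim⟩ := DerivativeEstimate.exists_limit (κ := κ) (η := η) hE
  have hκξ := eq_withDensity_of_tendsto hξ hξ0 hξi hlim
  exact ⟨hκξ ▸ withDensity_absolutelyContinuous _ _, ξ, hξ, hξ0, hκξ,
    DerivativeEstimate.memW12_sqrt (κ := κ) (η := η) hE hξ hξ0 hξi hlim⟩
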